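/- **Conventions.** Signatures contain equality and are effective (symbols are coded by natural numbers, and arities are computable from codes). Ground formulae are quantifier-free formulae that may contain free constants from a fixed countable supply. A theory $T$ is a set of first-order sentences; $\vdash_T$ denotes truth in all models of $T$ under all interpretations of the free constants. *Decidable SMT problem* means that the $T$-satisfiability of ground formulae is decidable. $T$ is *stably infinite* if every $T$-satisfiable quantifier-free formula is satisfiable in an infinite model of $T$. For tuples of terms, $\underline t\cap\underline u\neq\emptyset$ denotes $\bigvee_{i,j}t_i=u_j$, and $\underline t\cap\underline u=\emptyset$ its negation. A *quantifier-free $T$-interpolant* of finite sets $A,B$ of ground formulae with $A\cup B$ $T$-unsatisfiable is a ground formula $\theta$ such that $A\vdash_T\theta$, $B\cup\{\theta\}$ is $T$-unsatisfiable, and every free constant of $\theta$ occurs in both $A$ and $B$. $T$ is *equality interpolating* if every $T$-unsatisfiable pair of quantifier-free formulae has a quantifier-free interpolant, and for all quantifier-free $\delta_1(\underline x,\underline z_1,\underline y_1)$, $\delta_2(\underline x,\underline z_2,\underline y_2)$ (pairwise disjoint tuples of distinct variables) with $\delta_1\wedge\delta_2\vdash_T\underline y_1\cap\underline y_2\neq\emptyset$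 there is a finite tuple of terms $\underline v(\underline x)$ with $\delta_1\wedge\delta_2\vdash_T\underline y_1\underline y_2\cap\underline v\neq\emptyset$. **The procedure $\mathsf{CI}(T_1,T_2)$**, for theories $T_1,T_2$ in disjoint signatures $\Sigma_1,\Sigma_2$. The input is a pair $A_0,B_0$ of finite sets of ground $\Sigma_1\cup\Sigma_2$-formulae. It is first purified: terms over the constants of $A_0$ (respectively $B_0$) are replaced in $A_0$ (respectively $B_0$) by fresh constants $d$, the definitions $d=t$ being added there, until every atom is a $\Sigma_1$-atom or a $\Sigma_2$-atom. The rules below are then applied, in any order, to pairs $A\mid B$ with $\bot\notin A\cup B$, until no rule applies. Here $A_i,B_i$ are the sets of $\Sigma_i$-literals belonging to $A$, $B$; a constant is $A$-strict if it occurs in $A$ and not in $B$ (similarly for $B$-strict), and it is common if it occurs in both; $\underline a,\underline b$ are the tuples of the $A$-strict and of the $B$-strict constants. Terms and formulae are common if all their free constants are. An $A$-relevant atom is an atom occurring in $A$ or an equation between free constants of $A$; an $A$-assignment is a Boolean assignment to the $A$-relevant atoms that satisfies $A$ propositionally, seen as a set of literals. * **Decide$_A$.** If $A$ contains no $A$-assignment,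 the outcomes are $A\cup\alpha\mid B$ for all $A$-assignments $\alpha$ (the single outcome $A\cup\{\bot\}\mid B$ if there are none). The interpolant is the disjunction of those of the outcomes. **Decide$_B$** is symmetric, with the conjunction. * **Share$_i$.** If $A_i\cup B_i$ is $T_i$-satisfiable and $A_i\cup B_i\cup\{\underline a\cap\underline b=\emptyset\}$ is not, take a tuple $\underline v$ of common $\Sigma_i$-terms with $A_i\cup B_i\vdash_{T_i}\underline a\,\underline b\cap\underline v\neq\emptyset$ and a common $\Sigma_i$-formula $\theta$ such that $A_i\cup\{\underline a\cap\underline v=\emptyset\}\vdash_{T_i}\theta$ and $B_i\cup\{\underline b\cap\underline v=\emptyset,\theta\}$ is $T_i$-unsatisfiable. The outcomes are $A\cup\{a_j=v_k\}\mid B$ for all $j,k$, and $A\cup\{\theta\}\mid B\cup\{\theta,b_j=v_k\}$ for all $j,k$, each followed by term sharing: a fresh constant $c$ is introduced, $c=v_k$ is added to both sides, and the strict constant $a_j$ (respectively $b_j$) is replaced by $c$, its added equation with $v_k$ thus becoming $c=v_k$. The interpolant is $\bigvee_{j,k}\phi_{jk}\vee(\theta\wedge\bigwedge_{j,k}\psi_{jk})$,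 where $\phi_{jk},\psi_{jk}$ are those of the outcomes with $c$ replaced by $v_k$. * **Terminate$_i$.** If $A_i\cup B_i$ is $T_i$-unsatisfiable, take a common $\Sigma_i$-formula $\theta$ such that $A_i\vdash_{T_i}\theta$ and $B_i\cup\{\theta\}$ is $T_i$-unsatisfiable. The outcome is $A\cup\{\theta\}\mid B\cup\{\theta,\bot\}$. The interpolant is the conjunction of $\theta$ and that of the outcome. A pair with $\bot\in A$ gets the interpolant $\bot$, one with $\bot\in B$ gets $\top$. If every leaf of the tree of outcomes contains $\bot$, the procedure returns the formula computed at the root by these instructions; if it reaches a pair not containing $\bot$ to which no rule applies, it reports this instead of returning a formula. **Theorem.** Let $T_1$ and $T_2$ be signature-disjoint, stably infinite, equality interpolating theories with decidable SMT problems. Then $\mathsf{CI}(T_1,T_2)$ is a quantifier-free interpolation algorithm for $T_1\cup T_2$, that is: 1. (Termination) There is no infinite sequence of pairs each of which is an outcome of a rule applied to the preceding one. 2. (Soundness) Every formula returned by $\mathsf{CI}(T_1,T_2)$ on an input $A_0,B_0$ is a quantifier-free $T_1\cup T_2$-interpolant of $A_0,B_0$. 3. (Completeness) If $A_0\cup B_0$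 is $T_1\cup T_2$-unsatisfiable, then, from every purification of $A_0,B_0$, the rules can be applied so as to return a formula, and no choices lead to a pair not containing $\bot$ to which no rule applies. 4. (Effectiveness) There is a total computable function that maps every input $A_0,B_0$ to a result of a run of $\mathsf{CI}(T_1,T_2)$ on $A_0,B_0$. -/

import Mathlib

open scoped FirstOrder

namespace CombInterp

/-! ### Ground formulae

Free constants are natural numbers; a term over the signature `L` expanded with free constants is
a Mathlib term `L.Term ℕ`.  A model together with an interpretation of the free constants is a
structure with a valuation `ℕ → M`. -/

/-- Quantifier-free (ground) formulae over `L` expanded with the free constants. -/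
inductive QF (L : FirstOrder.Language.{0, 0}) : Type
  | falsum : QF L
  | equal : L.Term ℕ → L.Term ℕ → QF L
  | rel : {n : ℕ} → L.Relations n → (Fin n → L.Term ℕ) → QF L
  | imp : QF L → QF L → QF L

namespace QF

variable {L L' : FirstOrder.Language.{0, 0}}

/-- Truth of a ground formula in a structure, under a valuation of the free constants. -/
def Realize {M : Type} [L.Structure M] (v : ℕ → M) : QF L → Prop
  | falsum => False
  | equal t u => t.realize v = u.realize v
  | rel R ts => FirstOrder.Language.Structure.RelMap R (fun i => (ts i).realize v)
  | imp φ ψ => φ.Realize v → ψ.Realize v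

def neg (φ : QF L) : QF L := imp φ falsum

def top : QF L := neg falsum

def and (φ ψ : QF L) : QF L := neg (imp φ (neg ψ))

def or (φ ψ : QF L) : QF L := imp (neg φ) ψ

def bigAnd (l : List (QF L)) : QF L := l.foldr and top

def bigOr (l : List (QF L)) : QF L := l.foldr or falsum

/-- The free constants occurring in a formula. -/
def consts : QF L → Finset ℕ
  | falsum => ∅
  | equal t u => t.varFinset ∪ u.varFinset
  | rel _ ts => Finset.univ.biUnion fun i => (ts i).varFinset
  | imp φ ψ => φ.consts ∪ ψ.consts

/-- The formula obtained by replacing the free constant `c` with the term `t`. -/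
def subst (c : ℕ) (t : L.Term ℕ) : QF L → QF L
  | falsum => falsum
  | equal u w =>
      equal (u.subst fun x => if x = c then t else FirstOrder.Language.Term.var x)
        (w.subst fun x => if x = c then t else FirstOrder.Language.Term.var x)
  | rel R ts => rel R fun i => (ts i).subst fun x => if x = c then t else FirstOrder.Language.Term.var x
  | imp φ ψ => imp (φ.subst c t) (ψ.subst c t)

/-- A formula over `L` seen as a formula over a larger signature. -/
def lift (g : L →ᴸ L') : QF L → QF L'
  | falsum => falsum
  | equal t u => equal (g.onTerm t) (g.onTerm u)
  | rel R ts => rel (g.onRelation R) fun i => g.onTerm (ts i)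
  | imp φ ψ => imp (φ.lift g) (ψ.lift g)

/-- Atomic formulae: equations and predicate symbols applied to terms. -/
def IsAtom : QF L → Prop
  | falsum => False
  | equal _ _ => True
  | rel _ _ => True
  | imp _ _ => False

/-- Literals: atomic formulae and their negations. -/
def IsLiteral (φ : QF L) : Prop := φ.IsAtom ∨ ∃ p : QF L, p.IsAtom ∧ φ = p.neg

/-- The atomic formulae occurring in a formula. -/
def atoms : QF L → Set (QF L)
  | falsum => ∅
  | equal t u => {equal t u}
  | rel R ts => {rel R ts}
  | imp φ ψ => φ.atoms ∪ ψ.atoms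

/-- Propositional truth of a formula, under a Boolean assignment to atomic formulae. -/
def PropTrue (s : QF L → Prop) : QF L → Prop
  | falsum => False
  | equal t u => s (equal t u)
  | rel R ts => s (rel R ts)
  | imp φ ψ => φ.PropTrue s → ψ.PropTrue s

end QF

/-- For tuples of terms `ts` and `us`, the formula `ts ∩ us ≠ ∅`, i.e. the disjunction of all
the equations `t = u` with `t` in `ts` and `u` in `us`. -/
def meet {L : FirstOrder.Language.{0, 0}} (ts us : List (L.Term ℕ)) : QF L :=
  QF.bigOr ((ts.product us).map fun p => QF.equal p.1 p.2)

/-- A tuple of free constants, as a tuple of terms. -/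
def vars {L : FirstOrder.Language.{0, 0}} (xs : List ℕ) : List (L.Term ℕ) := xs.map FirstOrder.Language.Term.var

/-- The free constants occurring in a finite set of formulae. -/
def constsOf {L : FirstOrder.Language.{0, 0}} (A : List (QF L)) : Finset ℕ :=
  A.foldr (fun φ s => φ.consts ∪ s) ∅

/-! ### Theories -/

section Theories

variable {L : FirstOrder.Language.{0, 0}}

/-- `Γ` is `T`-satisfiable. -/
def Sat (T : L.Theory) (Γ : Set (QF L)) : Prop :=
  ∃ (M : Type) (_ : L.Structure M), Nonempty M ∧ M ⊨ T ∧
    ∃ v : ℕ → M, ∀ φ ∈ Γ, φ.Realize v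

/-- `Γ` `T`-entails `φ`. -/
def Entails (T : L.Theory) (Γ : Set (QF L)) (φ : QF L) : Prop :=
  ∀ (M : Type) (_ : L.Structure M), Nonempty M → M ⊨ T →
    ∀ v : ℕ → M, (∀ ψ ∈ Γ, ψ.Realize v) → φ.Realize v

/-- Every `T`-satisfiable quantifier-free formula is satisfiable in an infinite model of `T`. -/
def StablyInfinite (T : L.Theory) : Prop :=
  ∀ φ : QF L, Sat T {φ} →
    ∃ (M : Type) (_ : L.Structure M), Infinite M ∧ M ⊨ T ∧ ∃ v : ℕ → M, φ.Realize v

/-- `θ` is a quantifier-free `T`-interpolant of the pair `A`, `B` of finite sets of formulae. -/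
def IsInterpolant (T : L.Theory) (A B : List (QF L)) (θ : QF L) : Prop :=
  Entails T {φ | φ ∈ A} θ ∧ ¬ Sat T ({θ} ∪ {φ | φ ∈ B}) ∧ θ.consts ⊆ constsOf A ∩ constsOf B

/-- `T` admits quantifier-free interpolation. -/
def HasQFInterpolation (T : L.Theory) : Prop :=
  ∀ φ ψ : QF L, ¬ Sat T {φ, ψ} → ∃ θ : QF L, IsInterpolant T [φ] [ψ] θ

/-- `T` is equality interpolating: it has quantifier-free interpolation, and whenever
`δ₁(x, z₁, y₁) ∧ δ₂(x, z₂, y₂)` entails `y₁ ∩ y₂ ≠ ∅` there is a tuple of terms `v(x)` such that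
`δ₁(x, z₁, y₁) ∧ δ₂(x, z₂, y₂)` entails `y₁y₂ ∩ v ≠ ∅`. -/
def EqualityInterpolating (T : L.Theory) : Prop :=
  HasQFInterpolation T ∧
  ∀ (x z₁ y₁ z₂ y₂ : List ℕ) (δ₁ δ₂ : QF L),
    (x ++ z₁ ++ y₁ ++ z₂ ++ y₂).Nodup →
    δ₁.consts ⊆ (x ++ z₁ ++ y₁).toFinset →
    δ₂.consts ⊆ (x ++ z₂ ++ y₂).toFinset →
    Entails T {δ₁, δ₂} (meet (vars y₁) (vars y₂)) →
    ∃ v : List (L.Term ℕ), (∀ t ∈ v, t.varFinset ⊆ x.toFinset) ∧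
      Entails T {δ₁, δ₂} (meet (vars (y₁ ++ y₂)) v)

end Theories

/-! ### Gödel numbers and decidability -/

section Codes

variable {L : FirstOrder.Language.{0, 0}} [Encodable (Σ n, L.Functions n)] [Encodable (Σ n, L.Relations n)]

/-- The Gödel number of a term. -/
def termCode : L.Term ℕ → ℕ
  | .var c => Nat.pair 0 c
  | .func (l := n) f ts =>
      Nat.pair 1 (Nat.pair (Encodable.encode (⟨n, f⟩ : Σ n, L.Functions n))
        (Encodable.encode (List.ofFn fun i => termCode (ts i))))

/-- The Gödel number of a formula. -/
def QF.code : QF L → ℕ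
  | .falsum => Nat.pair 0 0
  | .equal t u => Nat.pair 1 (Nat.pair (termCode t) (termCode u))
  | .rel (n := n) R ts =>
      Nat.pair 2 (Nat.pair (Encodable.encode (⟨n, R⟩ : Σ n, L.Relations n))
        (Encodable.encode (List.ofFn fun i => termCode (ts i))))
  | .imp φ ψ => Nat.pair 3 (Nat.pair φ.code ψ.code)

/-- The Gödel number of a finite set of formulae, given as a list. -/
def listCode (A : List (QF L)) : ℕ := Encodable.encode (A.map QF.code)

/-- The satisfiability modulo `T` of quantifier-free formulae is decidable. -/
def DecidableSMT (T : L.Theory) : Prop :=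
  ∃ d : ℕ → Bool, Computable d ∧ ∀ φ : QF L, d φ.code = true ↔ Sat T {φ}

end Codes

/-- The symbols of the union of two disjoint signatures are coded through the codes of the
symbols of the two signatures. -/
instance sumFunctionsEncodable (L₁ L₂ : FirstOrder.Language.{0, 0}) [Encodable (Σ n, L₁.Functions n)]
    [Encodable (Σ n, L₂.Functions n)] : Encodable (Σ n, (L₁.sum L₂).Functions n) :=
  Encodable.ofEquiv ((Σ n, L₁.Functions n) ⊕ (Σ n, L₂.Functions n))
    (Equiv.sigmaSumDistrib L₁.Functions L₂.Functions)

instance sumRelationsEncodable (L₁ L₂ : FirstOrder.Language.{0, 0}) [Encodable (Σ n, L₁.Relations n)]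
    [Encodable (Σ n, L₂.Relations n)] : Encodable (Σ n, (L₁.sum L₂).Relations n) :=
  Encodable.ofEquiv ((Σ n, L₁.Relations n) ⊕ (Σ n, L₂.Relations n))
    (Equiv.sigmaSumDistrib L₁.Relations L₂.Relations)

/-- A signature is effective if the arity of a symbol can be computed from its code. -/
def EffectiveArities (L : FirstOrder.Language.{0, 0}) [Primcodable (Σ n, L.Functions n)]
    [Primcodable (Σ n, L.Relations n)] : Prop :=
  Computable (fun f : (Σ n, L.Functions n) => f.1) ∧
    Computable (fun R : (Σ n, L.Relations n) => R.1)

/-! ### The combined procedure -/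

/-- A pair `A | B` of finite sets of ground formulae. -/
structure Pair (L : FirstOrder.Language.{0, 0}) : Type where
  A : List (QF L)
  B : List (QF L)

section Rules

variable {L : FirstOrder.Language.{0, 0}}

/-- Exchange of the two components. -/
def Pair.swap (P : Pair L) : Pair L := ⟨P.B, P.A⟩

/-- The pair does not contain `⊥`. -/
def Pair.IsOpen (P : Pair L) : Prop := QF.falsum ∉ P.A ∧ QF.falsum ∉ P.B

/-- The constants occurring in both components (the `AB`-common ones). -/
def Pair.common (P : Pair L) : Finset ℕ := constsOf P.A ∩ constsOf P.B

/-- The constants occurring in the first component only (the `A`-strict ones); the `B`-strict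
ones are `P.swap.strict`. -/
def Pair.strict (P : Pair L) : Finset ℕ := constsOf P.A \ constsOf P.B

/-- `c` is a fresh constant. -/
def Pair.Fresh (P : Pair L) (c : ℕ) : Prop := c ∉ constsOf P.A ∪ constsOf P.B

/-- The `A`-relevant atoms: the atoms occurring in `A` and the equations between free constants
of `A`. -/
def Relevant (A : List (QF L)) (p : QF L) : Prop :=
  (∃ φ ∈ A, p ∈ φ.atoms) ∨
    ∃ c ∈ constsOf A, ∃ d ∈ constsOf A, p = QF.equal (FirstOrder.Language.Term.var c) (FirstOrder.Language.Term.var d)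

/-- `α` is an `A`-assignment: a Boolean assignment to the `A`-relevant atoms satisfying `A`
propositionally, seen as a set of literals. -/
def IsAssignment (A α : List (QF L)) : Prop :=
  (∀ l ∈ α, ∃ p, Relevant A p ∧ (l = p ∨ l = p.neg)) ∧
  (∀ p, Relevant A p → (p.neg ∈ α ↔ p ∉ α)) ∧
  ∀ φ ∈ A, φ.PropTrue (· ∈ α)

/-- The list `αs` enumerates, up to order and repetitions, all the `A`-assignments. -/
def ListsAssignments (A : List (QF L)) (αs : List (List (QF L))) : Prop :=
  (∀ α ∈ αs, IsAssignment A α) ∧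
    ∀ α, IsAssignment A α → ∃ β ∈ αs, ∀ l, l ∈ β ↔ l ∈ α

/-- `A` contains an `A`-assignment. -/
def ContainsAssignment (A : List (QF L)) : Prop := ∃ α, IsAssignment A α ∧ α ⊆ A

/-- Term sharing in `A`: given an equation `a = t` of `A`, where `a` is `A`-strict and `t` is
`AB`-common, a fresh `AB`-common constant `c` is introduced with the definition `c = t`, and `a` is
replaced with `c` (so that `a = t` becomes `c = t`). -/
def Pair.shareTerm (P : Pair L) (a : ℕ) (t : L.Term ℕ) (c : ℕ) : Pair L :=
  ⟨QF.equal (FirstOrder.Language.Term.var c) t :: P.A.map (QF.subst a (FirstOrder.Language.Term.var c)),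
    QF.equal (FirstOrder.Language.Term.var c) t :: P.B⟩

end Rules

section TheoryRules

variable {L L' : FirstOrder.Language.{0, 0}} (g : L →ᴸ L') (T : L.Theory)

/-- The literals of `A` over the component signature `L`. -/
def part (A : List (QF L')) : Set (QF L) := {l | l.IsLiteral ∧ l.lift g ∈ A}

/-- Conditions under which **Share** applies to `P` for the component theory `T`, with the
tuple `as` of the `A`-strict constants, the tuple `bs` of the `B`-strict constants, the tuple `vs`
of `AB`-common terms, the `AB`-common formula `θ` and the fresh constant `c`. -/
structure ShareData (P : Pair L') (as bs : List ℕ) (vs : List (L.Term ℕ)) (θ : QF L) (c : ℕ) :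
    Prop where
  isOpen : P.IsOpen
  nodup_as : as.Nodup
  mem_as : ∀ x, x ∈ as ↔ x ∈ P.strict
  nodup_bs : bs.Nodup
  mem_bs : ∀ x, x ∈ bs ↔ x ∈ P.swap.strict
  sat : Sat T (part g P.A ∪ part g P.B)
  unsat : ¬ Sat T (part g P.A ∪ part g P.B ∪ {(meet (vars as) (vars bs)).neg})
  vs_common : ∀ t ∈ vs, t.varFinset ⊆ P.common
  vs_unsat : ¬ Sat T (part g P.A ∪ part g P.B ∪ {(meet (vars (as ++ bs)) vs).neg})
  θ_common : θ.consts ⊆ P.common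
  entails : Entails T (part g P.A ∪ {(meet (vars as) vs).neg}) θ
  refutes : ¬ Sat T (part g P.B ∪ {(meet (vars bs) vs).neg} ∪ {θ})
  fresh : P.Fresh c

/-- The outcomes of **Share**.  For every `a` in `as` and `t` in `vs`, the equation `a = t` is
added to `A` and term sharing is applied to it; for every `b` in `bs` and `t` in `vs`, the formula
`θ` is added to `A` and to `B`, the equation `b = t` is added to `B` and term sharing is applied
to it. -/
def shareOutcomes (P : Pair L') (as bs : List ℕ) (vs : List (L.Term ℕ)) (θ : QF L) (c : ℕ) :
    List (Pair L') :=
  (as.product vs).map (fun p => P.shareTerm p.1 (g.onTerm p.2) c) ++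
  (bs.product vs).map (fun p =>
    (Pair.shareTerm ⟨θ.lift g :: P.B, θ.lift g :: P.A⟩ p.1 (g.onTerm p.2) c).swap)

/-- The interpolant of **Share** from the list `ιs` of the interpolants of the outcomes, where the
constant `c` introduced by term sharing is replaced with its definition. -/
def shareInterpolant (as bs : List ℕ) (vs : List (L.Term ℕ)) (θ : QF L) (c : ℕ)
    (ιs : List (QF L')) : QF L' :=
  QF.or
    (QF.bigOr (List.zipWith (fun p ι => QF.subst c (g.onTerm p.2) ι) (as.product vs) ιs))
    (QF.and (θ.lift g)
      (QF.bigAnd (List.zipWith (fun p ι => QF.subst c (g.onTerm p.2) ι) (bs.product vs)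
        (ιs.drop (as.product vs).length))))

/-- **Share** and **Terminate** for the component theory `T`. -/
inductive TheoryRule : Pair L' → List (Pair L') → (List (QF L') → QF L') → Prop
  | share (P : Pair L') (as bs : List ℕ) (vs : List (L.Term ℕ)) (θ : QF L) (c : ℕ) :
      ShareData g T P as bs vs θ c →
      TheoryRule P (shareOutcomes g P as bs vs θ c) (shareInterpolant g as bs vs θ c)
  | terminate (P : Pair L') (θ : QF L) :
      P.IsOpen →
      ¬ Sat T (part g P.A ∪ part g P.B) →
      θ.consts ⊆ P.common →
      Entails T (part g P.A) θ →
      ¬ Sat T (part g P.B ∪ {θ}) →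
      TheoryRule P [⟨θ.lift g :: P.A, QF.falsum :: θ.lift g :: P.B⟩]
        (fun ιs => QF.and (θ.lift g) (QF.bigAnd ιs))

end TheoryRules

section Procedure

variable {L₁ L₂ : FirstOrder.Language.{0, 0}} (T₁ : L₁.Theory) (T₂ : L₂.Theory)

/-- The theory `T₁ ∪ T₂` over the union of the two disjoint signatures. -/
def unionTheory : (L₁.sum L₂).Theory :=
  (FirstOrder.Language.LHom.sumInl : L₁ →ᴸ L₁.sum L₂).onTheory T₁ ∪ (FirstOrder.Language.LHom.sumInr : L₂ →ᴸ L₁.sum L₂).onTheory T₂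

/-- `Rule T₁ T₂ P outcomes instr`: one of the rules **Decide**, **Share**, **Terminate** applies
to `P`, with the given list of alternative outcomes and with the instruction `instr` computing an
interpolant for `P` from the list of the interpolants for the outcomes. -/
inductive Rule : Pair (L₁.sum L₂) → List (Pair (L₁.sum L₂)) →
    (List (QF (L₁.sum L₂)) → QF (L₁.sum L₂)) → Prop
  | decideA (P : Pair (L₁.sum L₂)) (αs : List (List (QF (L₁.sum L₂)))) :
      P.IsOpen → ¬ ContainsAssignment P.A → αs ≠ [] → ListsAssignments P.A αs →
      Rule P (αs.map fun α => ⟨α ++ P.A, P.B⟩) QF.bigOr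
  | decideAFail (P : Pair (L₁.sum L₂)) :
      P.IsOpen → (∀ α, ¬ IsAssignment P.A α) →
      Rule P [⟨QF.falsum :: P.A, P.B⟩] QF.bigOr
  | decideB (P : Pair (L₁.sum L₂)) (βs : List (List (QF (L₁.sum L₂)))) :
      P.IsOpen → ¬ ContainsAssignment P.B → βs ≠ [] → ListsAssignments P.B βs →
      Rule P (βs.map fun β => ⟨P.A, β ++ P.B⟩) QF.bigAnd
  | decideBFail (P : Pair (L₁.sum L₂)) :
      P.IsOpen → (∀ β, ¬ IsAssignment P.B β) →
      Rule P [⟨P.A, QF.falsum :: P.B⟩] QF.bigAnd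
  | theory₁ (P : Pair (L₁.sum L₂)) (outcomes : List (Pair (L₁.sum L₂)))
      (instr : List (QF (L₁.sum L₂)) → QF (L₁.sum L₂)) :
      TheoryRule FirstOrder.Language.LHom.sumInl T₁ P outcomes instr → Rule P outcomes instr
  | theory₂ (P : Pair (L₁.sum L₂)) (outcomes : List (Pair (L₁.sum L₂)))
      (instr : List (QF (L₁.sum L₂)) → QF (L₁.sum L₂)) :
      TheoryRule FirstOrder.Language.LHom.sumInr T₂ P outcomes instr → Rule P outcomes instr

/-- `Q` is one of the outcomes of a rule applied to `P`. -/
def Next (Q P : Pair (L₁.sum L₂)) : Prop :=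
  ∃ outcomes instr, Rule T₁ T₂ P outcomes instr ∧ Q ∈ outcomes

/-- Exhaustive application of the rules.  `Run T₁ T₂ P (some θ)` says that there is a finite tree
with root `P`, built by applying the rules, all of whose leaves contain `⊥`, and that `θ` is the
formula computed from it; `Run T₁ T₂ P none` says that the rules lead from `P` to a pair not
containing `⊥` to which no rule applies. -/
inductive Run : Pair (L₁.sum L₂) → Option (QF (L₁.sum L₂)) → Prop
  | closeA (P : Pair (L₁.sum L₂)) : QF.falsum ∈ P.A → Run P (some QF.falsum)
  | closeB (P : Pair (L₁.sum L₂)) : QF.falsum ∈ P.B → Run P (some QF.top)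
  | saturated (P : Pair (L₁.sum L₂)) :
      P.IsOpen → (∀ outcomes instr, ¬ Rule T₁ T₂ P outcomes instr) → Run P none
  | node (P : Pair (L₁.sum L₂)) (outcomes : List (Pair (L₁.sum L₂)))
      (instr : List (QF (L₁.sum L₂)) → QF (L₁.sum L₂)) (ιs : List (QF (L₁.sum L₂))) :
      Rule T₁ T₂ P outcomes instr → ιs.length = outcomes.length →
      (∀ q ∈ outcomes.zip ιs, Run q.1 (some q.2)) → Run P (some (instr ιs))
  | fail (P Q : Pair (L₁.sum L₂)) : Next T₁ T₂ Q P → Run Q none → Run P none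

/-- All the atoms of the formula are atoms over one of the two signatures. -/
def IsPure (φ : QF (L₁.sum L₂)) : Prop :=
  ∀ p ∈ φ.atoms, (∃ q : QF L₁, q.lift FirstOrder.Language.LHom.sumInl = p) ∨ (∃ q : QF L₂, q.lift FirstOrder.Language.LHom.sumInr = p)

/-- A purification step: some occurrences of a term `t` over the constants of `A` are replaced in
`A` with a fresh constant `d`, and the definition `d = t` is added to `A`; or the same for `B`. -/
inductive PurifyStep : Pair (L₁.sum L₂) → Pair (L₁.sum L₂) → Prop
  | left (P : Pair (L₁.sum L₂)) (d : ℕ) (t : (L₁.sum L₂).Term ℕ) (A' : List (QF (L₁.sum L₂))) :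
      P.Fresh d → t.varFinset ⊆ constsOf P.A → A'.map (QF.subst d t) = P.A →
      PurifyStep P ⟨QF.equal (FirstOrder.Language.Term.var d) t :: A', P.B⟩
  | right (P : Pair (L₁.sum L₂)) (d : ℕ) (t : (L₁.sum L₂).Term ℕ) (B' : List (QF (L₁.sum L₂))) :
      P.Fresh d → t.varFinset ⊆ constsOf P.B → B'.map (QF.subst d t) = P.B →
      PurifyStep P ⟨P.A, QF.equal (FirstOrder.Language.Term.var d) t :: B'⟩

/-- `Q` is a purification of `P`. -/
def Purifies (P Q : Pair (L₁.sum L₂)) : Prop :=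
  Relation.ReflTransGen PurifyStep P Q ∧ (∀ φ ∈ Q.A, IsPure φ) ∧ ∀ φ ∈ Q.B, IsPure φ

/-- `CI T₁ T₂ A B r`: the combined procedure, on the input pair `A`, `B`, can end with the result
`r`.  The input is purified, and then the rules are applied exhaustively, in any order. -/
def CI (A B : List (QF (L₁.sum L₂))) (r : Option (QF (L₁.sum L₂))) : Prop :=
  ∃ P : Pair (L₁.sum L₂), Purifies ⟨A, B⟩ P ∧ Run T₁ T₂ P r

end Procedure

end CombInterp

open CombInterp

set_option linter.unusedSectionVars false

namespace CombInterp

open FirstOrder.Language (Term)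

/-! ### Semantics and free constants of ground formulae -/

section Formulae

variable {L L' : FirstOrder.Language.{0, 0}} {M : Type} [L.Structure M] {v w : ℕ → M}

/-! Termination. Every rule lowers, lexicographically, the number of strict constants and then the
number of undecided components (counted as zero once the pair is closed). Share turns one strict
constant into a common one; the fresh constant and the formula `θ` bring in no new strict constant.
Decide adds literals over constants already present and makes one component contain an assignment,
which it then keeps; failing Decide and Terminate close the pair without adding constants. This is
`Next.smaller`.

Soundness. Each instruction turns interpolants of the outcomes into an interpolant of the pair, by a
case distinction inside an arbitrary model (`Rule.sound`, with `share_sound` as the main case). The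
constant introduced by term sharing is interpreted by the value of its defining term, which is what
substituting the term for it expresses. Constants introduced by purification occur on one side only,
hence not in an interpolant.

Completeness. The rules preserve purity and joint unsatisfiability, so a stuck open pair would have
to be pure and unsatisfiable. Equality interpolation shows that a stuck pair is saturated: both
sides contain assignments and, for each theory, the literals have a model separating the strict
constants of the two sides (`exists_theoryRule_data`). A pure saturated pair is satisfiable by a
Nelson-Oppen argument (`Saturated.sat`): stable infiniteness and Löwenheim-Skolem give countably
infinite models of both theories. They identify the same constants, because each assignment decides
all equations on its own side, and a pair of constants not lying on one side consists of two strict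
constants, which both models separate. A bijection between the models that respects the constants
glues them into a model of the union.

Effectiveness. Once the terms, the interpolant and the fresh constant of a theory rule are given,
its side conditions are finitely many syntactic tests and satisfiability queries; these data can
therefore be found by search. For a sufficient selection of rule instances, the statement that a
pair leads to a result is inductively generated by a semidecidable set of inferences, hence
semidecidable (`Semidecidable.derivable`). By termination and the existence of purifications every
input has a result, so unbounded search defines a total computable function. The remaining work is
to make terms, formulae and pairs into data types on which the syntactic operations are computable
with respect to the given Gödel numbers. -/

theorem mem_varFinset_func {n : ℕ} {f : L.Functions n} {ts : Fin n → L.Term ℕ} {x : ℕ} :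
    x ∈ (Term.func f ts).varFinset ↔ ∃ i, x ∈ (ts i).varFinset := by
  simp [Term.varFinset]

theorem term_realize_congr {t : L.Term ℕ} (h : ∀ c ∈ t.varFinset, v c = w c) :
    t.realize v = t.realize w := by
  induction t with
  | var c => exact h c (by simp [Term.varFinset])
  | func f ts ih =>
    simp only [Term.realize]
    congr 1
    funext i
    exact ih i fun c hc => h c (mem_varFinset_func.2 ⟨i, hc⟩)

theorem term_realize_subst {c : ℕ} {t u : L.Term ℕ} :
    (u.subst fun x => if x = c then t else Term.var x).realize v =
      u.realize (Function.update v c (t.realize v)) := by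
  rw [Term.realize_subst]
  congr 1
  funext x
  by_cases h : x = c
  · subst h; simp
  · simp [h]

theorem mem_varFinset_subst {c : ℕ} {t u : L.Term ℕ} {x : ℕ} :
    x ∈ (u.subst fun x => if x = c then t else Term.var x).varFinset ↔
      (x ∈ u.varFinset ∧ x ≠ c) ∨ (c ∈ u.varFinset ∧ x ∈ t.varFinset) := by
  induction u with
  | var y =>
    by_cases h : y = c
    · subst h; simp +contextual [Term.subst, Term.varFinset]
    · simp only [Term.subst, h, if_false, Term.varFinset, Finset.mem_singleton]
      constructor
      · rintro rfl; exact Or.inl ⟨rfl, h⟩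
      · rintro (⟨rfl, -⟩ | ⟨rfl, -⟩)
        · rfl
        · exact absurd rfl h
  | func f ts ih =>
    simp only [Term.subst, mem_varFinset_func, ih, exists_or, exists_and_right]

theorem varFinset_onTerm (g : L →ᴸ L') (t : L.Term ℕ) : (g.onTerm t).varFinset = t.varFinset := by
  induction t with
  | var c => rfl
  | func f ts ih => simp [FirstOrder.Language.LHom.onTerm, Term.varFinset, ih]

theorem term_subst_of_notMem {c : ℕ} {t u : L.Term ℕ} (h : c ∉ u.varFinset) :
    (u.subst fun x => if x = c then t else Term.var x) = u := by
  induction u with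
  | var y =>
    have : y ≠ c := by rintro rfl; simp [Term.varFinset] at h
    simp [Term.subst, this]
  | func f ts ih =>
    simp only [Term.subst]
    congr 1
    funext i
    exact ih i fun hc => h (mem_varFinset_func.2 ⟨i, hc⟩)

namespace QF

@[simp] theorem realize_falsum : (falsum : QF L).Realize v ↔ False := Iff.rfl

@[simp] theorem realize_imp {φ ψ : QF L} : (imp φ ψ).Realize v ↔ (φ.Realize v → ψ.Realize v) :=
  Iff.rfl

@[simp] theorem realize_equal {t u : L.Term ℕ} :
    (equal t u).Realize v ↔ t.realize v = u.realize v := Iff.rfl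

@[simp] theorem realize_neg {φ : QF L} : φ.neg.Realize v ↔ ¬ φ.Realize v := Iff.rfl

@[simp] theorem realize_top : (top : QF L).Realize v := fun h => h

@[simp] theorem realize_and {φ ψ : QF L} :
    (φ.and ψ).Realize v ↔ φ.Realize v ∧ ψ.Realize v := by
  simp [QF.and]

@[simp] theorem realize_or {φ ψ : QF L} :
    (φ.or ψ).Realize v ↔ φ.Realize v ∨ ψ.Realize v := by
  simp [QF.or, or_iff_not_imp_left]

@[simp] theorem realize_bigAnd {l : List (QF L)} :
    (bigAnd l).Realize v ↔ ∀ φ ∈ l, φ.Realize v := by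
  induction l with
  | nil => simp [bigAnd]
  | cons φ l ih =>
    have : bigAnd (φ :: l) = φ.and (bigAnd l) := rfl
    simp [this, ih]

@[simp] theorem realize_bigOr {l : List (QF L)} :
    (bigOr l).Realize v ↔ ∃ φ ∈ l, φ.Realize v := by
  induction l with
  | nil => simp [bigOr]
  | cons φ l ih =>
    have : bigOr (φ :: l) = φ.or (bigOr l) := rfl
    simp [this, ih]

@[simp] theorem consts_falsum : (falsum : QF L).consts = ∅ := rfl

@[simp] theorem consts_equal {t u : L.Term ℕ} :
    (equal t u).consts = t.varFinset ∪ u.varFinset := rfl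

theorem mem_consts_rel {n : ℕ} {R : L.Relations n} {ts : Fin n → L.Term ℕ} {x : ℕ} :
    x ∈ (rel R ts).consts ↔ ∃ i, x ∈ (ts i).varFinset := by
  simp [consts]

@[simp] theorem consts_imp {φ ψ : QF L} : (imp φ ψ).consts = φ.consts ∪ ψ.consts := rfl

@[simp] theorem consts_neg {φ : QF L} : φ.neg.consts = φ.consts := by simp [neg]

@[simp] theorem consts_top : (top : QF L).consts = ∅ := by simp [top]

@[simp] theorem consts_and {φ ψ : QF L} : (φ.and ψ).consts = φ.consts ∪ ψ.consts := by
  simp [QF.and]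

@[simp] theorem consts_or {φ ψ : QF L} : (φ.or ψ).consts = φ.consts ∪ ψ.consts := by
  simp [QF.or]

theorem mem_consts_bigAnd {l : List (QF L)} {x : ℕ} :
    x ∈ (bigAnd l).consts ↔ ∃ φ ∈ l, x ∈ φ.consts := by
  induction l with
  | nil => simp [bigAnd]
  | cons φ l ih =>
    have : bigAnd (φ :: l) = φ.and (bigAnd l) := rfl
    simp [this, ih]

theorem mem_consts_bigOr {l : List (QF L)} {x : ℕ} :
    x ∈ (bigOr l).consts ↔ ∃ φ ∈ l, x ∈ φ.consts := by
  induction l with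
  | nil => simp [bigOr]
  | cons φ l ih =>
    have : bigOr (φ :: l) = φ.or (bigOr l) := rfl
    simp [this, ih]

theorem realize_congr {φ : QF L} (h : ∀ c ∈ φ.consts, v c = w c) :
    φ.Realize v ↔ φ.Realize w := by
  induction φ with
  | falsum => rfl
  | equal t u =>
    simp only [consts_equal, Finset.mem_union] at h
    rw [realize_equal, realize_equal, term_realize_congr fun c hc => h c (Or.inl hc),
      term_realize_congr fun c hc => h c (Or.inr hc)]
  | rel R ts =>
    simp only [Realize]
    rw [show (fun i => (ts i).realize v) = fun i => (ts i).realize w from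
      funext fun i => term_realize_congr fun c hc => h c (mem_consts_rel.2 ⟨i, hc⟩)]
  | imp φ ψ ih₁ ih₂ =>
    simp only [consts_imp, Finset.mem_union] at h
    rw [realize_imp, realize_imp, ih₁ fun c hc => h c (Or.inl hc),
      ih₂ fun c hc => h c (Or.inr hc)]

theorem realize_subst {c : ℕ} {t : L.Term ℕ} {φ : QF L} :
    (φ.subst c t).Realize v ↔ φ.Realize (Function.update v c (t.realize v)) := by
  induction φ with
  | falsum => rfl
  | equal u w => simp only [subst, realize_equal, term_realize_subst]
  | rel R ts => simp only [subst, Realize, term_realize_subst]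
  | imp φ ψ ih₁ ih₂ => simp only [subst, realize_imp, ih₁, ih₂]

theorem realize_lift (g : L →ᴸ L') [L'.Structure M] [g.IsExpansionOn M] {φ : QF L} :
    (φ.lift g).Realize v ↔ φ.Realize v := by
  induction φ with
  | falsum => rfl
  | equal u w => simp only [lift, realize_equal, FirstOrder.Language.LHom.realize_onTerm]
  | rel R ts =>
    simp only [lift, Realize, FirstOrder.Language.LHom.realize_onTerm,
      FirstOrder.Language.LHom.map_onRelation]
  | imp φ ψ ih₁ ih₂ => simp only [lift, realize_imp, ih₁, ih₂]

theorem mem_consts_subst {c : ℕ} {t : L.Term ℕ} {φ : QF L} {x : ℕ} :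
    x ∈ (φ.subst c t).consts ↔
      (x ∈ φ.consts ∧ x ≠ c) ∨ (c ∈ φ.consts ∧ x ∈ t.varFinset) := by
  induction φ with
  | falsum => simp [subst]
  | equal u w => simp only [subst, consts_equal, Finset.mem_union, mem_varFinset_subst]; grind
  | rel R ts =>
    simp only [subst, mem_consts_rel, mem_varFinset_subst, exists_or, exists_and_right]
  | imp φ ψ ih₁ ih₂ => simp only [subst, consts_imp, Finset.mem_union, ih₁, ih₂, or_and_right]; grind

theorem subst_of_notMem {c : ℕ} {t : L.Term ℕ} {φ : QF L} (h : c ∉ φ.consts) :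
    φ.subst c t = φ := by
  induction φ with
  | falsum => rfl
  | equal u w =>
    simp only [consts_equal, Finset.mem_union, not_or] at h
    simp only [subst, term_subst_of_notMem h.1, term_subst_of_notMem h.2]
  | rel R ts =>
    simp only [mem_consts_rel, not_exists] at h
    simp only [subst]
    congr 1
    funext i
    exact term_subst_of_notMem (h i)
  | imp φ ψ ih₁ ih₂ =>
    simp only [consts_imp, Finset.mem_union, not_or] at h
    simp only [subst, ih₁ h.1, ih₂ h.2]

@[simp] theorem consts_lift (g : L →ᴸ L') {φ : QF L} : (φ.lift g).consts = φ.consts := by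
  induction φ with
  | falsum => rfl
  | equal u w => simp only [lift, consts_equal, varFinset_onTerm]
  | rel R ts => simp only [lift, consts, varFinset_onTerm]
  | imp φ ψ ih₁ ih₂ => simp only [lift, consts_imp, ih₁, ih₂]

theorem isAtom_of_mem_atoms {φ p : QF L} (h : p ∈ φ.atoms) : p.IsAtom := by
  induction φ with
  | falsum => exact h.elim
  | equal u w => rw [Set.mem_singleton_iff.1 h]; trivial
  | rel R ts => rw [Set.mem_singleton_iff.1 h]; trivial
  | imp φ ψ ih₁ ih₂ => exact h.elim ih₁ ih₂

theorem consts_subset_of_mem_atoms {φ p : QF L} (h : p ∈ φ.atoms) : p.consts ⊆ φ.consts := by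
  induction φ with
  | falsum => exact h.elim
  | equal u w => exact (congrArg consts (Set.mem_singleton_iff.1 h)).subset
  | rel R ts => exact (congrArg consts (Set.mem_singleton_iff.1 h)).subset
  | imp φ ψ ih₁ ih₂ =>
    rw [consts_imp]
    exact h.elim (fun h => (ih₁ h).trans Finset.subset_union_left)
      fun h => (ih₂ h).trans Finset.subset_union_right

theorem propTrue_congr {s r : QF L → Prop} {φ : QF L} (h : ∀ p ∈ φ.atoms, (s p ↔ r p)) :
    φ.PropTrue s ↔ φ.PropTrue r := by
  induction φ with
  | falsum => rfl
  | equal u w => exact h _ rfl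
  | rel R ts => exact h _ rfl
  | imp φ ψ ih₁ ih₂ =>
    simp only [PropTrue]
    rw [ih₁ fun p hp => h p (Or.inl hp), ih₂ fun p hp => h p (Or.inr hp)]

/-- A model with a valuation is in particular a Boolean assignment to the atoms; this is how
semantic facts enter the Decide rules. -/
theorem propTrue_realize {φ : QF L} : φ.PropTrue (fun p => p.Realize v) ↔ φ.Realize v := by
  induction φ with
  | falsum => rfl
  | equal u w => rfl
  | rel R ts => rfl
  | imp φ ψ ih₁ ih₂ => simp only [PropTrue, realize_imp, ih₁, ih₂]

theorem IsAtom.atoms_eq {p : QF L} (h : p.IsAtom) : p.atoms = {p} := by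
  cases p <;> first | rfl | exact h.elim

theorem IsAtom.propTrue {p : QF L} (h : p.IsAtom) {s : QF L → Prop} : p.PropTrue s ↔ s p := by
  cases p <;> first | rfl | exact h.elim

end QF

@[simp] theorem realize_meet {ts us : List (L.Term ℕ)} :
    (meet ts us).Realize v ↔ ∃ t ∈ ts, ∃ u ∈ us, t.realize v = u.realize v := by
  simp only [meet, QF.realize_bigOr, List.mem_map, Prod.exists, List.pair_mem_product]
  constructor
  · rintro ⟨_, ⟨t, u, ⟨ht, hu⟩, rfl⟩, h⟩; exact ⟨t, ht, u, hu, h⟩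
  · rintro ⟨t, ht, u, hu, h⟩; exact ⟨_, ⟨t, u, ⟨ht, hu⟩, rfl⟩, h⟩

theorem mem_consts_meet {ts us : List (L.Term ℕ)} {x : ℕ} (h : x ∈ (meet ts us).consts) :
    (∃ t ∈ ts, x ∈ t.varFinset) ∨ ∃ u ∈ us, x ∈ u.varFinset := by
  simp only [meet, QF.mem_consts_bigOr, List.mem_map, Prod.exists, List.pair_mem_product] at h
  obtain ⟨_, ⟨t, u, ⟨ht, hu⟩, rfl⟩, h⟩ := h
  simp only [QF.consts_equal, Finset.mem_union] at h
  exact h.imp (fun h => ⟨t, ht, h⟩) fun h => ⟨u, hu, h⟩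

theorem mem_vars {xs : List ℕ} {t : L.Term ℕ} : t ∈ vars xs ↔ ∃ x ∈ xs, t = Term.var x := by
  simp [vars, eq_comm]

theorem mem_constsOf {A : List (QF L)} {x : ℕ} : x ∈ constsOf A ↔ ∃ φ ∈ A, x ∈ φ.consts := by
  induction A with
  | nil => simp [constsOf]
  | cons φ A ih =>
    have : constsOf (φ :: A) = φ.consts ∪ constsOf A := rfl
    simp [this, ih]

@[simp] theorem constsOf_cons {A : List (QF L)} {φ : QF L} :
    constsOf (φ :: A) = φ.consts ∪ constsOf A := rfl

@[simp] theorem constsOf_nil : constsOf ([] : List (QF L)) = ∅ := rfl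

@[simp] theorem constsOf_append {A B : List (QF L)} :
    constsOf (A ++ B) = constsOf A ∪ constsOf B := by
  ext x; simp only [mem_constsOf, List.mem_append, Finset.mem_union]
  grind

theorem mem_constsOf_map_subst {A : List (QF L)} {c : ℕ} {t : L.Term ℕ} {x : ℕ} :
    x ∈ constsOf (A.map (QF.subst c t)) ↔
      (x ∈ constsOf A ∧ x ≠ c) ∨ (c ∈ constsOf A ∧ x ∈ t.varFinset) := by
  simp only [mem_constsOf, List.mem_map]
  constructor
  · rintro ⟨_, ⟨φ, hφ, rfl⟩, h⟩
    exact (QF.mem_consts_subst.1 h).imp (fun h => ⟨⟨φ, hφ, h.1⟩, h.2⟩) fun h => ⟨⟨φ, hφ, h.1⟩, h.2⟩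
  · rintro (⟨⟨φ, hφ, h⟩, hx⟩ | ⟨⟨φ, hφ, h⟩, hx⟩)
    · exact ⟨_, ⟨φ, hφ, rfl⟩, QF.mem_consts_subst.2 (Or.inl ⟨h, hx⟩)⟩
    · exact ⟨_, ⟨φ, hφ, rfl⟩, QF.mem_consts_subst.2 (Or.inr ⟨h, hx⟩)⟩

theorem constsOf_subset {A : List (QF L)} {φ : QF L} (h : φ ∈ A) : φ.consts ⊆ constsOf A :=
  fun _ hx => mem_constsOf.2 ⟨φ, h, hx⟩

end Formulae

end CombInterp

namespace CombInterp

open FirstOrder.Language (Term)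

/-! ### Relevant atoms and assignments -/

section Assignments

variable {L : FirstOrder.Language.{0, 0}}

/-- The list of the free constants of a term. -/
def termConsts : L.Term ℕ → List ℕ
  | .var c => [c]
  | .func _ ts => (List.ofFn fun i => termConsts (ts i)).flatten

theorem mem_termConsts {t : L.Term ℕ} {x : ℕ} : x ∈ termConsts t ↔ x ∈ t.varFinset := by
  induction t with
  | var c => simp [termConsts, Term.varFinset]
  | func f ts ih =>
    simp only [termConsts, List.mem_flatten, List.mem_ofFn, mem_varFinset_func]
    constructor
    · rintro ⟨_, ⟨i, rfl⟩, h⟩; exact ⟨i, (ih i).1 h⟩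
    · rintro ⟨i, h⟩; exact ⟨_, ⟨i, rfl⟩, (ih i).2 h⟩

/-- The list of the free constants of a formula. -/
def QF.constList : QF L → List ℕ
  | falsum => []
  | equal t u => termConsts t ++ termConsts u
  | rel _ ts => (List.ofFn fun i => termConsts (ts i)).flatten
  | imp φ ψ => φ.constList ++ ψ.constList

theorem QF.mem_constList {φ : QF L} {x : ℕ} : x ∈ φ.constList ↔ x ∈ φ.consts := by
  induction φ with
  | falsum => simp [constList]
  | equal t u => simp [constList, mem_termConsts]
  | rel R ts =>
    simp only [constList, List.mem_flatten, List.mem_ofFn, mem_consts_rel]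
    constructor
    · rintro ⟨_, ⟨i, rfl⟩, h⟩; exact ⟨i, mem_termConsts.1 h⟩
    · rintro ⟨i, h⟩; exact ⟨_, ⟨i, rfl⟩, mem_termConsts.2 h⟩
  | imp φ ψ ih₁ ih₂ => simp [constList, ih₁, ih₂]

/-- The list of the free constants of a finite set of formulae. -/
def constListOf (A : List (QF L)) : List ℕ := A.flatMap QF.constList

theorem mem_constListOf {A : List (QF L)} {x : ℕ} : x ∈ constListOf A ↔ x ∈ constsOf A := by
  simp [constListOf, mem_constsOf, QF.mem_constList]

/-- The list of the atoms of a formula. -/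
def QF.atomList : QF L → List (QF L)
  | falsum => []
  | equal t u => [equal t u]
  | rel R ts => [rel R ts]
  | imp φ ψ => φ.atomList ++ ψ.atomList

theorem QF.mem_atomList {φ p : QF L} : p ∈ φ.atomList ↔ p ∈ φ.atoms := by
  induction φ with
  | falsum => simp [atomList, atoms]
  | equal t u => simp [atomList, atoms]
  | rel R ts => simp [atomList, atoms]
  | imp φ ψ ih₁ ih₂ => simp [atomList, atoms, ih₁, ih₂]

/-- The list of the `A`-relevant atoms. -/
def relevantList (A : List (QF L)) : List (QF L) :=
  A.flatMap QF.atomList ++ (constListOf A).flatMap fun c =>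
    (constListOf A).map fun d => QF.equal (Term.var c) (Term.var d)

theorem mem_relevantList {A : List (QF L)} {p : QF L} : p ∈ relevantList A ↔ Relevant A p := by
  simp only [relevantList, Relevant, List.mem_append, List.mem_flatMap, List.mem_map,
    QF.mem_atomList, mem_constListOf, eq_comm]

theorem Relevant.isAtom {A : List (QF L)} {p : QF L} (h : Relevant A p) : p.IsAtom := by
  rcases h with ⟨φ, -, h⟩ | ⟨c, -, d, -, rfl⟩
  · exact QF.isAtom_of_mem_atoms h
  · trivial

theorem Relevant.consts_subset {A : List (QF L)} {p : QF L} (h : Relevant A p) :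
    p.consts ⊆ constsOf A := by
  rcases h with ⟨φ, hφ, h⟩ | ⟨c, hc, d, hd, rfl⟩
  · exact (QF.consts_subset_of_mem_atoms h).trans (constsOf_subset hφ)
  · intro x hx
    simp only [QF.consts_equal, Term.varFinset, Finset.mem_union, Finset.mem_singleton] at hx
    rcases hx with rfl | rfl <;> assumption

theorem QF.IsAtom.ne_neg {p q : QF L} (h : p.IsAtom) : p ≠ q.neg := by
  rintro rfl; exact h

theorem QF.neg_injective : Function.Injective (QF.neg : QF L → QF L) := fun _ _ h =>
  (QF.imp.inj h).1

theorem IsAssignment.constsOf_subset {A α : List (QF L)} (h : IsAssignment A α) :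
    constsOf α ⊆ constsOf A := by
  intro x hx
  obtain ⟨l, hl, hx⟩ := mem_constsOf.1 hx
  obtain ⟨p, hp, rfl | rfl⟩ := h.1 l hl
  · exact hp.consts_subset hx
  · rw [QF.consts_neg] at hx; exact hp.consts_subset hx

theorem isAssignment_congr {A α β : List (QF L)} (h : ∀ l, l ∈ α ↔ l ∈ β) :
    IsAssignment A α ↔ IsAssignment A β := by
  simp only [IsAssignment, h]

/-- The literals of an assignment are built from relevant atoms and contain no new constant, so
nothing new becomes relevant. Consequently the assignment remains one for the enlarged component,
and Decide does not apply to that component a second time. -/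
theorem IsAssignment.relevant_append {A α : List (QF L)} (h : IsAssignment A α) {p : QF L} :
    Relevant (α ++ A) p ↔ Relevant A p := by
  have hc : constsOf (α ++ A) = constsOf A := by
    rw [constsOf_append]; exact Finset.union_eq_right.2 h.constsOf_subset
  simp only [Relevant, hc, List.mem_append]
  constructor
  · rintro (⟨φ, hφ | hφ, hp⟩ | hp)
    · obtain ⟨q, hq, rfl | rfl⟩ := h.1 φ hφ
      · rw [hq.isAtom.atoms_eq, Set.mem_singleton_iff] at hp; exact hp ▸ hq
      · rw [show q.neg.atoms = q.atoms from Set.union_empty _, hq.isAtom.atoms_eq,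
          Set.mem_singleton_iff] at hp
        exact hp ▸ hq
    · exact Or.inl ⟨φ, hφ, hp⟩
    · exact Or.inr hp
  · rintro (⟨φ, hφ, hp⟩ | hp)
    · exact Or.inl ⟨φ, Or.inr hφ, hp⟩
    · exact Or.inr hp

theorem IsAssignment.append {A α : List (QF L)} (h : IsAssignment A α) :
    IsAssignment (α ++ A) α := by
  refine ⟨fun l hl => ?_, fun p hp => h.2.1 p (h.relevant_append.1 hp), fun φ hφ => ?_⟩
  · obtain ⟨p, hp, hl⟩ := h.1 l hl
    exact ⟨p, h.relevant_append.2 hp, hl⟩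
  · rcases List.mem_append.1 hφ with hφ | hφ
    · obtain ⟨p, hp, rfl | rfl⟩ := h.1 φ hφ
      · exact hp.isAtom.propTrue.2 hφ
      · exact fun hp' => (h.2.1 p hp).1 hφ (hp.isAtom.propTrue.1 hp')
    · exact h.2.2 φ hφ

/-- An assignment contains every relevant atom or its negation, so a model of its literals agrees
with it on all atoms of `A`; the propositional truth of `A` under `α` becomes truth in the model. -/
theorem IsAssignment.realize {A α : List (QF L)} (h : IsAssignment A α) {M : Type}
    [L.Structure M] {v : ℕ → M} (hv : ∀ l ∈ α, l.Realize v) : ∀ φ ∈ A, φ.Realize v := by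
  intro φ hφ
  rw [← QF.propTrue_realize]
  refine (QF.propTrue_congr fun p hp => ?_).1 (h.2.2 φ hφ)
  have hr : Relevant A p := Or.inl ⟨φ, hφ, hp⟩
  refine ⟨hv p, fun hpv => ?_⟩
  by_contra hα
  exact hv _ ((h.2.1 p hr).2 hα) hpv

/-- The assignment of literals to the relevant atoms of `A` determined by a predicate. -/
noncomputable def literalsOf (A : List (QF L)) (s : QF L → Prop) : List (QF L) :=
  open Classical in (relevantList A).map fun p => if s p then p else p.neg

theorem mem_literalsOf {A : List (QF L)} {s : QF L → Prop} {l : QF L} :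
    l ∈ literalsOf A s ↔ ∃ p, Relevant A p ∧ ((s p ∧ l = p) ∨ (¬ s p ∧ l = p.neg)) := by
  classical
  simp only [literalsOf, List.mem_map, mem_relevantList]
  refine exists_congr fun p => and_congr_right fun _ => ?_
  by_cases h : s p <;> simp [h, eq_comm]

theorem atom_mem_literalsOf {A : List (QF L)} {s : QF L → Prop} {p : QF L} (hp : Relevant A p) :
    p ∈ literalsOf A s ↔ s p := by
  rw [mem_literalsOf]
  constructor
  · rintro ⟨q, hq, ⟨h, rfl⟩ | ⟨-, h⟩⟩
    · exact h
    · exact absurd h hp.isAtom.ne_neg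
  · exact fun h => ⟨p, hp, Or.inl ⟨h, rfl⟩⟩

theorem neg_mem_literalsOf {A : List (QF L)} {s : QF L → Prop} {p : QF L} (hp : Relevant A p) :
    p.neg ∈ literalsOf A s ↔ ¬ s p := by
  rw [mem_literalsOf]
  constructor
  · rintro ⟨q, hq, ⟨-, h⟩ | ⟨h, h'⟩⟩
    · exact absurd h.symm hq.isAtom.ne_neg
    · rwa [QF.neg_injective h']
  · exact fun h => ⟨p, hp, Or.inr ⟨h, rfl⟩⟩

theorem isAssignment_literalsOf {A : List (QF L)} {s : QF L → Prop}
    (h : ∀ φ ∈ A, φ.PropTrue s) : IsAssignment A (literalsOf A s) := by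
  refine ⟨fun l hl => ?_, fun p hp => ?_, fun φ hφ => ?_⟩
  · obtain ⟨p, hp, h | h⟩ := mem_literalsOf.1 hl
    · exact ⟨p, hp, Or.inl h.2⟩
    · exact ⟨p, hp, Or.inr h.2⟩
  · rw [neg_mem_literalsOf hp, atom_mem_literalsOf hp]
  · exact (QF.propTrue_congr fun p hp => atom_mem_literalsOf (Or.inl ⟨φ, hφ, hp⟩)).2 (h φ hφ)

theorem IsAssignment.mem_literalsOf_iff {A α : List (QF L)} (h : IsAssignment A α) (l : QF L) :
    l ∈ literalsOf A (· ∈ α) ↔ l ∈ α := by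
  rw [mem_literalsOf]
  constructor
  · rintro ⟨p, hp, ⟨h', rfl⟩ | ⟨h', rfl⟩⟩
    · exact h'
    · exact (h.2.1 p hp).2 h'
  · intro hl
    obtain ⟨p, hp, rfl | rfl⟩ := h.1 l hl
    · exact ⟨l, hp, Or.inl ⟨hl, rfl⟩⟩
    · exact ⟨p, hp, Or.inr ⟨(h.2.1 p hp).1 hl, rfl⟩⟩

/-- The truth values of the relevant atoms in the model form the assignment. Hence the alternatives
of Decide are exhaustive, and a component without assignments has no model. -/
theorem exists_assignment_of_realize {A : List (QF L)} {M : Type} [L.Structure M] {v : ℕ → M}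
    (h : ∀ φ ∈ A, φ.Realize v) : ∃ α, IsAssignment A α ∧ ∀ l ∈ α, l.Realize v := by
  refine ⟨literalsOf A fun p => p.Realize v,
    isAssignment_literalsOf fun φ hφ => QF.propTrue_realize.2 (h φ hφ), fun l hl => ?_⟩
  obtain ⟨p, -, ⟨h, rfl⟩ | ⟨h, rfl⟩⟩ := mem_literalsOf.1 hl
  · exact h
  · exact h

/-- All the ways to choose one of `p` and `¬ p` for every member `p` of a list. -/
def literalChoices : List (QF L) → List (List (QF L))
  | [] => [ [] ]
  | p :: l => (literalChoices l).flatMap fun α => [p :: α, p.neg :: α]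

theorem map_mem_literalChoices {l : List (QF L)} {f : QF L → QF L}
    (h : ∀ p, f p = p ∨ f p = p.neg) : l.map f ∈ literalChoices l := by
  induction l with
  | nil => simp [literalChoices]
  | cons p l ih =>
    simp only [literalChoices, List.mem_flatMap, List.map_cons]
    exact ⟨_, ih, by rcases h p with h | h <;> simp [h]⟩

theorem mem_of_mem_literalChoices {l α : List (QF L)} (h : α ∈ literalChoices l) :
    ∀ x ∈ α, ∃ p ∈ l, x = p ∨ x = p.neg := by
  induction l generalizing α with
  | nil => simp only [literalChoices, List.mem_singleton] at h; simp [h]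
  | cons p l ih =>
    simp only [literalChoices, List.mem_flatMap, List.mem_cons, List.not_mem_nil, or_false] at h
    obtain ⟨β, hβ, rfl | rfl⟩ := h <;> intro x hx <;> rcases List.mem_cons.1 hx with rfl | hx
    · exact ⟨x, by simp, Or.inl rfl⟩
    · obtain ⟨q, hq, h⟩ := ih hβ x hx; exact ⟨q, by simp [hq], h⟩
    · exact ⟨p, by simp, Or.inr rfl⟩
    · obtain ⟨q, hq, h⟩ := ih hβ x hx; exact ⟨q, by simp [hq], h⟩

/-- The consistency conditions of an assignment, for a choice of literals. -/
def Consistent (A α : List (QF L)) : Prop :=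
  (∀ p ∈ relevantList A, (p.neg ∈ α ↔ p ∉ α)) ∧ ∀ φ ∈ A, φ.PropTrue (· ∈ α)

/-- The list of all the assignments of `A`. -/
noncomputable def assignments (A : List (QF L)) : List (List (QF L)) :=
  open Classical in (literalChoices (relevantList A)).filter (Consistent A ·)

theorem listsAssignments_assignments (A : List (QF L)) :
    ListsAssignments A (assignments A) := by
  constructor
  · intro α hα
    simp only [assignments, List.mem_filter, decide_eq_true_eq] at hα
    refine ⟨fun l hl => ?_, fun p hp => hα.2.1 p (mem_relevantList.2 hp), hα.2.2⟩
    obtain ⟨p, hp, h⟩ := mem_of_mem_literalChoices hα.1 l hl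
    exact ⟨p, mem_relevantList.1 hp, h⟩
  · intro α hα
    -- `α` may list its literals in any order and with repetitions; what the enumeration contains is
    -- its normal form along `relevantList A`, which has the same members.
    refine ⟨literalsOf A (· ∈ α), ?_, hα.mem_literalsOf_iff⟩
    have h := (isAssignment_congr (A := A) hα.mem_literalsOf_iff).2 hα
    simp only [assignments, List.mem_filter, decide_eq_true_eq]
    refine ⟨map_mem_literalChoices fun p => ?_, fun p hp => h.2.1 p (mem_relevantList.1 hp), h.2.2⟩
    by_cases h : p ∈ α <;> simp [h]

/-- This removes the quantifier over lists and makes the condition decidable. An assignment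
contained in `A` satisfies `A`, so it contains every relevant literal that belongs to `A`; it can
only consist of the relevant literals of `A`, and it suffices to test these. -/
theorem containsAssignment_iff {A : List (QF L)} :
    ContainsAssignment A ↔
      (∀ p ∈ relevantList A, (p.neg ∈ A ↔ p ∉ A)) ∧ ∀ φ ∈ A, φ.PropTrue (· ∈ A) := by
  constructor
  · rintro ⟨α, hα, hs⟩
    have key : ∀ p, Relevant A p → (p ∈ A ↔ p ∈ α) := by
      intro p hp
      refine ⟨fun hpA => ?_, fun h => hs h⟩
      have h := hα.2.2 p hpA
      rwa [hp.isAtom.propTrue] at h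
    have key' : ∀ p, Relevant A p → (p.neg ∈ A ↔ p.neg ∈ α) := by
      intro p hp
      refine ⟨fun hpA => ?_, fun h => hs h⟩
      have h := hα.2.2 _ hpA
      rw [hα.2.1 p hp]
      exact fun hp' => h (hp.isAtom.propTrue.2 hp')
    refine ⟨fun p hp => ?_, fun φ hφ => ?_⟩
    · rw [mem_relevantList] at hp
      rw [key p hp, key' p hp, hα.2.1 p hp]
    · exact (QF.propTrue_congr fun p hp => key p (Or.inl ⟨φ, hφ, hp⟩)).2 (hα.2.2 φ hφ)
  · rintro ⟨h₁, h₂⟩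
    refine ⟨literalsOf A (· ∈ A), isAssignment_literalsOf h₂, fun l hl => ?_⟩
    obtain ⟨p, hp, ⟨h, rfl⟩ | ⟨h, rfl⟩⟩ := mem_literalsOf.1 hl
    · exact h
    · exact (h₁ p (mem_relevantList.2 hp)).2 h

end Assignments

/-! ### Termination -/

section Termination

variable {L L' : FirstOrder.Language.{0, 0}}

theorem constsOf_shareTerm_A {P : Pair L} {a c : ℕ} {t : L.Term ℕ} (ha : a ∈ constsOf P.A)
    (ht : t.varFinset ⊆ constsOf P.A \ {a}) :
    constsOf (P.shareTerm a t c).A = insert c (constsOf P.A \ {a}) := by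
  ext x
  have : x ∈ t.varFinset → x ∈ constsOf P.A ∧ x ≠ a := fun h => by simpa using ht h
  simp only [Pair.shareTerm, constsOf_cons, QF.consts_equal, Finset.mem_union,
    mem_constsOf_map_subst, Term.varFinset, Finset.mem_singleton, Finset.mem_insert,
    Finset.mem_sdiff]
  grind

theorem constsOf_shareTerm_B {P : Pair L} {a c : ℕ} {t : L.Term ℕ}
    (ht : t.varFinset ⊆ constsOf P.B) :
    constsOf (P.shareTerm a t c).B = insert c (constsOf P.B) := by
  ext x
  have : x ∈ t.varFinset → x ∈ constsOf P.B := fun h => ht h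
  simp only [Pair.shareTerm, constsOf_cons, QF.consts_equal, Finset.mem_union,
    Term.varFinset, Finset.mem_singleton, Finset.mem_insert]
  grind

/-- The number of the strict constants of a pair. -/
def Pair.strictCount (P : Pair L) : ℕ := P.strict.card + P.swap.strict.card

theorem Pair.strictCount_swap (P : Pair L) : P.swap.strictCount = P.strictCount := Nat.add_comm _ _

theorem Pair.strictCount_congr {P Q : Pair L} (hA : constsOf Q.A = constsOf P.A)
    (hB : constsOf Q.B = constsOf P.B) : Q.strictCount = P.strictCount := by
  simp only [strictCount, strict, swap, hA, hB]

/-- The strict constant `a` disappears from the first component, because the common term `t` cannot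
contain it; the fresh `c` occurs on both sides and is not strict. -/
theorem Pair.strictCount_shareTerm_lt {P : Pair L} {a c : ℕ} {t : L.Term ℕ} (ha : a ∈ P.strict)
    (ht : t.varFinset ⊆ P.common) (hc : P.Fresh c) :
    (P.shareTerm a t c).strictCount < P.strictCount := by
  simp only [strict, common, Fresh, Finset.mem_sdiff, Finset.mem_union, not_or] at ha ht hc
  have h₁ : constsOf (P.shareTerm a t c).A = insert c (constsOf P.A \ {a}) := by
    refine constsOf_shareTerm_A ha.1 fun x hx => ?_
    have := Finset.mem_inter.1 (ht hx)
    simp only [Finset.mem_sdiff, Finset.mem_singleton]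
    exact ⟨this.1, fun h => ha.2 (h ▸ this.2)⟩
  have h₂ : constsOf (P.shareTerm a t c).B = insert c (constsOf P.B) :=
    constsOf_shareTerm_B (ht.trans Finset.inter_subset_right)
  have e₁ : insert c (constsOf P.A \ {a}) \ insert c (constsOf P.B) =
      (constsOf P.A \ constsOf P.B).erase a := by
    ext x
    simp only [Finset.mem_sdiff, Finset.mem_insert, Finset.mem_singleton, Finset.mem_erase]
    grind
  -- Removing `a` from the first component makes no constant of the second one strict, since `a`
  -- does not occur there.
  have e₂ : insert c (constsOf P.B) \ insert c (constsOf P.A \ {a}) =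
      constsOf P.B \ constsOf P.A := by
    ext x
    simp only [Finset.mem_sdiff, Finset.mem_insert, Finset.mem_singleton]
    grind
  simp only [strictCount, strict, swap, h₁, h₂, e₁, e₂]
  have := Finset.card_erase_lt_of_mem (Finset.mem_sdiff.2 ha)
  omega

theorem constsOf_cons_of_subset {A : List (QF L)} {φ : QF L} (h : φ.consts ⊆ constsOf A) :
    constsOf (φ :: A) = constsOf A := Finset.union_eq_right.2 h

/-- The number of the components of a pair that contain no assignment, plus one, if the pair is
open. -/
noncomputable def Pair.undecided (P : Pair L) : ℕ :=
  open Classical in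
  if P.IsOpen then
    1 + (if ContainsAssignment P.A then 0 else 1) + (if ContainsAssignment P.B then 0 else 1)
  else 0

theorem Pair.undecided_pos {P : Pair L} (h : P.IsOpen) : 0 < P.undecided := by
  rw [undecided, if_pos h]; omega

/-- The strict order on pairs decreased by the rules. -/
def Pair.Smaller (Q P : Pair L) : Prop :=
  Q.strictCount < P.strictCount ∨ Q.strictCount = P.strictCount ∧ Q.undecided < P.undecided

theorem Pair.smaller_wf : WellFounded (Pair.Smaller (L := L)) := by
  refine Subrelation.wf (r := InvImage (Prod.Lex (· < ·) (· < ·))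
    fun P : Pair L => (P.strictCount, P.undecided)) ?_ (InvImage.wf _ (WellFounded.prod_lex
      wellFounded_lt wellFounded_lt))
  intro Q P h
  exact Prod.lex_def.2 h

/-- A closed pair has second measure `0` and an open one a positive measure, so adding `⊥` is a
decrease as long as the constants stay the same. -/
theorem Pair.smaller_of_closed {P Q : Pair L} (h : P.IsOpen) (hQ : ¬ Q.IsOpen)
    (hA : constsOf Q.A = constsOf P.A) (hB : constsOf Q.B = constsOf P.B) : Q.Smaller P :=
  Or.inr ⟨strictCount_congr hA hB, by
    have := undecided_pos h
    rwa [show Q.undecided = 0 from if_neg hQ]⟩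

theorem TheoryRule.smaller {g : L →ᴸ L'} {T : L.Theory} {P Q : Pair L'} {outcomes instr}
    (h : TheoryRule g T P outcomes instr) (hQ : Q ∈ outcomes) : Q.Smaller P := by
  cases h with
  | share as bs vs θ c h =>
    left
    simp only [shareOutcomes, List.mem_append, List.mem_map, Prod.exists,
      List.pair_mem_product] at hQ
    rcases hQ with ⟨a, t, ⟨ha, ht⟩, rfl⟩ | ⟨b, t, ⟨hb, ht⟩, rfl⟩
    · refine Pair.strictCount_shareTerm_lt ((h.mem_as a).1 ha) ?_ h.fresh
      rw [varFinset_onTerm]; exact h.vs_common t ht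
    · rw [Pair.strictCount_swap]
      have hA : constsOf (θ.lift g :: P.A) = constsOf P.A :=
        constsOf_cons_of_subset (by
          rw [QF.consts_lift]; exact h.θ_common.trans Finset.inter_subset_left)
      have hB : constsOf (θ.lift g :: P.B) = constsOf P.B :=
        constsOf_cons_of_subset (by
          rw [QF.consts_lift]; exact h.θ_common.trans Finset.inter_subset_right)
      have hc := h.vs_common t ht
      have hf := h.fresh
      have hm := (h.mem_bs b).1 hb
      -- An outcome for a `B`-strict constant is a term sharing in the swapped pair with `θ` added
      -- on both sides; `θ` is common, so the added copies do not change the sets of constants.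
      rw [← Pair.strictCount_swap P, ← Pair.strictCount_congr (P := P.swap)
        (Q := ⟨θ.lift g :: P.B, θ.lift g :: P.A⟩) hB hA]
      refine Pair.strictCount_shareTerm_lt ?_ ?_ ?_
      · simpa only [Pair.strict, Pair.swap, hA, hB] using hm
      · rw [varFinset_onTerm]
        simpa only [Pair.common, hA, hB, Finset.inter_comm] using hc
      · simpa only [Pair.Fresh, hA, hB, Finset.union_comm] using hf
  | terminate θ ho hu hc he hr =>
    rw [List.mem_singleton] at hQ
    subst hQ
    refine Pair.smaller_of_closed ho (fun h => h.2 (by simp)) ?_ ?_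
    · exact constsOf_cons_of_subset (by
          rw [QF.consts_lift]; exact hc.trans Finset.inter_subset_left)
    · rw [constsOf_cons, QF.consts_falsum, Finset.empty_union]
      exact constsOf_cons_of_subset (by
          rw [QF.consts_lift]; exact hc.trans Finset.inter_subset_right)

variable {L₁ L₂ : FirstOrder.Language.{0, 0}} {T₁ : L₁.Theory} {T₂ : L₂.Theory}

/-- If `Q` is closed, its count is `0` and the inequality still holds; it need not be shown that
Decide keeps the pair open. -/
theorem Pair.undecided_decide {P Q : Pair L} (h : P.IsOpen)
    (hlt : (¬ ContainsAssignment P.A ∧ ContainsAssignment Q.A ∧ Q.B = P.B) ∨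
      (¬ ContainsAssignment P.B ∧ ContainsAssignment Q.B ∧ Q.A = P.A)) :
    Q.undecided < P.undecided := by
  rw [undecided, undecided, if_pos h]
  rcases hlt with ⟨h₁, h₂, h₃⟩ | ⟨h₁, h₂, h₃⟩
  · rw [if_neg h₁, if_pos h₂, h₃]; split_ifs <;> omega
  · rw [if_neg h₁, if_pos h₂, h₃]; split_ifs <;> omega

theorem Next.smaller {P Q : Pair (L₁.sum L₂)} (h : Next T₁ T₂ Q P) : Q.Smaller P := by
  obtain ⟨outcomes, instr, h, hQ⟩ := h
  cases h with
  | decideA αs ho hn hne hl =>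
    obtain ⟨α, hα, rfl⟩ := List.mem_map.1 hQ
    have hα := hl.1 α hα
    refine Or.inr ⟨Pair.strictCount_congr ?_ rfl, Pair.undecided_decide ho
      (Or.inl ⟨hn, ⟨α, hα.append, by simp⟩, rfl⟩)⟩
    rw [constsOf_append]; exact Finset.union_eq_right.2 hα.constsOf_subset
  | decideAFail ho hn =>
    rw [List.mem_singleton] at hQ
    subst hQ
    exact Pair.smaller_of_closed ho (fun h => h.1 (by simp)) (by simp) rfl
  | decideB βs ho hn hne hl =>
    obtain ⟨α, hα, rfl⟩ := List.mem_map.1 hQ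
    have hα := hl.1 α hα
    refine Or.inr ⟨Pair.strictCount_congr rfl ?_, Pair.undecided_decide ho
      (Or.inr ⟨hn, ⟨α, hα.append, by simp⟩, rfl⟩)⟩
    rw [constsOf_append]; exact Finset.union_eq_right.2 hα.constsOf_subset
  | decideBFail ho hn =>
    rw [List.mem_singleton] at hQ
    subst hQ
    exact Pair.smaller_of_closed ho (fun h => h.2 (by simp)) rfl (by simp)
  | theory₁ outcomes instr h => exact h.smaller hQ
  | theory₂ outcomes instr h => exact h.smaller hQ

theorem next_wellFounded : WellFounded (Next T₁ T₂) :=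
  Subrelation.wf Next.smaller Pair.smaller_wf

end Termination

end CombInterp

namespace CombInterp

open FirstOrder.Language (Term)

/-! ### Soundness -/

section Soundness

variable {L L' : FirstOrder.Language.{0, 0}}

/-- The reducts of the models of `T'` along `g` are models of `T`. -/
def ReductModels (g : L →ᴸ L') (T : L.Theory) (T' : L'.Theory) : Prop :=
  ∀ (M : Type) (_ : L'.Structure M), M ⊨ T' → letI := g.reduct M; M ⊨ T

theorem IsInterpolant.realize {T : L.Theory} {A B : List (QF L)} {θ : QF L}
    (h : IsInterpolant T A B θ) {M : Type} [L.Structure M] [Nonempty M] (hM : M ⊨ T)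
    {v : ℕ → M} (hv : ∀ φ ∈ A, φ.Realize v) : θ.Realize v := h.1 M _ ‹_› hM v hv

theorem IsInterpolant.false_of_realize {T : L.Theory} {A B : List (QF L)} {θ : QF L}
    (h : IsInterpolant T A B θ) {M : Type} [L.Structure M] [Nonempty M] (hM : M ⊨ T)
    {v : ℕ → M} (hv : ∀ φ ∈ B, φ.Realize v) (hθ : θ.Realize v) : False :=
  h.2.1 ⟨M, _, ‹_›, hM, v, by
    rintro φ (rfl | h)
    · exact hθ
    · exact hv φ h⟩

theorem IsInterpolant.of_realize {T : L.Theory} {A B : List (QF L)} {θ : QF L}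
    (h₁ : ∀ (M : Type) [L.Structure M] [Nonempty M], M ⊨ T → ∀ v : ℕ → M,
      (∀ φ ∈ A, φ.Realize v) → θ.Realize v)
    (h₂ : ∀ (M : Type) [L.Structure M] [Nonempty M], M ⊨ T → ∀ v : ℕ → M,
      (∀ φ ∈ B, φ.Realize v) → θ.Realize v → False)
    (h₃ : θ.consts ⊆ constsOf A ∩ constsOf B) : IsInterpolant T A B θ :=
  ⟨fun M _ _ hM v hv => h₁ M hM v hv, fun ⟨M, _, _, hM, v, hv⟩ =>
    h₂ M hM v (fun φ hφ => hv φ (Or.inr hφ)) (hv θ (Or.inl rfl)), h₃⟩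

/-- Giving the fresh constant the value of `t` satisfies its definition, and replacing `a` by `c`
changes no truth value because `a` has the same value. This is the semantic counterpart of replacing
`c` with `t` in an interpolant. -/
theorem realize_shareTerm_A {P : Pair L} {a c : ℕ} {t : L.Term ℕ} {M : Type} [L.Structure M]
    {v : ℕ → M} (hc : P.Fresh c) (ht : c ∉ t.varFinset) (hv : ∀ φ ∈ P.A, φ.Realize v)
    (ha : v a = t.realize v) :
    ∀ φ ∈ (P.shareTerm a t c).A, φ.Realize (Function.update v c (t.realize v)) := by
  have e : t.realize (Function.update v c (t.realize v)) = t.realize v :=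
    term_realize_congr fun x hx => by
      rw [Function.update_of_ne]; rintro rfl; exact ht hx
  intro φ hφ
  rcases List.mem_cons.1 hφ with rfl | hφ
  · simp [e]
  · obtain ⟨ψ, hψ, rfl⟩ := List.mem_map.1 hφ
    rw [QF.realize_subst]
    refine (QF.realize_congr fun x hx => ?_).1 (hv ψ hψ)
    have hxc : x ≠ c := by
      rintro rfl
      exact hc (Finset.mem_union_left _ (constsOf_subset hψ hx))
    by_cases hxa : x = a
    · subst hxa; simp [ha]
    · simp [hxa, hxc]

/-- No equation between `a` and `t` is assumed: the second component is not rewritten, it only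
receives the definition of a fresh constant. -/
theorem realize_shareTerm_B {P : Pair L} {a c : ℕ} {t : L.Term ℕ} {M : Type} [L.Structure M]
    {v : ℕ → M} (hc : P.Fresh c) (ht : c ∉ t.varFinset) (hv : ∀ φ ∈ P.B, φ.Realize v) :
    ∀ φ ∈ (P.shareTerm a t c).B, φ.Realize (Function.update v c (t.realize v)) := by
  have e : t.realize (Function.update v c (t.realize v)) = t.realize v :=
    term_realize_congr fun x hx => by
      rw [Function.update_of_ne]; rintro rfl; exact ht hx
  intro φ hφ
  rcases List.mem_cons.1 hφ with rfl | hφ'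
  · simp [e]
  · refine (QF.realize_congr fun x hx => ?_).1 (hv φ hφ')
    rw [Function.update_of_ne]
    rintro rfl
    exact hc (Finset.mem_union_right _ (constsOf_subset hφ' hx))

theorem Pair.Fresh.notMem_of_subset_common {P : Pair L} {c : ℕ} {s : Finset ℕ} (hc : P.Fresh c)
    (h : s ⊆ P.common) : c ∉ s :=
  fun hs => hc (Finset.mem_union_left _ (Finset.mem_inter.1 (h hs)).1)

/-- After term sharing the common constants are the former ones and `c`; the substitution removes
`c` and brings in constants of `t` only, which are common. -/
theorem consts_subst_subset_common {P : Pair L} {a c : ℕ} {t : L.Term ℕ} {ι : QF L}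
    (ha : a ∈ P.strict) (ht : t.varFinset ⊆ P.common)
    (hι : ι.consts ⊆ constsOf (P.shareTerm a t c).A ∩ constsOf (P.shareTerm a t c).B) :
    (ι.subst c t).consts ⊆ P.common := by
  have ha := Finset.mem_sdiff.1 ha
  rw [constsOf_shareTerm_A ha.1, constsOf_shareTerm_B (ht.trans Finset.inter_subset_right)] at hι
  · intro x hx
    rcases QF.mem_consts_subst.1 hx with ⟨hx, hxc⟩ | ⟨-, hx⟩
    · have := hι hx
      simp only [Finset.mem_inter, Finset.mem_insert, hxc, false_or, Finset.mem_sdiff] at this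
      exact Finset.mem_inter.2 ⟨this.1.1, this.2⟩
    · exact ht hx
  · intro x hx
    have := Finset.mem_inter.1 (ht hx)
    simp only [Finset.mem_sdiff, Finset.mem_singleton]
    exact ⟨this.1, fun h => ha.2 (h ▸ this.2)⟩

theorem exists_mem_zip_of_mem {α β : Type} {l : List α} {l' : List β} (h : l.length = l'.length)
    {a : α} (ha : a ∈ l) : ∃ b, (a, b) ∈ l.zip l' := by
  obtain ⟨i, hi, rfl⟩ := List.getElem_of_mem ha
  exact ⟨l'[i], List.mem_iff_getElem.2 ⟨i, by simp; omega, by simp⟩⟩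

theorem mem_zipWith {α β γ : Type} {f : α → β → γ} {l : List α} {l' : List β} {x : γ} :
    x ∈ List.zipWith f l l' ↔ ∃ p ∈ l.zip l', f p.1 p.2 = x := by
  rw [← List.map_uncurry_zip_eq_zipWith, List.mem_map]; rfl

theorem part_realize {g : L →ᴸ L'} {M : Type} [L.Structure M] [L'.Structure M]
    [g.IsExpansionOn M] {v : ℕ → M} {A : List (QF L')} (hv : ∀ φ ∈ A, φ.Realize v) :
    ∀ φ ∈ part g A, φ.Realize v :=
  fun _ hφ => (QF.realize_lift g).1 (hv _ hφ.2)

/-- In a model of `A`, either some `a = t` holds, and the interpolant of that outcome is true once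
`c` is read as `t`; or no such equation holds, `θ` follows, and every outcome of the second kind has
a true first component, so all its interpolants are true. In a model of `B`, an interpolant of the
first kind is false, since the second component of its outcome is `B` with a definition. If `θ` and
all interpolants of the second kind were true, the choice of `θ` would force some `b = t`, and the
outcome for this equation would be contradicted. -/
theorem share_sound {g : L →ᴸ L'} {T : L.Theory} {T' : L'.Theory}
    (hg : ReductModels g T T') {P : Pair L'} {as bs : List ℕ} {vs : List (L.Term ℕ)} {θ : QF L}
    {c : ℕ} (h : ShareData g T P as bs vs θ c) {ιs : List (QF L')}
    (hlen : ιs.length = (shareOutcomes g P as bs vs θ c).length)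
    (hι : ∀ q ∈ (shareOutcomes g P as bs vs θ c).zip ιs, IsInterpolant T' q.1.A q.1.B q.2) :
    IsInterpolant T' P.A P.B (shareInterpolant g as bs vs θ c ιs) := by
  simp only [shareOutcomes, List.length_append, List.length_map] at hlen
  obtain ⟨ι₁, ι₂, rfl, hlen₁⟩ : ∃ ι₁ ι₂, ιs = ι₁ ++ ι₂ ∧ ι₁.length = (as.product vs).length :=
    ⟨ιs.take _, ιs.drop _, (List.take_append_drop (as.product vs).length ιs).symm, by simp; omega⟩
  have hlen₂ : ι₂.length = (bs.product vs).length := by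
    rw [List.length_append] at hlen; omega
  rw [shareOutcomes, List.zip_append (by simpa using hlen₁.symm), List.zip_map_left,
    List.zip_map_left] at hι
  -- Zipping stops at the shorter list, so pairing the first block of outcomes with the whole list
  -- of interpolants uses its first part only.
  have hzip : (as.product vs).zip (ι₁ ++ ι₂) = (as.product vs).zip ι₁ := by
    conv_lhs => rw [← List.append_nil (as.product vs)]
    rw [List.zip_append hlen₁.symm]; simp
  have hdrop : (ι₁ ++ ι₂).drop (as.product vs).length = ι₂ := by
    rw [← hlen₁]; simp
  have hA : ∀ p ∈ (as.product vs).zip ι₁, p.1.1 ∈ P.strict ∧ p.1.2 ∈ vs ∧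
      IsInterpolant T' (P.shareTerm p.1.1 (g.onTerm p.1.2) c).A
        (P.shareTerm p.1.1 (g.onTerm p.1.2) c).B p.2 := by
    rintro ⟨⟨a, t⟩, ι⟩ hp
    have hm := List.pair_mem_product.1 (List.of_mem_zip hp).1
    exact ⟨(h.mem_as a).1 hm.1, hm.2, hι (_, ι) (List.mem_append_left _ (List.mem_map_of_mem hp))⟩
  have hB : ∀ p ∈ (bs.product vs).zip ι₂, p.1.1 ∈ P.swap.strict ∧ p.1.2 ∈ vs ∧
      IsInterpolant T'
        (Pair.shareTerm ⟨θ.lift g :: P.B, θ.lift g :: P.A⟩ p.1.1 (g.onTerm p.1.2) c).B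
        (Pair.shareTerm ⟨θ.lift g :: P.B, θ.lift g :: P.A⟩ p.1.1 (g.onTerm p.1.2) c).A p.2 := by
    rintro ⟨⟨a, t⟩, ι⟩ hp
    have hm := List.pair_mem_product.1 (List.of_mem_zip hp).1
    exact ⟨(h.mem_bs a).1 hm.1, hm.2, hι (_, ι) (List.mem_append_right _ (List.mem_map_of_mem hp))⟩
  -- The outcomes of the second kind are term sharings in `R`, up to exchange of the components. As
  -- `θ` is common, `R` has the constants of the swapped pair.
  set R : Pair L' := ⟨θ.lift g :: P.B, θ.lift g :: P.A⟩ with hR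
  have hθA : constsOf (θ.lift g :: P.A) = constsOf P.A := constsOf_cons_of_subset (by
    rw [QF.consts_lift]; exact h.θ_common.trans Finset.inter_subset_left)
  have hθB : constsOf (θ.lift g :: P.B) = constsOf P.B := constsOf_cons_of_subset (by
    rw [QF.consts_lift]; exact h.θ_common.trans Finset.inter_subset_right)
  have hRc : R.common = P.common := by simp only [hR, Pair.common, hθA, hθB, Finset.inter_comm]
  have hRs : R.strict = P.swap.strict := by simp only [hR, Pair.strict, Pair.swap, hθA, hθB]
  have hRf : R.Fresh c := by
    have := h.fresh
    simpa only [hR, Pair.Fresh, hθA, hθB, Finset.union_comm] using this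
  have htc : ∀ t ∈ vs, (g.onTerm t).varFinset ⊆ P.common := fun t ht => by
    rw [varFinset_onTerm]; exact h.vs_common t ht
  have htf : ∀ t ∈ vs, c ∉ (g.onTerm t).varFinset := fun t ht =>
    h.fresh.notMem_of_subset_common (htc t ht)
  rw [shareInterpolant, hdrop]
  refine IsInterpolant.of_realize (fun M _ _ hM v hv => ?_) (fun M _ _ hM v hv hi => ?_) ?_
  · let _ := g.reduct M
    have hMT : M ⊨ T := hg M _ hM
    simp only [QF.realize_or, QF.realize_and, QF.realize_bigOr, QF.realize_bigAnd, mem_zipWith,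
      hzip]
    -- The formula `θ` is entailed only under the assumption that `as` and `vs` do not meet; if they
    -- meet, an outcome of the first kind provides the true disjunct.
    by_cases hav : ∃ a ∈ as, ∃ t ∈ vs, v a = t.realize v
    · left
      obtain ⟨a, ha, t, ht, e⟩ := hav
      obtain ⟨ι, hm⟩ := exists_mem_zip_of_mem hlen₁.symm (List.pair_mem_product.2 ⟨ha, ht⟩)
      refine ⟨_, ⟨_, hm, rfl⟩, ?_⟩
      rw [QF.realize_subst]
      refine (hA _ hm).2.2.realize hM (realize_shareTerm_A h.fresh (htf t ht) hv ?_)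
      rw [e, FirstOrder.Language.LHom.realize_onTerm]
    · right
      have hθ : (θ.lift g).Realize v := by
        rw [QF.realize_lift]
        refine h.entails M _ ‹_› hMT v ?_
        rintro φ (hφ | hφ)
        · exact part_realize hv φ hφ
        · rw [Set.mem_singleton_iff.1 hφ, QF.realize_neg, realize_meet]
          rintro ⟨_, ha, t, ht, e⟩
          obtain ⟨a, ha', rfl⟩ := mem_vars.1 ha
          exact hav ⟨a, ha', t, ht, e⟩
      refine ⟨hθ, ?_⟩
      rintro _ ⟨p, hp, rfl⟩
      rw [QF.realize_subst]
      refine (hB p hp).2.2.realize hM (realize_shareTerm_B hRf (htf _ (hB p hp).2.1) ?_)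
      intro φ hφ
      rcases List.mem_cons.1 hφ with rfl | hφ
      · exact hθ
      · exact hv φ hφ
  · let _ := g.reduct M
    have hMT : M ⊨ T := hg M _ hM
    simp only [QF.realize_or, QF.realize_and, QF.realize_bigOr, QF.realize_bigAnd, mem_zipWith,
      hzip] at hi
    rcases hi with ⟨_, ⟨p, hp, rfl⟩, hi⟩ | ⟨hθ, hi⟩
    · rw [QF.realize_subst] at hi
      exact (hA p hp).2.2.false_of_realize hM
        (realize_shareTerm_B h.fresh (htf _ (hA p hp).2.1) hv) hi
    · by_cases hbv : ∃ b ∈ bs, ∃ t ∈ vs, v b = t.realize v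
      · obtain ⟨b, hb, t, ht, e⟩ := hbv
        obtain ⟨ι, hm⟩ := exists_mem_zip_of_mem hlen₂.symm (List.pair_mem_product.2 ⟨hb, ht⟩)
        have hi := hi _ ⟨_, hm, rfl⟩
        rw [QF.realize_subst] at hi
        refine (hB _ hm).2.2.false_of_realize hM (realize_shareTerm_A hRf (htf t ht) ?_ ?_) hi
        · intro φ hφ
          rcases List.mem_cons.1 hφ with rfl | hφ
          · exact hθ
          · exact hv φ hφ
        · rw [e, FirstOrder.Language.LHom.realize_onTerm]
      · rw [QF.realize_lift] at hθ
        refine h.refutes ⟨M, _, ‹_›, hMT, v, ?_⟩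
        rintro φ ((hφ | hφ) | hφ)
        · exact part_realize hv φ hφ
        · rw [Set.mem_singleton_iff.1 hφ, QF.realize_neg, realize_meet]
          rintro ⟨_, hb, t, ht, e⟩
          obtain ⟨b, hb', rfl⟩ := mem_vars.1 hb
          exact hbv ⟨b, hb', t, ht, e⟩
        · rwa [Set.mem_singleton_iff.1 hφ]
  · intro x hx
    simp only [QF.consts_or, QF.consts_and, Finset.mem_union, QF.mem_consts_bigOr,
      QF.mem_consts_bigAnd, mem_zipWith, hzip, QF.consts_lift] at hx
    rcases hx with ⟨_, ⟨p, hp, rfl⟩, hx⟩ | hx | ⟨_, ⟨p, hp, rfl⟩, hx⟩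
    · obtain ⟨ha, ht, hi⟩ := hA p hp
      exact consts_subst_subset_common ha (htc _ ht) hi.2.2 hx
    · exact h.θ_common hx
    · obtain ⟨hb, ht, hi⟩ := hB p hp
      have hi := hi.2.2
      rw [Finset.inter_comm] at hi
      have := consts_subst_subset_common (hRs ▸ hb) (hRc ▸ htc _ ht) hi hx
      rwa [hRc] at this

theorem TheoryRule.sound {g : L →ᴸ L'} {T : L.Theory} {T' : L'.Theory}
    (hg : ReductModels g T T') {P : Pair L'} {outcomes instr}
    (h : TheoryRule g T P outcomes instr) {ιs : List (QF L')} (hlen : ιs.length = outcomes.length)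
    (hι : ∀ q ∈ outcomes.zip ιs, IsInterpolant T' q.1.A q.1.B q.2) :
    IsInterpolant T' P.A P.B (instr ιs) := by
  cases h with
  | share as bs vs θ c h => exact share_sound hg h hlen hι
  | terminate θ ho hu hc he hr =>
    obtain ⟨ι, rfl⟩ := List.length_eq_one_iff.1 hlen
    have hi : IsInterpolant T' (θ.lift g :: P.A) (QF.falsum :: θ.lift g :: P.B) ι :=
      hι (⟨θ.lift g :: P.A, QF.falsum :: θ.lift g :: P.B⟩, ι) (by simp)
    refine IsInterpolant.of_realize (fun M _ _ hM v hv => ?_) (fun M _ _ hM v hv hi => ?_) ?_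
    · let _ := g.reduct M
      have hMT : M ⊨ T := hg M _ hM
      have hθ : (θ.lift g).Realize v :=
        (QF.realize_lift g).2 (he M _ ‹_› hMT v (part_realize hv))
      simp only [QF.realize_and, QF.realize_bigAnd, List.mem_singleton, forall_eq]
      exact ⟨hθ, hi.realize hM (by simpa [hθ] using hv)⟩
    · let _ := g.reduct M
      have hMT : M ⊨ T := hg M _ hM
      simp only [QF.realize_and, QF.realize_lift] at hi
      refine hr ⟨M, _, ‹_›, hMT, v, ?_⟩
      rintro φ (hφ | hφ)
      · exact part_realize hv φ hφ
      · rw [Set.mem_singleton_iff.1 hφ]; exact hi.1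
    · intro x hx
      simp only [QF.consts_and, Finset.mem_union, QF.mem_consts_bigAnd, List.mem_singleton,
        QF.consts_lift, exists_eq_left] at hx
      rcases hx with hx | hx
      · exact hc hx
      · have := hi.2.2 hx
        simp only [constsOf_cons, QF.consts_lift, QF.consts_falsum, Finset.empty_union,
          Finset.mem_inter, Finset.mem_union] at this
        rcases this with ⟨h₁ | h₁, h₂⟩
        · exact hc h₁
        · rcases h₂ with h₂ | h₂
          · exact hc h₂
          · exact Finset.mem_inter.2 ⟨h₁, h₂⟩

/-- A family of alternatives for the first component, one of which holds in every model. -/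
theorem bigOr_isInterpolant {T : L.Theory} {P : Pair L} {αs : List (List (QF L))}
    (hα : ∀ α ∈ αs, constsOf α ⊆ constsOf P.A)
    (h : ∀ (M : Type) [L.Structure M] (v : ℕ → M), (∀ φ ∈ P.A, φ.Realize v) →
      ∃ α ∈ αs, ∀ φ ∈ α, φ.Realize v)
    {ιs : List (QF L)} (hlen : ιs.length = αs.length)
    (hι : ∀ q ∈ (αs.map fun α => (⟨α ++ P.A, P.B⟩ : Pair L)).zip ιs,
      IsInterpolant T q.1.A q.1.B q.2) :
    IsInterpolant T P.A P.B (QF.bigOr ιs) := by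
  rw [List.zip_map_left] at hι
  replace hι : ∀ p ∈ αs.zip ιs, IsInterpolant T (p.1 ++ P.A) P.B p.2 := fun p hp =>
    hι _ (List.mem_map_of_mem hp)
  have hex : ∀ ι ∈ ιs, ∃ α ∈ αs, IsInterpolant T (α ++ P.A) P.B ι := by
    intro ι hm
    obtain ⟨i, hi, rfl⟩ := List.getElem_of_mem hm
    exact ⟨αs[i], by simp, hι (αs[i], ιs[i]) (List.mem_iff_getElem.2 ⟨i, by simp; omega, by simp⟩)⟩
  refine IsInterpolant.of_realize (fun M _ _ hM v hv => ?_) (fun M _ _ hM v hv hi => ?_) ?_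
  · obtain ⟨α, hα, hαv⟩ := h M v hv
    obtain ⟨ι, hm⟩ := exists_mem_zip_of_mem hlen.symm hα
    refine QF.realize_bigOr.2 ⟨ι, (List.of_mem_zip hm).2, (hι _ hm).realize hM fun φ hφ => ?_⟩
    exact (List.mem_append.1 hφ).elim (hαv φ) (hv φ)
  · obtain ⟨ι, hm, hi⟩ := QF.realize_bigOr.1 hi
    obtain ⟨α, -, hα⟩ := hex ι hm
    exact hα.false_of_realize hM hv hi
  · intro x hx
    obtain ⟨ι, hm, hx⟩ := QF.mem_consts_bigOr.1 hx
    obtain ⟨α, hα', hi⟩ := hex ι hm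
    have := hi.2.2 hx
    rwa [constsOf_append, Finset.union_eq_right.2 (hα α hα')] at this

/-- A family of alternatives for the second component, one of which holds in every model. -/
theorem bigAnd_isInterpolant {T : L.Theory} {P : Pair L} {αs : List (List (QF L))}
    (hα : ∀ α ∈ αs, constsOf α ⊆ constsOf P.B)
    (h : ∀ (M : Type) [L.Structure M] (v : ℕ → M), (∀ φ ∈ P.B, φ.Realize v) →
      ∃ α ∈ αs, ∀ φ ∈ α, φ.Realize v)
    {ιs : List (QF L)} (hlen : ιs.length = αs.length)
    (hι : ∀ q ∈ (αs.map fun α => (⟨P.A, α ++ P.B⟩ : Pair L)).zip ιs,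
      IsInterpolant T q.1.A q.1.B q.2) :
    IsInterpolant T P.A P.B (QF.bigAnd ιs) := by
  rw [List.zip_map_left] at hι
  replace hι : ∀ p ∈ αs.zip ιs, IsInterpolant T P.A (p.1 ++ P.B) p.2 := fun p hp =>
    hι _ (List.mem_map_of_mem hp)
  have hex : ∀ ι ∈ ιs, ∃ α ∈ αs, IsInterpolant T P.A (α ++ P.B) ι := by
    intro ι hm
    obtain ⟨i, hi, rfl⟩ := List.getElem_of_mem hm
    exact ⟨αs[i], by simp, hι (αs[i], ιs[i]) (List.mem_iff_getElem.2 ⟨i, by simp; omega, by simp⟩)⟩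
  refine IsInterpolant.of_realize (fun M _ _ hM v hv => ?_) (fun M _ _ hM v hv hi => ?_) ?_
  · refine QF.realize_bigAnd.2 fun ι hm => ?_
    obtain ⟨α, -, hα⟩ := hex ι hm
    exact hα.realize hM hv
  · obtain ⟨α, hα, hαv⟩ := h M v hv
    obtain ⟨ι, hm⟩ := exists_mem_zip_of_mem hlen.symm hα
    refine (hι _ hm).false_of_realize hM (fun φ hφ => ?_)
      (QF.realize_bigAnd.1 hi ι (List.of_mem_zip hm).2)
    exact (List.mem_append.1 hφ).elim (hαv φ) (hv φ)
  · intro x hx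
    obtain ⟨ι, hm, hx⟩ := QF.mem_consts_bigAnd.1 hx
    obtain ⟨α, hα', hi⟩ := hex ι hm
    have := hi.2.2 hx
    rwa [constsOf_append, Finset.union_eq_right.2 (hα α hα')] at this

theorem ListsAssignments.exists_realize {A : List (QF L)} {αs : List (List (QF L))}
    (hl : ListsAssignments A αs) {M : Type} [L.Structure M] {v : ℕ → M}
    (hv : ∀ φ ∈ A, φ.Realize v) : ∃ α ∈ αs, ∀ φ ∈ α, φ.Realize v := by
  obtain ⟨α, hα, hαv⟩ := exists_assignment_of_realize hv
  obtain ⟨β, hβ, h⟩ := hl.2 α hα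
  exact ⟨β, hβ, fun l hl => hαv l ((h l).1 hl)⟩

variable {L₁ L₂ : FirstOrder.Language.{0, 0}} {T₁ : L₁.Theory} {T₂ : L₂.Theory}

theorem reductModels_inl : ReductModels FirstOrder.Language.LHom.sumInl T₁ (unionTheory T₁ T₂) := by
  intro M _ hM
  let _ := (FirstOrder.Language.LHom.sumInl : L₁ →ᴸ L₁.sum L₂).reduct M
  exact (FirstOrder.Language.LHom.onTheory_model _ _).1
    (hM.mono Set.subset_union_left)

theorem reductModels_inr : ReductModels FirstOrder.Language.LHom.sumInr T₂ (unionTheory T₁ T₂) := by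
  intro M _ hM
  let _ := (FirstOrder.Language.LHom.sumInr : L₂ →ᴸ L₁.sum L₂).reduct M
  exact (FirstOrder.Language.LHom.onTheory_model _ _).1
    (hM.mono Set.subset_union_right)

theorem Rule.sound {P : Pair (L₁.sum L₂)} {outcomes instr} (h : Rule T₁ T₂ P outcomes instr)
    {ιs : List (QF (L₁.sum L₂))} (hlen : ιs.length = outcomes.length)
    (hι : ∀ q ∈ outcomes.zip ιs, IsInterpolant (unionTheory T₁ T₂) q.1.A q.1.B q.2) :
    IsInterpolant (unionTheory T₁ T₂) P.A P.B (instr ιs) := by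
  cases h with
  | decideA αs ho hn hne hl =>
    rw [List.length_map] at hlen
    exact bigOr_isInterpolant (fun α hα => (hl.1 α hα).constsOf_subset)
      (fun M _ v hv => hl.exists_realize hv) hlen hι
  | decideAFail ho hn =>
    -- Failing Decide is treated as Decide with the single alternative `⊥`: a component without
    -- assignments has no model, so the alternatives are exhaustive vacuously.
    refine bigOr_isInterpolant (αs := [ [QF.falsum] ]) (by simp) (fun M _ v hv => ?_) hlen hι
    obtain ⟨α, hα, -⟩ := exists_assignment_of_realize hv
    exact absurd hα (hn α)
  | decideB αs ho hn hne hl =>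
    rw [List.length_map] at hlen
    exact bigAnd_isInterpolant (fun α hα => (hl.1 α hα).constsOf_subset)
      (fun M _ v hv => hl.exists_realize hv) hlen hι
  | decideBFail ho hn =>
    refine bigAnd_isInterpolant (αs := [ [QF.falsum] ]) (by simp) (fun M _ v hv => ?_) hlen hι
    obtain ⟨α, hα, -⟩ := exists_assignment_of_realize hv
    exact absurd hα (hn α)
  | theory₁ outcomes instr h => exact h.sound reductModels_inl hlen hι
  | theory₂ outcomes instr h => exact h.sound reductModels_inr hlen hι

theorem Run.sound {P : Pair (L₁.sum L₂)} {r : Option (QF (L₁.sum L₂))} (h : Run T₁ T₂ P r) :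
    ∀ θ, r = some θ → IsInterpolant (unionTheory T₁ T₂) P.A P.B θ := by
  induction h with
  | closeA P h =>
    rintro _ ⟨⟩
    exact IsInterpolant.of_realize (fun M _ _ _ v hv => hv _ h) (fun M _ _ _ v _ h => h) (by simp)
  | closeB P h =>
    rintro _ ⟨⟩
    exact IsInterpolant.of_realize (fun M _ _ _ v _ => QF.realize_top)
      (fun M _ _ _ v hv _ => hv _ h) (by simp)
  | saturated P _ _ => rintro _ ⟨⟩
  | node P outcomes instr ιs hR hlen _ ih =>
    rintro _ ⟨⟩
    exact hR.sound hlen fun q hq => ih q hq _ rfl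
  | fail P Q _ _ _ => rintro _ ⟨⟩

/-- The second components of the models of a pair after a purification step restrict to models of
the pair before. -/
theorem realize_of_purified {d : ℕ} {t : L.Term ℕ} {A A' : List (QF L)}
    (hA : A'.map (QF.subst d t) = A) {M : Type} [L.Structure M] {v : ℕ → M}
    (hv : ∀ φ ∈ QF.equal (Term.var d) t :: A', φ.Realize v) : ∀ φ ∈ A, φ.Realize v := by
  intro φ hφ
  rw [← hA] at hφ
  obtain ⟨ψ, hψ, rfl⟩ := List.mem_map.1 hφ
  have h := hv _ (List.mem_cons_self ..)
  simp only [QF.realize_equal, Term.realize] at h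
  rw [QF.realize_subst, ← h, Function.update_eq_self]
  exact hv ψ (List.mem_cons_of_mem _ hψ)

/-- The fresh constant is given the value of the term it abbreviates, which turns a model of the
original formulae into one of the purified ones. -/
theorem realize_purified {d : ℕ} {t : L.Term ℕ} {A A' : List (QF L)}
    (hA : A'.map (QF.subst d t) = A) (ht : d ∉ t.varFinset) {M : Type} [L.Structure M] {v : ℕ → M}
    (hv : ∀ φ ∈ A, φ.Realize v) : ∀ φ ∈ QF.equal (Term.var d) t :: A',
      φ.Realize (Function.update v d (t.realize v)) := by
  intro φ hφ
  rcases List.mem_cons.1 hφ with rfl | hφ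
  · simp only [QF.realize_equal, Term.realize, Function.update_self]
    refine term_realize_congr fun x hx => ?_
    rw [Function.update_of_ne]; rintro rfl; exact ht hx
  · rw [← QF.realize_subst]
    exact hv _ (hA ▸ List.mem_map_of_mem hφ)

theorem constsOf_purified_subset {d : ℕ} {t : L.Term ℕ} {A A' : List (QF L)}
    (hA : A'.map (QF.subst d t) = A) (ht : t.varFinset ⊆ constsOf A) :
    constsOf (QF.equal (Term.var d) t :: A') ⊆ insert d (constsOf A) := by
  intro x hx
  simp only [constsOf_cons, QF.consts_equal, Term.varFinset, Finset.mem_union,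
    Finset.mem_singleton] at hx
  rw [Finset.mem_insert]
  by_cases hxd : x = d
  · exact Or.inl hxd
  · rcases hx with (hx | hx) | hx
    · exact Or.inl hx
    · exact Or.inr (ht hx)
    · right
      rw [← hA, mem_constsOf_map_subst]
      exact Or.inl ⟨hx, hxd⟩

/-- The new constant `d` occurs in one component only, hence not in the interpolant, whose truth
value is therefore not affected by the value chosen for `d`. -/
theorem PurifyStep.isInterpolant {P Q : Pair (L₁.sum L₂)} (h : PurifyStep P Q)
    {T : (L₁.sum L₂).Theory} {θ : QF (L₁.sum L₂)} (hθ : IsInterpolant T Q.A Q.B θ) :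
    IsInterpolant T P.A P.B θ := by
  cases h with
  | left d t A' hd ht hA =>
    have hd' : d ∉ constsOf P.A ∧ d ∉ constsOf P.B := by simpa [Pair.Fresh] using hd
    have hc := hθ.2.2
    have hdθ : d ∉ θ.consts := fun h => hd'.2 (Finset.mem_inter.1 (hc h)).2
    refine IsInterpolant.of_realize (fun M _ _ hM v hv => ?_)
      (fun M _ _ hM v hv hi => hθ.false_of_realize hM hv hi) ?_
    · refine (QF.realize_congr fun x hx => ?_).1
        (hθ.realize hM (realize_purified hA (fun h => hd'.1 (ht h)) hv))
      rw [Function.update_of_ne]; rintro rfl; exact hdθ hx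
    · intro x hx
      have := Finset.mem_inter.1 (hc hx)
      refine Finset.mem_inter.2 ⟨?_, this.2⟩
      refine (Finset.mem_insert.1 (constsOf_purified_subset hA ht this.1)).resolve_left ?_
      rintro rfl; exact hdθ hx
  | right d t B' hd ht hB =>
    have hd' : d ∉ constsOf P.A ∧ d ∉ constsOf P.B := by simpa [Pair.Fresh] using hd
    have hc := hθ.2.2
    have hdθ : d ∉ θ.consts := fun h => hd'.1 (Finset.mem_inter.1 (hc h)).1
    refine IsInterpolant.of_realize (fun M _ _ hM v hv => hθ.realize hM hv)
      (fun M _ _ hM v hv hi => ?_) ?_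
    · refine hθ.false_of_realize hM (realize_purified hB (fun h => hd'.2 (ht h)) hv)
        ((QF.realize_congr fun x hx => ?_).1 hi)
      rw [Function.update_of_ne]; rintro rfl; exact hdθ hx
    · intro x hx
      have := Finset.mem_inter.1 (hc hx)
      refine Finset.mem_inter.2 ⟨this.1, ?_⟩
      refine (Finset.mem_insert.1 (constsOf_purified_subset hB ht this.2)).resolve_left ?_
      rintro rfl; exact hdθ hx

/-- A model of the purified pair satisfies `d = t` and thus, under the same valuation, the formulae
in which `d` is replaced back by `t`. -/
theorem PurifyStep.not_sat {P Q : Pair (L₁.sum L₂)} (h : PurifyStep P Q)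
    {T : (L₁.sum L₂).Theory} (hP : ¬ Sat T ({φ | φ ∈ P.A} ∪ {φ | φ ∈ P.B})) :
    ¬ Sat T ({φ | φ ∈ Q.A} ∪ {φ | φ ∈ Q.B}) := by
  rintro ⟨M, _, hM, hT, v, hv⟩
  refine hP ⟨M, _, hM, hT, v, ?_⟩
  cases h with
  | left d t A' hd ht hA =>
    rintro φ (hφ | hφ)
    · exact realize_of_purified hA (fun φ hφ => hv φ (Or.inl hφ)) φ hφ
    · exact hv φ (Or.inr hφ)
  | right d t B' hd ht hB =>
    rintro φ (hφ | hφ)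
    · exact hv φ (Or.inl hφ)
    · exact realize_of_purified hB (fun φ hφ => hv φ (Or.inr hφ)) φ hφ

theorem CI.sound {A B : List (QF (L₁.sum L₂))} {θ : QF (L₁.sum L₂)}
    (h : CI T₁ T₂ A B (some θ)) : IsInterpolant (unionTheory T₁ T₂) A B θ := by
  obtain ⟨P, ⟨hP, -, -⟩, hR⟩ := h
  have h := hR.sound θ rfl
  clear hR
  induction hP with
  | refl => exact h
  | tail _ hstep ih => exact ih (hstep.isInterpolant h)

end Soundness

end CombInterp

namespace CombInterp

open FirstOrder.Language (Term)

/-! ### The component parts of a finite set of formulae -/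

section Parts

variable {L L' : FirstOrder.Language.{0, 0}}

/-- A partial inverse of a map of signatures. -/
structure LHomInverse (g : L →ᴸ L') where
  func : ∀ {n : ℕ}, L'.Functions n → Option (L.Functions n)
  rel : ∀ {n : ℕ}, L'.Relations n → Option (L.Relations n)
  func_eq_some : ∀ {n : ℕ} (F : L'.Functions n) (f : L.Functions n),
    func F = some f ↔ g.onFunction f = F
  rel_eq_some : ∀ {n : ℕ} (R : L'.Relations n) (r : L.Relations n),
    rel R = some r ↔ g.onRelation r = R

variable {g : L →ᴸ L'}

/-- A tuple of optional values, as an optional tuple. -/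
def sequenceFin {α : Type} {n : ℕ} (f : Fin n → Option α) : Option (Fin n → α) :=
  if h : ∀ j, (f j).isSome then some fun j => (f j).get (h j) else none

theorem sequenceFin_eq_some {α : Type} {n : ℕ} {f : Fin n → Option α} {a : Fin n → α} :
    sequenceFin f = some a ↔ ∀ j, f j = some (a j) := by
  unfold sequenceFin
  constructor
  · intro h j
    split_ifs at h with hs
    rw [← Option.some.inj h]; simp
  · intro h
    have hs : ∀ j, (f j).isSome := fun j => by simp [h j]
    rw [dif_pos hs]
    congr 1; funext j; simp [h j]

/-- The term over the smaller signature whose image is the given term, if there is one. -/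
def unliftTerm (i : LHomInverse g) : L'.Term ℕ → Option (L.Term ℕ)
  | .var c => some (.var c)
  | .func F ts => (i.func F).bind fun f =>
      (sequenceFin fun j => unliftTerm i (ts j)).map (Term.func f)

theorem unliftTerm_eq_some {i : LHomInverse g} {t : L'.Term ℕ} {u : L.Term ℕ} :
    unliftTerm i t = some u ↔ g.onTerm u = t := by
  induction t generalizing u with
  | var c =>
    simp only [unliftTerm, Option.some.injEq]
    constructor
    · rintro rfl; rfl
    · intro h
      cases u with
      | var d => exact (congrArg Term.var (Term.var.inj h)).symm
      | func f us => cases h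
  | func F ts ih =>
    simp only [unliftTerm, Option.bind_eq_some_iff, Option.map_eq_some_iff, sequenceFin_eq_some,
      i.func_eq_some, ih]
    constructor
    · rintro ⟨f, rfl, us, hus, rfl⟩
      simp only [FirstOrder.Language.LHom.onTerm, hus]
    · intro h
      cases u with
      | var d => cases h
      | func f us =>
        simp only [FirstOrder.Language.LHom.onTerm, Term.func.injEq] at h
        obtain ⟨rfl, h₁, h₂⟩ := h
        rw [heq_eq_eq] at h₁ h₂
        exact ⟨f, h₁, us, fun j => congrFun h₂ j, rfl⟩

/-- The formula over the smaller signature whose image is the given formula, if there is one. -/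
def QF.unlift (i : LHomInverse g) : QF L' → Option (QF L)
  | falsum => some falsum
  | equal t u => (unliftTerm i t).bind fun t => (unliftTerm i u).map (equal t)
  | rel R ts => (i.rel R).bind fun r =>
      (sequenceFin fun j => unliftTerm i (ts j)).map (rel r)
  | imp φ ψ => (φ.unlift i).bind fun φ => (ψ.unlift i).map (imp φ)

theorem QF.unlift_eq_some {i : LHomInverse g} {φ : QF L'} {ψ : QF L} :
    φ.unlift i = some ψ ↔ ψ.lift g = φ := by
  induction φ generalizing ψ with
  | falsum =>
    cases ψ <;> simp [unlift, lift]
  | equal t u =>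
    simp only [unlift, Option.bind_eq_some_iff, Option.map_eq_some_iff, unliftTerm_eq_some]
    cases ψ <;> simp [lift]
  | rel R ts =>
    simp only [unlift, Option.bind_eq_some_iff, Option.map_eq_some_iff, sequenceFin_eq_some,
      i.rel_eq_some, unliftTerm_eq_some]
    constructor
    · rintro ⟨f, rfl, us, hus, rfl⟩
      simp only [lift, hus]
    · intro h
      cases ψ with
      | rel r us =>
        simp only [lift, rel.injEq] at h
        obtain ⟨rfl, h₁, h₂⟩ := h
        rw [heq_eq_eq] at h₁ h₂
        exact ⟨r, h₁, us, fun j => congrFun h₂ j, rfl⟩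
      | _ => cases h
  | imp φ₁ φ₂ ih₁ ih₂ =>
    simp only [unlift, Option.bind_eq_some_iff, Option.map_eq_some_iff, ih₁, ih₂]
    cases ψ <;> simp [lift]

theorem QF.isAtom_lift {φ : QF L} : (φ.lift g).IsAtom ↔ φ.IsAtom := by
  cases φ <;> rfl

/-- The literals of `A` over the smaller signature, as a list. -/
noncomputable def partList (i : LHomInverse g) (A : List (QF L')) : List (QF L) :=
  open Classical in (A.filterMap (QF.unlift i)).filter (QF.IsLiteral ·)

theorem mem_partList {i : LHomInverse g} {A : List (QF L')} {l : QF L} :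
    l ∈ partList i A ↔ l ∈ part g A := by
  simp only [partList, List.mem_filter, List.mem_filterMap, decide_eq_true_eq, part,
    Set.mem_ofPred_eq, QF.unlift_eq_some]
  constructor
  · rintro ⟨⟨φ, h, rfl⟩, hl⟩; exact ⟨hl, h⟩
  · rintro ⟨hl, h⟩; exact ⟨⟨_, h, rfl⟩, hl⟩

theorem consts_subset_of_mem_part {A : List (QF L')} {l : QF L} (h : l ∈ part g A) :
    l.consts ⊆ constsOf A := by
  rw [← QF.consts_lift g]; exact constsOf_subset h.2

theorem constsOf_partList_subset {i : LHomInverse g} {A : List (QF L')} :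
    (QF.bigAnd (partList i A)).consts ⊆ constsOf A := by
  intro x hx
  obtain ⟨φ, hφ, hx⟩ := QF.mem_consts_bigAnd.1 hx
  exact consts_subset_of_mem_part (mem_partList.1 hφ) hx

end Parts

/-! ### Existence of rules -/

section Existence

variable {L L' : FirstOrder.Language.{0, 0}} {g : L →ᴸ L'} {T : L.Theory}

/-- The list of the constants occurring in the first component only. -/
def Pair.strictList (P : Pair L) : List ℕ :=
  ((constListOf P.A).filter fun x => x ∉ constListOf P.B).dedup

theorem Pair.mem_strictList {P : Pair L} {x : ℕ} : x ∈ P.strictList ↔ x ∈ P.strict := by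
  simp [strictList, strict, mem_constListOf]

theorem Pair.nodup_strictList (P : Pair L) : P.strictList.Nodup := List.nodup_dedup _

/-- The literals of `P` over the component signature are satisfiable with all the strict constants
of the two components pairwise distinct. -/
def Separated (g : L →ᴸ L') (T : L.Theory) (P : Pair L') : Prop :=
  Sat T (part g P.A ∪ part g P.B ∪
    {(meet (vars P.strictList) (vars P.swap.strictList)).neg})

/-- The conditions of **Terminate**. -/
def TerminateData (g : L →ᴸ L') (T : L.Theory) (P : Pair L') (θ : QF L) : Prop :=
  P.IsOpen ∧ ¬ Sat T (part g P.A ∪ part g P.B) ∧ θ.consts ⊆ P.common ∧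
    Entails T (part g P.A) θ ∧ ¬ Sat T (part g P.B ∪ {θ})

theorem realize_bigAnd_partList {i : LHomInverse g} {A : List (QF L')} {M : Type} [L.Structure M]
    {v : ℕ → M} : (QF.bigAnd (partList i A)).Realize v ↔ ∀ φ ∈ part g A, φ.Realize v := by
  simp [mem_partList]

/-- If the literals are unsatisfiable, quantifier-free interpolation applied to the two conjunctions
gives the formula for Terminate. Otherwise the literals entail that some `A`-strict constant equals
some `B`-strict one, and equality interpolation yields common terms `vs` that always meet the strict
constants. Then the `A`-literals with `as` avoiding `vs` and the `B`-literals with `bs` avoiding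
`vs` are jointly unsatisfiable, and an interpolant of these is the `θ` of Share. -/
theorem exists_theoryRule_data (i : LHomInverse g) (hT : EqualityInterpolating T) {P : Pair L'}
    (ho : P.IsOpen) (hs : ¬ Separated g T P) :
    (∃ θ, TerminateData g T P θ) ∨
      ∃ vs θ c, ShareData g T P P.strictList P.swap.strictList vs θ c := by
  by_cases hsat : Sat T (part g P.A ∪ part g P.B)
  · right
    have hunsat : ∀ (M : Type) [L.Structure M] [Nonempty M], M ⊨ T → ∀ v : ℕ → M,
        (∀ φ ∈ part g P.A, φ.Realize v) → (∀ φ ∈ part g P.B, φ.Realize v) →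
        (meet (L := L) (vars P.strictList) (vars P.swap.strictList)).Realize v := by
      intro M _ _ hM v hA hB
      by_contra h
      refine hs ⟨M, _, ‹_›, hM, v, ?_⟩
      rintro φ ((hφ | hφ) | hφ)
      · exact hA φ hφ
      · exact hB φ hφ
      · rw [Set.mem_singleton_iff.1 hφ]; exact h
    -- The shared variables `x` are the common constants, the tuples `y₁`, `y₂` are all the strict
    -- constants of the two sides, and no auxiliary variables `z₁`, `z₂` remain.
    obtain ⟨vs, hvs, hent⟩ := hT.2 P.common.toList [] P.strictList [] P.swap.strictList
      (QF.bigAnd (partList i P.A)) (QF.bigAnd (partList i P.B)) (by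
        simp only [List.append_nil, List.nodup_append', Finset.nodup_toList,
          Pair.nodup_strictList, true_and, List.disjoint_left, List.mem_append,
          Finset.mem_toList, Pair.mem_strictList, Pair.common, Pair.strict, Pair.swap,
          Finset.mem_inter, Finset.mem_sdiff]
        grind) (by
        refine constsOf_partList_subset.trans fun x hx => ?_
        simp only [List.append_nil, List.mem_toFinset, List.mem_append,
          Finset.mem_toList, Pair.mem_strictList, Pair.common, Pair.strict,
          Finset.mem_inter, Finset.mem_sdiff]
        grind) (by
        refine constsOf_partList_subset.trans fun x hx => ?_
        simp only [List.append_nil, List.mem_toFinset, List.mem_append,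
          Finset.mem_toList, Pair.mem_strictList, Pair.common, Pair.strict, Pair.swap,
          Finset.mem_inter, Finset.mem_sdiff]
        grind) (by
        intro M _ _ hM v hv
        exact hunsat M hM v (realize_bigAnd_partList.1 (hv _ (Or.inl rfl)))
          (realize_bigAnd_partList.1 (hv _ (Or.inr rfl))))
    have hvs' : ∀ t ∈ vs, t.varFinset ⊆ P.common := fun t ht => by
      simpa using hvs t ht
    have hmeet : ∀ (M : Type) [L.Structure M] [Nonempty M], M ⊨ T → ∀ v : ℕ → M,
        (∀ φ ∈ part g P.A, φ.Realize v) → (∀ φ ∈ part g P.B, φ.Realize v) →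
        (meet (vars P.strictList) vs).Realize v ∨ (meet (vars P.swap.strictList) vs).Realize v := by
      intro M _ _ hM v hA hB
      have h := hent M _ ‹_› hM v (by
        rintro φ (rfl | rfl)
        · exact realize_bigAnd_partList.2 hA
        · exact realize_bigAnd_partList.2 hB)
      simp only [realize_meet, vars, List.map_append, List.mem_append] at h ⊢
      obtain ⟨t, ht | ht, h⟩ := h
      · exact Or.inl ⟨t, ht, h⟩
      · exact Or.inr ⟨t, ht, h⟩
    obtain ⟨θ, hθA, hθB, hθc⟩ := hT.1
      ((QF.bigAnd (partList i P.A)).and (meet (vars P.strictList) vs).neg)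
      ((QF.bigAnd (partList i P.B)).and (meet (vars P.swap.strictList) vs).neg) (by
        rintro ⟨M, _, _, hM, v, hv⟩
        have h₁ := QF.realize_and.1 (hv _ (Or.inl rfl))
        have h₂ := QF.realize_and.1 (hv _ (Or.inr rfl))
        exact (hmeet M hM v (realize_bigAnd_partList.1 h₁.1)
          (realize_bigAnd_partList.1 h₂.1)).elim h₁.2 h₂.2)
    obtain ⟨c, hc⟩ := Infinite.exists_notMem_finset (constsOf P.A ∪ constsOf P.B)
    -- Adding the avoidance of `vs` brings no foreign constant into a side. The claim is stated for
    -- a general `Q` with the same common constants, so as to serve both `P` and its swap.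
    have hmc : ∀ (Q : Pair L'), Q.common = P.common →
        (meet (vars (L := L) Q.strictList) vs).consts ⊆ constsOf Q.A := by
      intro Q hQ x hx
      rcases mem_consts_meet hx with ⟨t, ht, hx⟩ | ⟨t, ht, hx⟩
      · obtain ⟨y, hy, rfl⟩ := mem_vars.1 ht
        simp only [Term.varFinset, Finset.mem_singleton] at hx
        subst hx
        exact (Finset.mem_sdiff.1 (Pair.mem_strictList.1 hy)).1
      · have := hvs' t ht hx
        rw [← hQ] at this
        exact (Finset.mem_inter.1 this).1
    refine ⟨vs, θ, c, ho, P.nodup_strictList, fun _ => Pair.mem_strictList,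
      P.swap.nodup_strictList, fun _ => Pair.mem_strictList, hsat, hs, hvs', ?_, ?_, ?_, ?_, hc⟩
    · rintro ⟨M, _, _, hM, v, hv⟩
      have h := hmeet M hM v (fun φ hφ => hv φ (Or.inl (Or.inl hφ)))
        (fun φ hφ => hv φ (Or.inl (Or.inr hφ)))
      refine hv _ (Or.inr rfl) ?_
      simp only [realize_meet, vars, List.map_append, List.mem_append] at h ⊢
      rcases h with ⟨t, ht, h⟩ | ⟨t, ht, h⟩
      · exact ⟨t, Or.inl ht, h⟩
      · exact ⟨t, Or.inr ht, h⟩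
    · refine hθc.trans fun x hx => ?_
      simp only [constsOf_cons, constsOf_nil, Finset.union_empty, QF.consts_and, QF.consts_neg,
        Finset.mem_inter, Finset.mem_union] at hx
      refine Finset.mem_inter.2 ⟨?_, ?_⟩
      · exact hx.1.elim (fun h => constsOf_partList_subset h) fun h => hmc P rfl h
      · exact hx.2.elim (fun h => constsOf_partList_subset h)
          fun h => hmc P.swap (Finset.inter_comm _ _) h
    · intro M _ _ hM v hv
      refine hθA M _ ‹_› hM v ?_
      intro φ hφ
      rw [List.mem_singleton.1 hφ, QF.realize_and]
      exact ⟨realize_bigAnd_partList.2 fun φ hφ => hv φ (Or.inl hφ), hv _ (Or.inr rfl)⟩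
    · rintro ⟨M, _, _, hM, v, hv⟩
      refine hθB ⟨M, _, ‹_›, hM, v, ?_⟩
      rintro φ (hφ | hφ)
      · exact hv _ (Or.inr hφ)
      · rw [List.mem_singleton.1 hφ, QF.realize_and]
        exact ⟨realize_bigAnd_partList.2 fun φ hφ => hv φ (Or.inl (Or.inl hφ)),
          hv _ (Or.inl (Or.inr rfl))⟩
  · left
    obtain ⟨θ, hθA, hθB, hθc⟩ := hT.1 (QF.bigAnd (partList i P.A)) (QF.bigAnd (partList i P.B)) (by
        rintro ⟨M, _, _, hM, v, hv⟩
        refine hsat ⟨M, _, ‹_›, hM, v, ?_⟩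
        rintro φ (hφ | hφ)
        · exact realize_bigAnd_partList.1 (hv _ (Or.inl rfl)) φ hφ
        · exact realize_bigAnd_partList.1 (hv _ (Or.inr rfl)) φ hφ)
    refine ⟨θ, ho, hsat, ?_, ?_, ?_⟩
    · refine hθc.trans ?_
      simp only [constsOf_cons, constsOf_nil, Finset.union_empty]
      exact Finset.inter_subset_inter constsOf_partList_subset constsOf_partList_subset
    · intro M _ _ hM v hv
      refine hθA M _ ‹_› hM v ?_
      intro φ hφ
      rw [List.mem_singleton.1 hφ]
      exact realize_bigAnd_partList.2 hv
    · rintro ⟨M, _, _, hM, v, hv⟩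
      refine hθB ⟨M, _, ‹_›, hM, v, ?_⟩
      rintro φ (hφ | hφ)
      · exact hv _ (Or.inr hφ)
      · rw [List.mem_singleton.1 hφ]
        exact realize_bigAnd_partList.2 fun φ hφ => hv φ (Or.inl hφ)

/-- The separating model refutes the unsatisfiability condition of either rule. An instance of Share
may list the strict constants in another order than `strictList`; only membership matters. -/
theorem Separated.not_theoryRule {P : Pair L'} (h : Separated g T P) {outcomes instr} :
    ¬ TheoryRule g T P outcomes instr := by
  obtain ⟨M, _, hM, hT, v, hv⟩ := h
  rintro (⟨as, bs, vs, θ, c, h⟩ | ⟨θ, ho, hu, -⟩)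
  · refine h.unsat ⟨M, _, hM, hT, v, ?_⟩
    rintro φ (hφ | hφ)
    · exact hv φ (Or.inl hφ)
    · rw [Set.mem_singleton_iff.1 hφ]
      have := hv _ (Or.inr rfl)
      rw [QF.realize_neg, realize_meet] at this ⊢
      rintro ⟨t, ht, u, hu, e⟩
      obtain ⟨a, ha, rfl⟩ := mem_vars.1 ht
      obtain ⟨b, hb, rfl⟩ := mem_vars.1 hu
      exact this ⟨_, mem_vars.2 ⟨a, Pair.mem_strictList.2 ((h.mem_as a).1 ha), rfl⟩,
        _, mem_vars.2 ⟨b, Pair.mem_strictList.2 ((h.mem_bs b).1 hb), rfl⟩, e⟩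
  · exact hu ⟨M, _, hM, hT, v, fun φ hφ => hv φ (Or.inl hφ)⟩

end Existence

end CombInterp

namespace CombInterp

open FirstOrder.Language (Term)

/-! ### Combination of models -/

section Combination

/-- Two valuations in countably infinite sets that identify the same members of a set of constants
are related by a bijection. -/
theorem exists_equiv_of_same_kernel {M N : Type} [Countable M] [Infinite M] [Countable N]
    [Infinite N] (v : ℕ → M) (w : ℕ → N) (C : Finset ℕ)
    (h : ∀ c ∈ C, ∀ d ∈ C, v c = v d ↔ w c = w d) : ∃ e : M ≃ N, ∀ c ∈ C, e (v c) = w c := by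
  classical
  set S : Set M := v '' C
  set R : Set N := w '' C
  have hv : ∀ x : S, ∃ c ∈ C, v c = x := fun x => x.2
  have hw : ∀ y : R, ∃ c ∈ C, w c = y := fun y => y.2
  choose f hf hvf using hv
  choose k hk hwk using hw
  -- Each named element is sent, through a chosen constant `f x` naming it, to the value of that
  -- constant on the other side; equality of the kernels makes this independent of the choice and
  -- invertible.
  let e₁ : S ≃ R :=
    { toFun := fun x => ⟨w (f x), Set.mem_image_of_mem _ (hf x)⟩
      invFun := fun y => ⟨v (k y), Set.mem_image_of_mem _ (hk y)⟩
      left_inv := fun x => by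
        apply Subtype.ext
        rw [← hvf x]
        exact (h _ (hk _) _ (hf x)).2 (hwk _)
      right_inv := fun y => by
        apply Subtype.ext
        rw [← hwk y]
        exact (h _ (hf _) _ (hk y)).1 (hvf _) }
  have : Infinite ↑Sᶜ := ((C.finite_toSet.image v).infinite_compl).to_subtype
  have : Infinite ↑Rᶜ := ((C.finite_toSet.image w).infinite_compl).to_subtype
  -- The unnamed elements form cofinite subsets of countably infinite sets, hence countably infinite
  -- sets.
  obtain ⟨e₂⟩ : Nonempty (↑Sᶜ ≃ ↑Rᶜ) := nonempty_equiv_of_countable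
  refine ⟨(Equiv.Set.sumCompl S).symm.trans ((e₁.sumCongr e₂).trans (Equiv.Set.sumCompl R)),
    fun c hc => ?_⟩
  have hm : v c ∈ S := Set.mem_image_of_mem _ hc
  simp only [Equiv.trans_apply, Equiv.Set.sumCompl_symm_apply_of_mem hm, Equiv.sumCongr_apply,
    Sum.map_inl, Equiv.Set.sumCompl_apply_inl]
  exact (h _ (hf _) _ hc).1 (hvf ⟨v c, hm⟩)

variable {L : FirstOrder.Language.{0, 0}}

theorem QF.realize_equiv {M N : Type} [L.Structure M] [L.Structure N] (e : M ≃[L] N) {v : ℕ → M}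
    {φ : QF L} : φ.Realize (fun c => e (v c)) ↔ φ.Realize v := by
  induction φ with
  | falsum => rfl
  | equal t u =>
    simp only [realize_equal]
    rw [show (fun c => e (v c)) = e ∘ v from rfl, FirstOrder.Language.HomClass.realize_term,
      FirstOrder.Language.HomClass.realize_term]
    exact e.injective.eq_iff
  | rel R ts =>
    simp only [Realize]
    rw [show (fun c => e (v c)) = e ∘ v from rfl]
    simp only [FirstOrder.Language.HomClass.realize_term]
    exact e.map_rel R _
  | imp φ ψ ih₁ ih₂ => simp only [realize_imp, ih₁, ih₂]

theorem QF.realize_elementarySubstructure {M : Type} [L.Structure M]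
    (S : L.ElementarySubstructure M) {v : ℕ → S} {φ : QF L} :
    φ.Realize (fun c => (v c : M)) ↔ φ.Realize v := by
  induction φ with
  | falsum => rfl
  | equal t u =>
    simp only [realize_equal]
    rw [show (fun c => (v c : M)) = S.subtype ∘ v from rfl,
      FirstOrder.Language.HomClass.realize_term, FirstOrder.Language.HomClass.realize_term]
    exact S.subtype.injective.eq_iff
  | rel R ts =>
    simp only [Realize]
    rw [show (fun c => (v c : M)) = S.subtype ∘ v from rfl]
    simp only [FirstOrder.Language.HomClass.realize_term]
    exact S.subtype.map_rel R _
  | imp φ ψ ih₁ ih₂ => simp only [realize_imp, ih₁, ih₂]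

theorem card_le_aleph0 [Countable (Σ n, L.Functions n)] [Countable (Σ n, L.Relations n)] :
    L.card ≤ Cardinal.aleph0 := by
  rw [FirstOrder.Language.card]
  exact Cardinal.mk_le_aleph0_iff.2 (inferInstanceAs (Countable ((Σ n, L.Functions n) ⊕ _)))

/-- Downward Löwenheim-Skolem, applied to the countable range of the valuation in an infinite model:
the elementary substructure contains the values of all constants and is countably infinite, because
the signature is countable. -/
theorem StablyInfinite.exists_countable_model [Countable (Σ n, L.Functions n)]
    [Countable (Σ n, L.Relations n)] {T : L.Theory} (hT : StablyInfinite T) {φ : QF L}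
    (h : Sat T {φ}) : ∃ (M : Type) (_ : L.Structure M), Countable M ∧ Infinite M ∧ M ⊨ T ∧
      ∃ v : ℕ → M, φ.Realize v := by
  obtain ⟨M, _, hM, hMT, v, hv⟩ := hT φ h
  obtain ⟨S, hS, hc⟩ := FirstOrder.Language.exists_elementarySubstructure_card_eq L (Set.range v)
    (Cardinal.aleph0 : Cardinal.{0}) le_rfl (by
      simpa only [Cardinal.lift_id, Cardinal.mk_le_aleph0_iff] using
        (Set.countable_range v).to_subtype)
    (by simpa only [Cardinal.lift_id] using card_le_aleph0)
    (by simpa only [Cardinal.lift_id] using Cardinal.aleph0_le_mk M)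
  rw [Cardinal.lift_id, Cardinal.lift_id] at hc
  refine ⟨S, inferInstance, Cardinal.mk_le_aleph0_iff.1 hc.le, Cardinal.infinite_iff.2 hc.ge,
    inferInstance, fun c => ⟨v c, hS ⟨c, rfl⟩⟩, ?_⟩
  rw [← QF.realize_elementarySubstructure]
  exact hv

/-- Stable infiniteness speaks of a single formula, so the literals of both sides and the separation
of the strict constants are first gathered into one conjunction. -/
theorem Separated.exists_countable_model {L' : FirstOrder.Language.{0, 0}} {g : L →ᴸ L'}
    (i : LHomInverse g) [Countable (Σ n, L.Functions n)]
    [Countable (Σ n, L.Relations n)] {T : L.Theory} (hT : StablyInfinite T) {P : Pair L'}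
    (h : Separated g T P) : ∃ (M : Type) (_ : L.Structure M), Countable M ∧ Infinite M ∧ M ⊨ T ∧
      ∃ v : ℕ → M, (∀ φ ∈ part g P.A, φ.Realize v) ∧ (∀ φ ∈ part g P.B, φ.Realize v) ∧
        ∀ a ∈ P.strict, ∀ b ∈ P.swap.strict, v a ≠ v b := by
  obtain ⟨M, _, hM, hI, hMT, v, hv⟩ := hT.exists_countable_model
    (φ := QF.bigAnd [QF.bigAnd (partList i P.A), QF.bigAnd (partList i P.B),
      (meet (vars P.strictList) (vars P.swap.strictList)).neg]) (by
    obtain ⟨M, _, hM, hMT, v, hv⟩ := h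
    refine ⟨M, _, hM, hMT, v, ?_⟩
    rintro _ rfl
    simp only [QF.realize_bigAnd (l := [_, _, _]), List.mem_cons, List.not_mem_nil, or_false,
      forall_eq_or_imp, forall_eq, realize_bigAnd_partList]
    exact ⟨fun φ hφ => hv φ (Or.inl (Or.inl hφ)), fun φ hφ => hv φ (Or.inl (Or.inr hφ)),
      hv _ (Or.inr rfl)⟩)
  simp only [QF.realize_bigAnd (l := [_, _, _]), List.mem_cons, List.not_mem_nil, or_false,
    forall_eq_or_imp, forall_eq, realize_bigAnd_partList] at hv
  refine ⟨M, _, hM, hI, hMT, v, hv.1, hv.2.1, fun a ha b hb e => hv.2.2 ?_⟩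
  exact realize_meet.2 ⟨_, mem_vars.2 ⟨a, Pair.mem_strictList.2 ha, rfl⟩,
    _, mem_vars.2 ⟨b, Pair.mem_strictList.2 hb, rfl⟩, e⟩

theorem IsAssignment.mem_or_neg_mem {A α : List (QF L)} (h : IsAssignment A α) {p : QF L}
    (hp : Relevant A p) : p ∈ α ∨ p.neg ∈ α := by
  by_cases h' : p ∈ α
  · exact Or.inl h'
  · exact Or.inr ((h.2.1 p hp).2 h')

end Combination

/-! ### Saturated pairs, their satisfiability, and a sufficient selection of rule instances -/

section Saturation

variable {L₁ L₂ : FirstOrder.Language.{0, 0}} {T₁ : L₁.Theory} {T₂ : L₂.Theory}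

/-- Constants that the assignments identify. -/
theorem ContainsAssignment.equal_iff {L L' : FirstOrder.Language.{0, 0}} {g : L →ᴸ L'}
    {A : List (QF L')} (h : ContainsAssignment A) {M : Type} [L.Structure M] {v : ℕ → M}
    (hv : ∀ φ ∈ part g A, φ.Realize v) {c d : ℕ} (hc : c ∈ constsOf A) (hd : d ∈ constsOf A) :
    v c = v d ↔ QF.equal (Term.var c) (Term.var d) ∈ A := by
  obtain ⟨α, hα, hs⟩ := h
  rcases hα.mem_or_neg_mem (Or.inr ⟨c, hc, d, hd, rfl⟩) with h | h
  · refine iff_of_true ?_ (hs h)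
    -- An equation between constants uses no symbol of the signature, so it is visible to the
    -- component theory whatever `g` is. This is what makes the two theories agree on equalities.
    exact hv (QF.equal (Term.var c) (Term.var d)) ⟨Or.inl trivial, hs h⟩
  · refine iff_of_false ?_ fun h' => ?_
    · exact hv (QF.equal (Term.var c) (Term.var d)).neg
        ⟨Or.inr ⟨QF.equal (Term.var c) (Term.var d), trivial, rfl⟩, hs h⟩
    · have : QF.equal (Term.var c) (Term.var d) ∈ α := hα.2.2 _ h'
      exact (hα.2.1 _ (Or.inr ⟨c, hc, d, hd, rfl⟩)).1 h this

def inverseInl : LHomInverse (FirstOrder.Language.LHom.sumInl : L₁ →ᴸ L₁.sum L₂) where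
  func := Sum.getLeft?
  rel := Sum.getLeft?
  func_eq_some F _ := (Sum.getLeft?_eq_some_iff (x := F)).trans eq_comm
  rel_eq_some F _ := (Sum.getLeft?_eq_some_iff (x := F)).trans eq_comm

def inverseInr : LHomInverse (FirstOrder.Language.LHom.sumInr : L₂ →ᴸ L₁.sum L₂) where
  func := Sum.getRight?
  rel := Sum.getRight?
  func_eq_some F _ := (Sum.getRight?_eq_some_iff (x := F)).trans eq_comm
  rel_eq_some F _ := (Sum.getRight?_eq_some_iff (x := F)).trans eq_comm

/-- By purity each literal of the assignment belongs to one of the two component parts, and the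
assignment determines the truth of all of `A`. -/
theorem realize_of_parts {A : List (QF (L₁.sum L₂))} (hp : ∀ φ ∈ A, IsPure φ)
    (h : ContainsAssignment A) {M : Type} [L₁.Structure M] [L₂.Structure M] {v : ℕ → M}
    (h₁ : ∀ φ ∈ part FirstOrder.Language.LHom.sumInl A, φ.Realize v)
    (h₂ : ∀ φ ∈ part FirstOrder.Language.LHom.sumInr A, φ.Realize v) :
    ∀ φ ∈ A, φ.Realize v := by
  obtain ⟨α, hα, hs⟩ := h
  refine hα.realize fun l hl => ?_
  obtain ⟨p, hr, hlp⟩ := hα.1 l hl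
  have hpure : (∃ q : QF L₁, q.lift FirstOrder.Language.LHom.sumInl = p) ∨
      ∃ q : QF L₂, q.lift FirstOrder.Language.LHom.sumInr = p := by
    rcases hr with ⟨φ, hφ, hpφ⟩ | ⟨c, -, d, -, rfl⟩
    · exact hp φ hφ p hpφ
    · exact Or.inl ⟨QF.equal (Term.var c) (Term.var d), rfl⟩
  have hat := hr.isAtom
  rcases hpure with ⟨q, rfl⟩ | ⟨q, rfl⟩
  · rw [QF.isAtom_lift] at hat
    rcases hlp with rfl | rfl
    · exact (QF.realize_lift _).2 (h₁ q ⟨Or.inl hat, hs hl⟩)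
    · exact fun hq => h₁ q.neg ⟨Or.inr ⟨q, hat, rfl⟩, hs hl⟩ ((QF.realize_lift _).1 hq)
  · rw [QF.isAtom_lift] at hat
    rcases hlp with rfl | rfl
    · exact (QF.realize_lift _).2 (h₂ q ⟨Or.inl hat, hs hl⟩)
    · exact fun hq => h₂ q.neg ⟨Or.inr ⟨q, hat, rfl⟩, hs hl⟩ ((QF.realize_lift _).1 hq)

/-- The conditions under which no rule applies to an open pair. -/
structure Saturated (T₁ : L₁.Theory) (T₂ : L₂.Theory) (P : Pair (L₁.sum L₂)) : Prop where
  isOpen : P.IsOpen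
  containsA : ContainsAssignment P.A
  containsB : ContainsAssignment P.B
  separated₁ : Separated FirstOrder.Language.LHom.sumInl T₁ P
  separated₂ : Separated FirstOrder.Language.LHom.sumInr T₂ P

/-- The Nelson-Oppen combination: two countably infinite models that identify the same constants are
matched by a bijection, along which one structure is transported to the domain of the other. -/
theorem Saturated.sat [Countable (Σ n, L₁.Functions n)] [Countable (Σ n, L₁.Relations n)]
    [Countable (Σ n, L₂.Functions n)] [Countable (Σ n, L₂.Relations n)]
    (hsi₁ : StablyInfinite T₁) (hsi₂ : StablyInfinite T₂) {P : Pair (L₁.sum L₂)}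
    (h : Saturated T₁ T₂ P) (hpA : ∀ φ ∈ P.A, IsPure φ) (hpB : ∀ φ ∈ P.B, IsPure φ) :
    Sat (unionTheory T₁ T₂) ({φ | φ ∈ P.A} ∪ {φ | φ ∈ P.B}) := by
  obtain ⟨M, _, _, _, hM, v, hvA, hvB, hv⟩ := h.separated₁.exists_countable_model inverseInl hsi₁
  obtain ⟨N, _, _, _, hN, w, hwA, hwB, hw⟩ := h.separated₂.exists_countable_model inverseInr hsi₂
  have hkerA : ∀ c ∈ constsOf P.A, ∀ d ∈ constsOf P.A, v c = v d ↔ w c = w d :=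
    fun c hc d hd => (h.containsA.equal_iff hvA hc hd).trans (h.containsA.equal_iff hwA hc hd).symm
  have hkerB : ∀ c ∈ constsOf P.B, ∀ d ∈ constsOf P.B, v c = v d ↔ w c = w d :=
    fun c hc d hd => (h.containsB.equal_iff hvB hc hd).trans (h.containsB.equal_iff hwB hc hd).symm
  -- If one of the two constants is common, both lie on one side and its assignment decides their
  -- equality. Otherwise both are strict, on opposite sides, and both models keep them distinct.
  have hkerAB : ∀ c ∈ constsOf P.A, ∀ d ∈ constsOf P.B, v c = v d ↔ w c = w d := by
    intro c hc d hd
    by_cases hcB : c ∈ constsOf P.B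
    · exact hkerB c hcB d hd
    by_cases hdA : d ∈ constsOf P.A
    · exact hkerA c hc d hdA
    have hcs : c ∈ P.strict := Finset.mem_sdiff.2 ⟨hc, hcB⟩
    have hds : d ∈ P.swap.strict := Finset.mem_sdiff.2 ⟨hd, hdA⟩
    exact iff_of_false (hv c hcs d hds) (hw c hcs d hds)
  obtain ⟨e, he⟩ := exists_equiv_of_same_kernel v w (constsOf P.A ∪ constsOf P.B) (by
    intro c hc d hd
    rcases Finset.mem_union.1 hc with hc | hc <;> rcases Finset.mem_union.1 hd with hd | hd
    · exact hkerA c hc d hd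
    · exact hkerAB c hc d hd
    · rw [eq_comm, eq_comm (a := w c)]; exact hkerAB d hd c hc
    · exact hkerB c hc d hd)
  let _ : L₁.Structure N := e.inducedStructure
  have hN₁ : N ⊨ T₁ :=
    FirstOrder.Language.StrongHomClass.theory_model (L := L₁) (M := M) (T := T₁)
      e.inducedStructureEquiv
  -- On the constants of the pair the valuation `w` is the image of `v` under `e`, so the literals
  -- over the first signature remain true in the transported structure.
  have key : ∀ (A : List (QF (L₁.sum L₂))), constsOf A ⊆ constsOf P.A ∪ constsOf P.B →
      (∀ φ ∈ part FirstOrder.Language.LHom.sumInl A, φ.Realize v) →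
      ∀ φ ∈ part FirstOrder.Language.LHom.sumInl A, φ.Realize w := by
    intro A hA hAv φ hφ
    have h₁ := (QF.realize_equiv (e.inducedStructureEquiv (L := L₁))).2 (hAv φ hφ)
    refine (QF.realize_congr fun c hc => ?_).1 h₁
    exact he c (hA (consts_subset_of_mem_part hφ hc))
  refine ⟨N, FirstOrder.Language.sumStructure L₁ L₂ N, inferInstance, ?_, w, ?_⟩
  · refine FirstOrder.Language.Theory.model_union_iff.2 ⟨?_, ?_⟩
    · exact (FirstOrder.Language.LHom.onTheory_model _ _).2 hN₁
    · exact (FirstOrder.Language.LHom.onTheory_model _ _).2 hN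
  · rintro φ (hφ | hφ)
    · exact realize_of_parts hpA h.containsA (key _ Finset.subset_union_left hvA) hwA φ hφ
    · exact realize_of_parts hpB h.containsB (key _ Finset.subset_union_right hvB) hwB φ hφ

theorem Saturated.not_rule {P : Pair (L₁.sum L₂)} (h : Saturated T₁ T₂ P) {outcomes instr} :
    ¬ Rule T₁ T₂ P outcomes instr := by
  rintro (⟨αs, ho, hn, -⟩ | ⟨ho, hn⟩ | ⟨αs, ho, hn, -⟩ | ⟨ho, hn⟩ | ⟨_, _, hr⟩ | ⟨_, _, hr⟩)
  · exact hn h.containsA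
  · obtain ⟨α, hα, -⟩ := h.containsA; exact hn α hα
  · exact hn h.containsB
  · obtain ⟨α, hα, -⟩ := h.containsB; exact hn α hα
  · exact h.separated₁.not_theoryRule hr
  · exact h.separated₂.not_theoryRule hr

/-- The alternatives of **Decide** for `A`: the assignments of `A`, or `⊥` if there are none. -/
noncomputable def alternatives (A : List (QF (L₁.sum L₂))) : List (List (QF (L₁.sum L₂))) :=
  open Classical in if assignments A = [] then [ [QF.falsum] ] else assignments A

theorem rule_decideA {P : Pair (L₁.sum L₂)} (ho : P.IsOpen) (hn : ¬ ContainsAssignment P.A) :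
    Rule T₁ T₂ P ((alternatives P.A).map fun α => ⟨α ++ P.A, P.B⟩) QF.bigOr := by
  unfold alternatives
  split_ifs with h
  · refine Rule.decideAFail P ho fun α hα => ?_
    obtain ⟨β, hβ, -⟩ := (listsAssignments_assignments P.A).2 α hα
    simp [h] at hβ
  · exact Rule.decideA P _ ho hn h (listsAssignments_assignments P.A)

theorem rule_decideB {P : Pair (L₁.sum L₂)} (ho : P.IsOpen) (hn : ¬ ContainsAssignment P.B) :
    Rule T₁ T₂ P ((alternatives P.B).map fun α => ⟨P.A, α ++ P.B⟩) QF.bigAnd := by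
  unfold alternatives
  split_ifs with h
  · refine Rule.decideBFail P ho fun α hα => ?_
    obtain ⟨β, hβ, -⟩ := (listsAssignments_assignments P.B).2 α hα
    simp [h] at hβ
  · exact Rule.decideB P _ ho hn h (listsAssignments_assignments P.B)

/-- A selection of the instances of **Share** and **Terminate**, with the result `ι` of the
instruction applied to `ιs`. -/
def TheoryStep {L L' : FirstOrder.Language.{0, 0}} (g : L →ᴸ L') (T : L.Theory) (P : Pair L')
    (outcomes : List (Pair L')) (ιs : List (QF L')) (ι : QF L') : Prop :=
  (∃ θ, TerminateData g T P θ ∧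
    outcomes = [⟨θ.lift g :: P.A, QF.falsum :: θ.lift g :: P.B⟩] ∧
    ι = QF.and (θ.lift g) (QF.bigAnd ιs)) ∨
  ∃ vs θ c, ShareData g T P P.strictList P.swap.strictList vs θ c ∧
    outcomes = shareOutcomes g P P.strictList P.swap.strictList vs θ c ∧
    ι = shareInterpolant g P.strictList P.swap.strictList vs θ c ιs

/-- A selection of the instances of the rules that suffices to carry out the procedure, with the
result `ι` of the instruction applied to `ιs`. -/
def Step (T₁ : L₁.Theory) (T₂ : L₂.Theory) (P : Pair (L₁.sum L₂))
    (outcomes : List (Pair (L₁.sum L₂))) (ιs : List (QF (L₁.sum L₂))) (ι : QF (L₁.sum L₂)) :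
    Prop :=
  ((P.IsOpen ∧ ¬ ContainsAssignment P.A) ∧
    outcomes = ((alternatives P.A).map fun α => ⟨α ++ P.A, P.B⟩) ∧ ι = QF.bigOr ιs) ∨
  ((P.IsOpen ∧ ¬ ContainsAssignment P.B) ∧
    outcomes = ((alternatives P.B).map fun α => ⟨P.A, α ++ P.B⟩) ∧ ι = QF.bigAnd ιs) ∨
  TheoryStep FirstOrder.Language.LHom.sumInl T₁ P outcomes ιs ι ∨
  TheoryStep FirstOrder.Language.LHom.sumInr T₂ P outcomes ιs ι

theorem TheoryStep.theoryRule {L L' : FirstOrder.Language.{0, 0}} {g : L →ᴸ L'} {T : L.Theory}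
    {P : Pair L'} {outcomes : List (Pair L')} {ιs : List (QF L')} {ι : QF L'}
    (h : TheoryStep g T P outcomes ιs ι) :
    ∃ instr, TheoryRule g T P outcomes instr ∧ instr ιs = ι := by
  rcases h with ⟨θ, h, rfl, rfl⟩ | ⟨vs, θ, c, h, rfl, rfl⟩
  · exact ⟨_, TheoryRule.terminate P θ h.1 h.2.1 h.2.2.1 h.2.2.2.1 h.2.2.2.2, rfl⟩
  · exact ⟨_, TheoryRule.share P _ _ vs θ c h, rfl⟩

theorem Step.rule {P : Pair (L₁.sum L₂)} {outcomes : List (Pair (L₁.sum L₂))}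
    {ιs : List (QF (L₁.sum L₂))} {ι : QF (L₁.sum L₂)} (h : Step T₁ T₂ P outcomes ιs ι) :
    ∃ instr, Rule T₁ T₂ P outcomes instr ∧ instr ιs = ι := by
  rcases h with ⟨⟨ho, hn⟩, rfl, rfl⟩ | ⟨⟨ho, hn⟩, rfl, rfl⟩ | h | h
  · exact ⟨_, rule_decideA ho hn, rfl⟩
  · exact ⟨_, rule_decideB ho hn, rfl⟩
  · obtain ⟨instr, h, e⟩ := h.theoryRule; exact ⟨instr, Rule.theory₁ P _ _ h, e⟩
  · obtain ⟨instr, h, e⟩ := h.theoryRule; exact ⟨instr, Rule.theory₂ P _ _ h, e⟩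

theorem exists_theoryStep {L L' : FirstOrder.Language.{0, 0}} {g : L →ᴸ L'} {T : L.Theory}
    (i : LHomInverse g) (hT : EqualityInterpolating T) {P : Pair L'}
    (ho : P.IsOpen) (hs : ¬ Separated g T P) :
    ∃ outcomes, ∀ ιs, ∃ ι, TheoryStep g T P outcomes ιs ι := by
  rcases exists_theoryRule_data i hT ho hs with ⟨θ, h⟩ | ⟨vs, θ, c, h⟩
  · exact ⟨_, fun ιs => ⟨_, Or.inl ⟨θ, h, rfl, rfl⟩⟩⟩
  · exact ⟨_, fun ιs => ⟨_, Or.inr ⟨vs, θ, c, h, rfl, rfl⟩⟩⟩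

/-- The outcomes are chosen before the list `ιs`: the rule instance has to be fixed first, the
interpolants of its outcomes are found by recursion, and the result `ι` depends on them. -/
theorem saturated_or_exists_step (hei₁ : EqualityInterpolating T₁)
    (hei₂ : EqualityInterpolating T₂) {P : Pair (L₁.sum L₂)} (ho : P.IsOpen) :
    Saturated T₁ T₂ P ∨ ∃ outcomes, ∀ ιs, ∃ ι, Step T₁ T₂ P outcomes ιs ι := by
  by_cases hA : ContainsAssignment P.A
  · by_cases hB : ContainsAssignment P.B
    · by_cases h₁ : Separated FirstOrder.Language.LHom.sumInl T₁ P
      · by_cases h₂ : Separated FirstOrder.Language.LHom.sumInr T₂ P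
        · exact Or.inl ⟨ho, hA, hB, h₁, h₂⟩
        · obtain ⟨o, h⟩ := exists_theoryStep inverseInr hei₂ ho h₂
          exact Or.inr ⟨o, fun ιs => (h ιs).imp fun _ h => Or.inr (Or.inr (Or.inr h))⟩
      · obtain ⟨o, h⟩ := exists_theoryStep inverseInl hei₁ ho h₁
        exact Or.inr ⟨o, fun ιs => (h ιs).imp fun _ h => Or.inr (Or.inr (Or.inl h))⟩
    · exact Or.inr ⟨_, fun ιs => ⟨_, Or.inr (Or.inl ⟨⟨ho, hB⟩, rfl, rfl⟩)⟩⟩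
  · exact Or.inr ⟨_, fun ιs => ⟨_, Or.inl ⟨⟨ho, hA⟩, rfl, rfl⟩⟩⟩

end Saturation

end CombInterp

namespace CombInterp

open FirstOrder.Language (Term)

/-! ### Purification -/

section Purification

section Abstraction

variable {L : FirstOrder.Language.{0, 0}}

/-- The number of occurrences of function symbols in a term. -/
def termSize : L.Term ℕ → ℕ
  | .var _ => 0
  | .func _ ts => 1 + ∑ i, termSize (ts i)

/-- The number of occurrences of function symbols in a formula. -/
def QF.funcSize : QF L → ℕ
  | falsum => 0
  | equal t u => termSize t + termSize u
  | rel _ ts => ∑ i, termSize (ts i)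
  | imp φ ψ => φ.funcSize + ψ.funcSize

/-- A function symbol applied to constants. -/
def IsFlat (s : L.Term ℕ) : Prop :=
  ∃ (n : ℕ) (f : L.Functions n) (xs : Fin n → ℕ), s = Term.func f fun i => Term.var (xs i)

theorem termSize_eq_zero {t : L.Term ℕ} (h : termSize t = 0) : ∃ x, t = Term.var x := by
  cases t with
  | var x => exact ⟨x, rfl⟩
  | func f ts => simp [termSize] at h

/-- Since `d` is fresh for all the arguments, substituting back affects only the argument that was
changed. -/
theorem update_subst {n : ℕ} {d : ℕ} {s : L.Term ℕ} {ts : Fin n → L.Term ℕ} {i : Fin n}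
    {t' : L.Term ℕ} (hd : ∀ j, d ∉ (ts j).varFinset)
    (ht : (t'.subst fun x => if x = d then s else Term.var x) = ts i) :
    (fun j => (Function.update ts i t' j).subst fun x => if x = d then s else Term.var x) = ts := by
  funext j
  by_cases h : j = i
  · subst h; simp [ht]
  · rw [Function.update_of_ne h, term_subst_of_notMem (hd j)]

theorem sum_update_lt {n : ℕ} {ts : Fin n → L.Term ℕ} {i : Fin n} {t' : L.Term ℕ}
    (h : termSize t' < termSize (ts i)) :
    ∑ j, termSize (Function.update ts i t' j) < ∑ j, termSize (ts j) := by
  refine Finset.sum_lt_sum (fun j _ => ?_) ⟨i, Finset.mem_univ i, by simpa using h⟩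
  by_cases hj : j = i
  · subst hj; simpa using h.le
  · rw [Function.update_of_ne hj]

/-- An innermost function symbol, all of whose arguments are constants, heads a flat subterm; naming
it by `d` lowers the number of function symbols. The subterm is chosen before `d`, so that `d` can
afterwards be taken fresh for the whole pair. -/
theorem exists_abstraction_term (t : L.Term ℕ) (h : 0 < termSize t) :
    ∃ s, IsFlat s ∧ s.varFinset ⊆ t.varFinset ∧ ∀ d ∉ t.varFinset, ∃ t' : L.Term ℕ,
      (t'.subst fun x => if x = d then s else Term.var x) = t ∧ termSize t' < termSize t := by
  induction t with
  | var x => simp [termSize] at h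
  | func f ts ih =>
    -- If all arguments are constants, the whole term is flat and becomes `d`; otherwise the search
    -- descends into an argument that is not a constant.
    by_cases hz : ∀ i, termSize (ts i) = 0
    · choose xs hxs using fun i => termSize_eq_zero (hz i)
      refine ⟨Term.func f ts, ⟨_, f, xs, congrArg (Term.func f) (funext hxs)⟩, subset_rfl,
        fun d _ => ⟨Term.var d, by simp [Term.subst], by simp [termSize]⟩⟩
    · push Not at hz
      obtain ⟨i, hi⟩ := hz
      obtain ⟨s, hs, hsub, hd⟩ := ih i (Nat.pos_of_ne_zero hi)
      refine ⟨s, hs, fun x hx => mem_varFinset_func.2 ⟨i, hsub hx⟩, fun d hdt => ?_⟩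
      have hdn : ∀ j, d ∉ (ts j).varFinset := fun j hj => hdt (mem_varFinset_func.2 ⟨j, hj⟩)
      obtain ⟨t', ht', hlt⟩ := hd d (hdn i)
      refine ⟨Term.func f (Function.update ts i t'), ?_, ?_⟩
      · simp only [Term.subst, update_subst hdn ht']
      · simpa only [termSize, add_lt_add_iff_left] using sum_update_lt hlt

theorem QF.exists_abstraction (φ : QF L) (h : 0 < φ.funcSize) :
    ∃ s, IsFlat s ∧ s.varFinset ⊆ φ.consts ∧ ∀ d ∉ φ.consts, ∃ φ' : QF L,
      φ'.subst d s = φ ∧ φ'.funcSize < φ.funcSize := by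
  induction φ with
  | falsum => simp [funcSize] at h
  | equal t u =>
    by_cases ht : 0 < termSize t
    · obtain ⟨s, hs, hsub, hd⟩ := exists_abstraction_term t ht
      refine ⟨s, hs, hsub.trans Finset.subset_union_left, fun d hdt => ?_⟩
      simp only [consts_equal, Finset.mem_union, not_or] at hdt
      obtain ⟨t', ht', hlt⟩ := hd d hdt.1
      refine ⟨equal t' u, ?_, by simp only [funcSize]; omega⟩
      simp only [subst, ht', term_subst_of_notMem hdt.2]
    · obtain ⟨s, hs, hsub, hd⟩ := exists_abstraction_term u (by simp only [funcSize] at h; omega)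
      refine ⟨s, hs, hsub.trans Finset.subset_union_right, fun d hdt => ?_⟩
      simp only [consts_equal, Finset.mem_union, not_or] at hdt
      obtain ⟨t', ht', hlt⟩ := hd d hdt.2
      refine ⟨equal t t', ?_, by simp only [funcSize]; omega⟩
      simp only [subst, ht', term_subst_of_notMem hdt.1]
  | rel R ts =>
    obtain ⟨i, -, hi⟩ := Finset.exists_ne_zero_of_sum_ne_zero (Nat.ne_of_gt h)
    obtain ⟨s, hs, hsub, hd⟩ := exists_abstraction_term (ts i) (Nat.pos_of_ne_zero hi)
    refine ⟨s, hs, fun x hx => mem_consts_rel.2 ⟨i, hsub hx⟩, fun d hdt => ?_⟩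
    have hdn : ∀ j, d ∉ (ts j).varFinset := fun j hj => hdt (mem_consts_rel.2 ⟨j, hj⟩)
    obtain ⟨t', ht', hlt⟩ := hd d (hdn i)
    refine ⟨rel R (Function.update ts i t'), ?_, sum_update_lt hlt⟩
    simp only [subst, update_subst hdn ht']
  | imp φ ψ ih₁ ih₂ =>
    by_cases ht : 0 < φ.funcSize
    · obtain ⟨s, hs, hsub, hd⟩ := ih₁ ht
      refine ⟨s, hs, hsub.trans Finset.subset_union_left, fun d hdt => ?_⟩
      simp only [consts_imp, Finset.mem_union, not_or] at hdt
      obtain ⟨t', ht', hlt⟩ := hd d hdt.1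
      refine ⟨imp t' ψ, ?_, by simp only [funcSize]; omega⟩
      simp only [subst, ht', subst_of_notMem hdt.2]
    · obtain ⟨s, hs, hsub, hd⟩ := ih₂ (by simp only [funcSize] at h; omega)
      refine ⟨s, hs, hsub.trans Finset.subset_union_right, fun d hdt => ?_⟩
      simp only [consts_imp, Finset.mem_union, not_or] at hdt
      obtain ⟨t', ht', hlt⟩ := hd d hdt.2
      refine ⟨imp φ t', ?_, by simp only [funcSize]; omega⟩
      simp only [subst, ht', subst_of_notMem hdt.1]

theorem map_subst_of_notMem {A : List (QF L)} {d : ℕ} {s : L.Term ℕ} (hd : d ∉ constsOf A) :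
    A.map (QF.subst d s) = A :=
  (List.map_congr_left (g := id) fun _ hφ =>
    QF.subst_of_notMem fun h => hd (constsOf_subset hφ h)).trans (List.map_id A)

theorem exists_abstraction (A : List (QF L)) (h : 0 < (A.map QF.funcSize).sum) :
    ∃ s, IsFlat s ∧ s.varFinset ⊆ constsOf A ∧ ∀ d ∉ constsOf A, ∃ A' : List (QF L),
      A'.map (QF.subst d s) = A ∧ (A'.map QF.funcSize).sum < (A.map QF.funcSize).sum := by
  induction A with
  | nil => simp at h
  | cons φ A ih =>
    simp only [List.map_cons, List.sum_cons] at h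
    by_cases ht : 0 < φ.funcSize
    · obtain ⟨s, hs, hsub, hd⟩ := φ.exists_abstraction ht
      refine ⟨s, hs, hsub.trans Finset.subset_union_left, fun d hdt => ?_⟩
      simp only [constsOf_cons, Finset.mem_union, not_or] at hdt
      obtain ⟨φ', ht', hlt⟩ := hd d hdt.1
      refine ⟨φ' :: A, ?_, by simpa using hlt⟩
      rw [List.map_cons, ht', map_subst_of_notMem hdt.2]
    · obtain ⟨s, hs, hsub, hd⟩ := ih (by omega)
      refine ⟨s, hs, hsub.trans Finset.subset_union_right, fun d hdt => ?_⟩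
      simp only [constsOf_cons, Finset.mem_union, not_or] at hdt
      obtain ⟨A', ht', hlt⟩ := hd d hdt.2
      refine ⟨φ :: A', ?_, by simpa using hlt⟩
      rw [List.map_cons, ht', QF.subst_of_notMem hdt.1]

end Abstraction

variable {L₁ L₂ : FirstOrder.Language.{0, 0}}

theorem isPure_of_funcSize_eq_zero {φ : QF (L₁.sum L₂)} (h : φ.funcSize = 0) : IsPure φ := by
  induction φ with
  | falsum => exact fun p hp => hp.elim
  | equal t u =>
    simp only [QF.funcSize, Nat.add_eq_zero_iff] at h
    obtain ⟨x, rfl⟩ := termSize_eq_zero h.1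
    obtain ⟨y, rfl⟩ := termSize_eq_zero h.2
    intro p hp
    rw [Set.mem_singleton_iff.1 hp]
    exact Or.inl ⟨QF.equal (Term.var x) (Term.var y), rfl⟩
  | rel R ts =>
    simp only [QF.funcSize, Finset.sum_eq_zero_iff, Finset.mem_univ, true_implies] at h
    choose xs hxs using fun i => termSize_eq_zero (h i)
    obtain rfl : ts = fun i => Term.var (xs i) := funext hxs
    intro p hp
    rw [Set.mem_singleton_iff.1 hp]
    cases R with
    | inl R => exact Or.inl ⟨QF.rel R fun i => Term.var (xs i), rfl⟩
    | inr R => exact Or.inr ⟨QF.rel R fun i => Term.var (xs i), rfl⟩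
  | imp φ ψ ih₁ ih₂ =>
    simp only [QF.funcSize, Nat.add_eq_zero_iff] at h
    intro p hp
    exact hp.elim (ih₁ h.1 p) (ih₂ h.2 p)

theorem isPure_equal_flat {d : ℕ} {s : (L₁.sum L₂).Term ℕ} (hs : IsFlat s) :
    IsPure (QF.equal (Term.var d) s) := by
  obtain ⟨n, f, xs, rfl⟩ := hs
  intro p hp
  rw [Set.mem_singleton_iff.1 hp]
  cases f with
  | inl f => exact Or.inl ⟨QF.equal (Term.var d) (Term.func f fun i => Term.var (xs i)), rfl⟩
  | inr f => exact Or.inr ⟨QF.equal (Term.var d) (Term.func f fun i => Term.var (xs i)), rfl⟩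

theorem Pair.exists_fresh {L : FirstOrder.Language.{0, 0}} (P : Pair L) : ∃ d, P.Fresh d :=
  Infinite.exists_notMem_finset _

theorem isPure_append_of_sum_eq_zero {D M : List (QF (L₁.sum L₂))} (hD : ∀ φ ∈ D, IsPure φ)
    (h : (M.map QF.funcSize).sum = 0) : ∀ φ ∈ D ++ M, IsPure φ := by
  intro φ hφ
  refine (List.mem_append.1 hφ).elim (hD φ) fun hφ => isPure_of_funcSize_eq_zero ?_
  exact List.sum_eq_zero_iff.1 h _ (List.mem_map_of_mem hφ)

/-- `D` collects the flat definitions already introduced and `M` the formulae still to be treated.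
Each step adds a definition that itself contains a function symbol, so only the size of `M` can
serve as the measure. -/
theorem exists_purification_left (n : ℕ) (D M B : List (QF (L₁.sum L₂)))
    (hn : (M.map QF.funcSize).sum = n) (hD : ∀ φ ∈ D, IsPure φ) :
    ∃ A, Relation.ReflTransGen PurifyStep ⟨D ++ M, B⟩ ⟨A, B⟩ ∧ ∀ φ ∈ A, IsPure φ := by
  induction n using Nat.strong_induction_on generalizing D M with
  | _ n ih =>
    rcases Nat.eq_zero_or_pos n with rfl | h0
    · exact ⟨_, .refl, isPure_append_of_sum_eq_zero hD hn⟩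
    · obtain ⟨s, hs, hsub, hd⟩ := exists_abstraction M (hn ▸ h0)
      obtain ⟨d, hf⟩ := Pair.exists_fresh (⟨D ++ M, B⟩ : Pair (L₁.sum L₂))
      have hf' := hf
      simp only [Pair.Fresh, constsOf_append, Finset.mem_union, not_or] at hf'
      obtain ⟨M', hM', hlt⟩ := hd d hf'.1.2
      obtain ⟨A, hA, hp⟩ := ih _ (hn ▸ hlt) (QF.equal (Term.var d) s :: D) M' rfl (by
        intro φ hφ
        rcases List.mem_cons.1 hφ with rfl | hφ
        · exact isPure_equal_flat hs
        · exact hD φ hφ)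
      refine ⟨A, Relation.ReflTransGen.head (PurifyStep.left _ d s (D ++ M') hf ?_ ?_) hA, hp⟩
      · rw [constsOf_append]; exact hsub.trans Finset.subset_union_right
      · rw [List.map_append, hM', map_subst_of_notMem hf'.1.1]

theorem exists_purification_right (n : ℕ) (D M A : List (QF (L₁.sum L₂)))
    (hn : (M.map QF.funcSize).sum = n) (hD : ∀ φ ∈ D, IsPure φ) :
    ∃ B, Relation.ReflTransGen PurifyStep ⟨A, D ++ M⟩ ⟨A, B⟩ ∧ ∀ φ ∈ B, IsPure φ := by
  induction n using Nat.strong_induction_on generalizing D M with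
  | _ n ih =>
    rcases Nat.eq_zero_or_pos n with rfl | h0
    · exact ⟨_, .refl, isPure_append_of_sum_eq_zero hD hn⟩
    · obtain ⟨s, hs, hsub, hd⟩ := exists_abstraction M (hn ▸ h0)
      obtain ⟨d, hf⟩ := Pair.exists_fresh (⟨A, D ++ M⟩ : Pair (L₁.sum L₂))
      have hf' := hf
      simp only [Pair.Fresh, constsOf_append, Finset.mem_union, not_or] at hf'
      obtain ⟨M', hM', hlt⟩ := hd d hf'.2.2
      obtain ⟨B, hB, hp⟩ := ih _ (hn ▸ hlt) (QF.equal (Term.var d) s :: D) M' rfl (by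
        intro φ hφ
        rcases List.mem_cons.1 hφ with rfl | hφ
        · exact isPure_equal_flat hs
        · exact hD φ hφ)
      refine ⟨B, Relation.ReflTransGen.head (PurifyStep.right _ d s (D ++ M') hf ?_ ?_) hB, hp⟩
      · rw [constsOf_append]; exact hsub.trans Finset.subset_union_right
      · rw [List.map_append, hM', map_subst_of_notMem hf'.2.1]

theorem exists_purification (P : Pair (L₁.sum L₂)) : ∃ Q, Purifies P Q := by
  obtain ⟨A, hA, hpA⟩ := exists_purification_left _ [] P.A P.B rfl (by simp)
  obtain ⟨B, hB, hpB⟩ := exists_purification_right _ [] P.B A rfl (by simp)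
  exact ⟨⟨A, B⟩, hA.trans hB, hpA, hpB⟩

end Purification

/-! ### Completeness -/

section Completeness

theorem lift_subst {L L' : FirstOrder.Language.{0, 0}} (g : L →ᴸ L') (a c : ℕ) (φ : QF L) :
    (φ.subst a (Term.var c)).lift g = (φ.lift g).subst a (Term.var c) := by
  have key : ∀ t : L.Term ℕ, g.onTerm (t.subst fun x => if x = a then Term.var c else Term.var x) =
      (g.onTerm t).subst fun x => if x = a then Term.var c else Term.var x := by
    intro t
    induction t with
    | var x =>
      simp only [Term.subst, FirstOrder.Language.LHom.onTerm]
      split_ifs <;> rfl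
    | func f ts ih => simp only [Term.subst, FirstOrder.Language.LHom.onTerm, ih]
  induction φ with
  | falsum => rfl
  | equal t u => simp only [QF.subst, QF.lift, key]
  | rel R ts => simp only [QF.subst, QF.lift, key]
  | imp φ ψ ih₁ ih₂ => simp only [QF.subst, QF.lift, ih₁, ih₂]

theorem QF.atoms_subst {L : FirstOrder.Language.{0, 0}} {a : ℕ} {t : L.Term ℕ} {φ p : QF L}
    (h : p ∈ (φ.subst a t).atoms) : ∃ q ∈ φ.atoms, p = q.subst a t := by
  induction φ with
  | falsum => exact h.elim
  | equal u w => exact ⟨_, rfl, h⟩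
  | rel R ts => exact ⟨_, rfl, h⟩
  | imp φ ψ ih₁ ih₂ =>
    rcases h with h | h
    · obtain ⟨q, hq, e⟩ := ih₁ h; exact ⟨q, Or.inl hq, e⟩
    · obtain ⟨q, hq, e⟩ := ih₂ h; exact ⟨q, Or.inr hq, e⟩

theorem QF.atoms_lift {L L' : FirstOrder.Language.{0, 0}} {g : L →ᴸ L'} {φ : QF L} {p : QF L'}
    (h : p ∈ (φ.lift g).atoms) : ∃ q : QF L, q.lift g = p := by
  induction φ with
  | falsum => exact h.elim
  | equal u w => exact ⟨equal u w, h.symm⟩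
  | rel R ts => exact ⟨rel R ts, h.symm⟩
  | imp φ ψ ih₁ ih₂ => exact h.elim ih₁ ih₂

variable {L₁ L₂ : FirstOrder.Language.{0, 0}} {T₁ : L₁.Theory} {T₂ : L₂.Theory}

theorem isPure_falsum : IsPure (QF.falsum : QF (L₁.sum L₂)) := fun _ hp => hp.elim

theorem isPure_lift_inl (φ : QF L₁) :
    IsPure (φ.lift (FirstOrder.Language.LHom.sumInl : L₁ →ᴸ L₁.sum L₂)) :=
  fun _ hp => Or.inl (QF.atoms_lift hp)

theorem isPure_lift_inr (φ : QF L₂) :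
    IsPure (φ.lift (FirstOrder.Language.LHom.sumInr : L₂ →ᴸ L₁.sum L₂)) :=
  fun _ hp => Or.inr (QF.atoms_lift hp)

theorem IsPure.subst {φ : QF (L₁.sum L₂)} (h : IsPure φ) (a c : ℕ) :
    IsPure (φ.subst a (Term.var c)) := by
  intro p hp
  obtain ⟨q, hq, rfl⟩ := QF.atoms_subst hp
  rcases h q hq with ⟨r, rfl⟩ | ⟨r, rfl⟩
  · exact Or.inl ⟨r.subst a (Term.var c), lift_subst _ _ _ _⟩
  · exact Or.inr ⟨r.subst a (Term.var c), lift_subst _ _ _ _⟩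

theorem IsAssignment.isPure {A α : List (QF (L₁.sum L₂))} (h : IsAssignment A α)
    (hA : ∀ φ ∈ A, IsPure φ) : ∀ φ ∈ α, IsPure φ := by
  intro φ hφ p hp
  obtain ⟨q, hq, hφ⟩ := h.1 φ hφ
  have : p ∈ q.atoms := by
    rcases hφ with rfl | rfl
    · exact hp
    · exact hp.elim id False.elim
  rw [hq.isAtom.atoms_eq, Set.mem_singleton_iff] at this
  subst this
  rcases hq with ⟨ψ, hψ, hp⟩ | ⟨c, -, d, -, rfl⟩
  · exact hA ψ hψ p hp
  · exact Or.inl ⟨QF.equal (Term.var c) (Term.var d), rfl⟩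

/-- The pairs of finite sets of pure formulae that are unsatisfiable together. -/
structure Pair.PureUnsat (T : (L₁.sum L₂).Theory) (P : Pair (L₁.sum L₂)) : Prop where
  pureA : ∀ φ ∈ P.A, IsPure φ
  pureB : ∀ φ ∈ P.B, IsPure φ
  unsat : ¬ Sat T ({φ | φ ∈ P.A} ∪ {φ | φ ∈ P.B})

variable {T : (L₁.sum L₂).Theory}

theorem Pair.PureUnsat.swap {P : Pair (L₁.sum L₂)} (h : P.PureUnsat T) : P.swap.PureUnsat T :=
  ⟨h.pureB, h.pureA, by simpa only [Pair.swap, Set.union_comm] using h.unsat⟩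

theorem Pair.PureUnsat.append {P : Pair (L₁.sum L₂)} (h : P.PureUnsat T)
    {α β : List (QF (L₁.sum L₂))} (hα : ∀ φ ∈ α, IsPure φ) (hβ : ∀ φ ∈ β, IsPure φ) :
    Pair.PureUnsat T ⟨α ++ P.A, β ++ P.B⟩ where
  pureA φ hφ := (List.mem_append.1 hφ).elim (hα φ) (h.pureA φ)
  pureB φ hφ := (List.mem_append.1 hφ).elim (hβ φ) (h.pureB φ)
  unsat := fun ⟨M, _, hM, hT, v, hv⟩ => h.unsat ⟨M, _, hM, hT, v, by
    rintro φ (hφ | hφ)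
    · exact hv φ (Or.inl (List.mem_append_right _ hφ))
    · exact hv φ (Or.inr (List.mem_append_right _ hφ))⟩

/-- From a model of the outcome, a model of the original pair arises by giving `a` the value of `c`;
the second component does not notice, as `a` does not occur in it. Purity survives because a
constant is replaced by a constant. -/
theorem Pair.PureUnsat.shareTerm {P : Pair (L₁.sum L₂)} (h : P.PureUnsat T) {a c : ℕ}
    {t : (L₁.sum L₂).Term ℕ} (ha : a ∉ constsOf P.B) (ht : IsPure (QF.equal (Term.var c) t)) :
    (P.shareTerm a t c).PureUnsat T where
  pureA φ hφ := by
    rcases List.mem_cons.1 hφ with rfl | hφ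
    · exact ht
    · obtain ⟨ψ, hψ, rfl⟩ := List.mem_map.1 hφ
      exact (h.pureA ψ hψ).subst a c
  pureB φ hφ := by
    rcases List.mem_cons.1 hφ with rfl | hφ
    · exact ht
    · exact h.pureB φ hφ
  unsat := by
    rintro ⟨M, _, hM, hT, v, hv⟩
    refine h.unsat ⟨M, _, hM, hT, Function.update v a (v c), ?_⟩
    rintro φ (hφ | hφ)
    · have := hv _ (Or.inl (List.mem_cons_of_mem _ (List.mem_map_of_mem hφ)))
      rwa [QF.realize_subst] at this
    · refine (QF.realize_congr fun x hx => ?_).1 (hv φ (Or.inr (List.mem_cons_of_mem _ hφ)))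
      rw [Function.update_of_ne]
      rintro rfl
      exact ha (constsOf_subset hφ hx)

theorem TheoryRule.pureUnsat {L : FirstOrder.Language.{0, 0}} {g : L →ᴸ L₁.sum L₂}
    {T' : L.Theory} (hg : ∀ φ : QF L, IsPure (φ.lift g)) {P Q : Pair (L₁.sum L₂)}
    {outcomes instr} (h : TheoryRule g T' P outcomes instr) (hQ : Q ∈ outcomes)
    (hP : P.PureUnsat T) : Q.PureUnsat T := by
  cases h with
  | share as bs vs θ c h =>
    simp only [shareOutcomes, List.mem_append, List.mem_map, Prod.exists,
      List.pair_mem_product] at hQ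
    rcases hQ with ⟨a, t, ⟨ha, ht⟩, rfl⟩ | ⟨b, t, ⟨hb, ht⟩, rfl⟩
    · exact hP.shareTerm (Finset.mem_sdiff.1 ((h.mem_as a).1 ha)).2
        (hg (QF.equal (Term.var c) t))
    · have hR := (hP.append (α := [θ.lift g]) (β := [θ.lift g]) (by simpa using hg θ)
        (by simpa using hg θ)).swap
      refine (hR.shareTerm ?_ (hg (QF.equal (Term.var c) t))).swap
      have := (Finset.mem_sdiff.1 ((h.mem_bs b).1 hb)).2
      simp only [Pair.swap, List.singleton_append, constsOf_cons, QF.consts_lift,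
        Finset.mem_union, not_or] at this ⊢
      exact ⟨fun hθ => this (Finset.mem_inter.1 (h.θ_common hθ)).1, this⟩
  | terminate θ ho hu hc he hr =>
    rw [List.mem_singleton] at hQ
    subst hQ
    exact hP.append (α := [θ.lift g]) (β := [QF.falsum, θ.lift g]) (by simpa using hg θ)
      (by simpa using ⟨isPure_falsum, hg θ⟩)

theorem Next.pureUnsat {P Q : Pair (L₁.sum L₂)} (h : Next T₁ T₂ Q P) (hP : P.PureUnsat T) :
    Q.PureUnsat T := by
  have hf : ∀ φ ∈ ([QF.falsum] : List (QF (L₁.sum L₂))), IsPure φ := by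
    intro φ hφ
    rw [List.mem_singleton.1 hφ]
    exact isPure_falsum
  have hn : ∀ φ ∈ ([] : List (QF (L₁.sum L₂))), IsPure φ := by simp
  obtain ⟨outcomes, instr, h, hQ⟩ := h
  cases h with
  | decideA αs ho _ _ hl =>
    obtain ⟨α, hα, rfl⟩ := List.mem_map.1 hQ
    exact hP.append ((hl.1 α hα).isPure hP.pureA) hn
  | decideAFail ho _ =>
    rw [List.mem_singleton.1 hQ]
    exact hP.append hf hn
  | decideB αs ho _ _ hl =>
    obtain ⟨α, hα, rfl⟩ := List.mem_map.1 hQ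
    exact hP.append hn ((hl.1 α hα).isPure hP.pureB)
  | decideBFail ho _ =>
    rw [List.mem_singleton.1 hQ]
    exact hP.append hn hf
  | theory₁ outcomes instr h => exact h.pureUnsat isPure_lift_inl hQ hP
  | theory₂ outcomes instr h => exact h.pureUnsat isPure_lift_inr hQ hP

theorem Purifies.pureUnsat {P Q : Pair (L₁.sum L₂)} (h : Purifies P Q)
    (hP : ¬ Sat T ({φ | φ ∈ P.A} ∪ {φ | φ ∈ P.B})) : Q.PureUnsat T := by
  obtain ⟨h, hA, hB⟩ := h
  refine ⟨hA, hB, ?_⟩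
  clear hA hB
  induction h with
  | refl => exact hP
  | tail _ hs ih => exact hs.not_sat ih

theorem Pair.not_isOpen {L : FirstOrder.Language.{0, 0}} {P : Pair L} (h : ¬ P.IsOpen) :
    QF.falsum ∈ P.A ∨ QF.falsum ∈ P.B := by
  simpa only [Pair.IsOpen, not_and_or, not_not] using h

variable [Countable (Σ n, L₁.Functions n)] [Countable (Σ n, L₁.Relations n)]
  [Countable (Σ n, L₂.Functions n)] [Countable (Σ n, L₂.Relations n)]

/-- Induction along the terminating relation, with purity and unsatisfiability as the invariant: the
invariant excludes saturation, so some rule applies to every open pair. -/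
theorem Pair.PureUnsat.exists_run (hsi₁ : StablyInfinite T₁) (hsi₂ : StablyInfinite T₂)
    (hei₁ : EqualityInterpolating T₁) (hei₂ : EqualityInterpolating T₂) {P : Pair (L₁.sum L₂)}
    (h : P.PureUnsat (unionTheory T₁ T₂)) : ∃ θ, Run T₁ T₂ P (some θ) := by
  induction P using (next_wellFounded (T₁ := T₁) (T₂ := T₂)).induction with
  | _ P ih =>
    by_cases ho : P.IsOpen
    · rcases saturated_or_exists_step hei₁ hei₂ ho with hs | ⟨outcomes, hs⟩
      · exact absurd (hs.sat hsi₁ hsi₂ h.pureA h.pureB) h.unsat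
      · have hnext : ∀ Q : {Q // Q ∈ outcomes}, Next T₁ T₂ Q.1 P := fun Q => by
          -- Whether the rule applies does not depend on the interpolants, so any list will do; the
          -- empty one is taken.
          obtain ⟨ι, hι⟩ := hs []
          obtain ⟨instr, hr, -⟩ := hι.rule
          exact ⟨outcomes, instr, hr, Q.2⟩
        choose f hf using fun Q : {Q // Q ∈ outcomes} =>
          ih Q.1 (hnext Q) ((hnext Q).pureUnsat h)
        obtain ⟨ι, hι⟩ := hs (outcomes.attach.map f)
        obtain ⟨instr, hr, rfl⟩ := hι.rule
        refine ⟨_, Run.node P outcomes instr (outcomes.attach.map f) hr (by simp) fun q hq => ?_⟩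
        obtain ⟨j, hj, rfl⟩ := List.mem_iff_getElem.1 hq
        simpa using hf ⟨outcomes[j]'(by simp at hj; omega), List.getElem_mem _⟩
    · rcases Pair.not_isOpen ho with h | h
      · exact ⟨_, Run.closeA P h⟩
      · exact ⟨_, Run.closeB P h⟩

/-- The run is arbitrary, not restricted to the selected instances: any rule application preserves
the invariant, and a pair to which no rule applies would be saturated, hence satisfiable. -/
theorem Pair.PureUnsat.not_run_none (hsi₁ : StablyInfinite T₁) (hsi₂ : StablyInfinite T₂)
    (hei₁ : EqualityInterpolating T₁) (hei₂ : EqualityInterpolating T₂) {P : Pair (L₁.sum L₂)}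
    (h : P.PureUnsat (unionTheory T₁ T₂)) : ¬ Run T₁ T₂ P none := by
  intro hr
  generalize e : (none : Option (QF (L₁.sum L₂))) = r at hr
  induction hr with
  | closeA P _ => cases e
  | closeB P _ => cases e
  | saturated P ho hn =>
    rcases saturated_or_exists_step hei₁ hei₂ ho with hs | ⟨outcomes, hs⟩
    · exact h.unsat (hs.sat hsi₁ hsi₂ h.pureA h.pureB)
    · obtain ⟨ι, hι⟩ := hs []
      obtain ⟨instr, hr, -⟩ := hι.rule
      exact hn _ _ hr
  | node => cases e
  | fail P Q hQ _ ih => exact ih (hQ.pureUnsat h) rfl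

end Completeness

end CombInterp

namespace CombInterp

/-! ### Closure properties of computable functions and predicates -/

section ComputableLists

variable {α β γ σ : Type} [Primcodable α] [Primcodable β] [Primcodable γ] [Primcodable σ]

/-- A left fold is a recursion on the length that reads the list by position; in this form closure
under recursion on natural numbers gives computability with a merely computable step. -/
theorem rec_getElem?_eq_foldl {β σ : Type} (l : List β) (h : σ → β → σ) (s : σ) (n : ℕ) :
    Nat.rec (motive := fun _ => σ) s (fun k s => Option.casesOn (l[k]?) s fun b => h s b) n =
      (l.take n).foldl h s := by
  induction n with
  | zero => simp
  | succ n ih =>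
    simp only [ih, List.take_add_one, List.foldl_append]
    cases l[n]? <;> rfl

theorem computable_foldl {f : α → List β} {g : α → σ} {h : α → σ × β → σ} (hf : Computable f)
    (hg : Computable g) (hh : Computable₂ h) :
    Computable fun a => (f a).foldl (fun s b => h a (s, b)) (g a) := by
  have hstep : Computable₂ fun (a : α) (p : ℕ × σ) =>
      (Option.casesOn ((f a)[p.1]?) p.2 fun b => h a (p.2, b) : σ) := by
    refine Computable.option_casesOn (o := fun x : α × (ℕ × σ) => (f x.1)[x.2.1]?)
      (f := fun x => x.2.2) (g := fun x b => h x.1 (x.2.2, b)) ?_ ?_ ?_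
    · exact Computable.list_getElem?.comp (hf.comp .fst) (Computable.fst.comp .snd)
    · exact Computable.snd.comp .snd
    · exact hh.comp (Computable.fst.comp .fst)
        (((Computable.snd.comp .snd).comp .fst).pair .snd)
  refine (Computable.nat_rec (Computable.list_length.comp hf) hg hstep).of_eq fun a => ?_
  rw [rec_getElem?_eq_foldl (f a) (fun s b => h a (s, b)) (g a), List.take_length]

theorem computable_foldr {f : α → List β} {g : α → σ} {h : α → β × σ → σ} (hf : Computable f)
    (hg : Computable g) (hh : Computable₂ h) :
    Computable fun a => (f a).foldr (fun b s => h a (b, s)) (g a) := by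
  refine (computable_foldl (h := fun a p => h a (p.2, p.1)) (Computable.list_reverse.comp hf) hg
    ?_).of_eq fun a => ?_
  · exact hh.comp .fst ((Computable.snd.comp .snd).pair (Computable.fst.comp .snd))
  · rw [List.foldl_reverse]

theorem computable_list_rec {f : α → List β} {g : α → σ} {h : α → β × List β × σ → σ}
    (hf : Computable f) (hg : Computable g) (hh : Computable₂ h) :
    Computable fun a => (List.rec (g a) (fun b l s => h a (b, l, s)) (f a) : σ) := by
  -- The fold carries the part of the list already consumed along with the value, since the recursor
  -- has access to the tail.
  have : Computable fun a => (f a).foldr (fun b (s : List β × σ) => (b :: s.1, h a (b, s)))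
      (([] : List β), g a) := by
    refine computable_foldr (h := fun a p => (p.1 :: p.2.1, h a p)) hf ((Computable.const _).pair hg)
      ?_
    exact (Computable.list_cons.comp (Computable.fst.comp .snd)
      ((Computable.fst.comp .snd).comp .snd)).pair hh
  refine (Computable.snd.comp this).of_eq fun a => ?_
  have key : ∀ l : List β, l.foldr (fun b (s : List β × σ) => (b :: s.1, h a (b, s)))
      (([] : List β), g a) = (l, List.rec (g a) (fun b l s => h a (b, l, s)) l) := by
    intro l
    induction l with
    | nil => rfl
    | cons b l ih => rw [List.foldr_cons, ih]
  rw [key]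

theorem computable_map {f : α → List β} {g : α → β → σ} (hf : Computable f)
    (hg : Computable₂ g) : Computable fun a => (f a).map (g a) := by
  refine (computable_foldr (h := fun a p => g a p.1 :: p.2) hf (Computable.const []) ?_).of_eq
    fun a => ?_
  · exact Computable.list_cons.comp (hg.comp .fst (Computable.fst.comp .snd))
      (Computable.snd.comp .snd)
  · induction f a with
    | nil => rfl
    | cons b l ih => rw [List.foldr_cons, ih, List.map_cons]

theorem computable_flatMap {f : α → List β} {g : α → β → List σ} (hf : Computable f)
    (hg : Computable₂ g) : Computable fun a => (f a).flatMap (g a) := by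
  refine (computable_foldr (h := fun a p => g a p.1 ++ p.2) hf (Computable.const []) ?_).of_eq
    fun a => ?_
  · exact Computable.list_append.comp (hg.comp .fst (Computable.fst.comp .snd))
      (Computable.snd.comp .snd)
  · induction f a with
    | nil => rfl
    | cons b l ih => rw [List.foldr_cons, ih, List.flatMap_cons]

theorem computable_flatten {f : α → List (List β)} (hf : Computable f) :
    Computable fun a => (f a).flatten :=
  (computable_flatMap hf (g := fun _ l => l) Computable.snd).of_eq fun a => by
    rw [List.flatMap_id']

theorem computable_filterMap {f : α → List β} {g : α → β → Option σ} (hf : Computable f)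
    (hg : Computable₂ g) : Computable fun a => (f a).filterMap (g a) := by
  refine (computable_flatMap (g := fun a b => (g a b).toList) hf
    (Primrec.optionToList.to_comp.comp₂ hg)).of_eq fun a => ?_
  induction f a with
  | nil => rfl
  | cons b l ih =>
    rw [List.flatMap_cons, ih, List.filterMap_cons]
    cases g a b <;> rfl

theorem computable_product {f : α → List β} {g : α → List γ} (hf : Computable f)
    (hg : Computable g) : Computable fun a => (f a).product (g a) :=
  computable_flatMap (g := fun a b => (g a).map (Prod.mk b)) hf
    (computable_map (f := fun x : α × β => g x.1) (g := fun x c => (x.2, c)) (hg.comp .fst)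
      ((Computable.snd.comp .fst).pair .snd))

theorem zip_eq_filterMap {β γ : Type} (l : List β) (l' : List γ) :
    l.zip l' = (List.range l.length).filterMap fun i =>
      (l[i]?).bind fun b => (l'[i]?).map fun c => (b, c) := by
  induction l generalizing l' with
  | nil => simp
  | cons b l ih =>
    rw [List.length_cons, List.range_succ_eq_map, List.filterMap_cons, List.filterMap_map]
    cases l' with
    | nil => simp
    | cons c l' => simp [ih]

theorem computable_zip {f : α → List β} {g : α → List γ} (hf : Computable f)
    (hg : Computable g) : Computable fun a => (f a).zip (g a) := by
  refine (computable_filterMap (f := fun a => List.range (f a).length)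
    (g := fun a i => ((f a)[i]?).bind fun b => ((g a)[i]?).map fun c => (b, c))
    (Primrec.list_range.to_comp.comp (Computable.list_length.comp hf)) ?_).of_eq
    fun a => (zip_eq_filterMap _ _).symm
  refine Computable.option_bind (f := fun x : α × ℕ => (f x.1)[x.2]?)
    (g := fun x b => ((g x.1)[x.2]?).map fun c => (b, c)) ?_ ?_
  · exact Computable.list_getElem?.comp (hf.comp .fst) .snd
  · refine Computable.option_map (f := fun x : (α × ℕ) × β => (g x.1.1)[x.1.2]?)
      (g := fun x c => (x.2, c)) ?_ ?_
    · exact Computable.list_getElem?.comp (hg.comp (Computable.fst.comp .fst))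
        (Computable.snd.comp .fst)
    · exact (Computable.snd.comp .fst).pair .snd

theorem computable_zipWith {f : α → List β} {g : α → List γ} {h : α → β × γ → σ}
    (hf : Computable f) (hg : Computable g) (hh : Computable₂ h) :
    Computable fun a => List.zipWith (fun b c => h a (b, c)) (f a) (g a) :=
  (computable_map (computable_zip hf hg) hh).of_eq fun a => by
    rw [← List.map_uncurry_zip_eq_zipWith]; rfl

theorem computable_drop {f : α → List β} {n : α → ℕ} (hf : Computable f) (hn : Computable n) :
    Computable fun a => (f a).drop (n a) := by
  refine (Computable.nat_rec (h := fun _ (x : ℕ × List β) => x.2.tail) hn hf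
    (Primrec.list_tail.to_comp.comp (Computable.snd.comp .snd))).of_eq fun a => ?_
  induction n a with
  | zero => rfl
  | succ k ih => simp only [ih, List.tail_drop]

end ComputableLists

section ComputablePredicates

variable {α β σ : Type} [Primcodable α] [Primcodable β] [Primcodable σ] {p q : α → Prop}

theorem computablePred_of_bool {f : α → Bool} (hf : Computable f) (h : ∀ a, p a ↔ f a = true) :
    ComputablePred p :=
  ComputablePred.computable_iff.2 ⟨f, hf, funext fun a => propext (h a)⟩

theorem _root_.ComputablePred.comp {r : β → Prop} (hr : ComputablePred r) {f : α → β}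
    (hf : Computable f) : ComputablePred fun a => r (f a) := by
  obtain ⟨b, hb, rfl⟩ := ComputablePred.computable_iff.1 hr
  exact computablePred_of_bool (hb.comp hf) fun _ => Iff.rfl

theorem _root_.ComputablePred.and (hp : ComputablePred p) (hq : ComputablePred q) :
    ComputablePred fun a => p a ∧ q a := by
  obtain ⟨b, hb, rfl⟩ := ComputablePred.computable_iff.1 hp
  obtain ⟨c, hc, rfl⟩ := ComputablePred.computable_iff.1 hq
  exact computablePred_of_bool (Primrec.and.to_comp.comp hb hc) fun _ => by simp

theorem _root_.ComputablePred.or (hp : ComputablePred p) (hq : ComputablePred q) :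
    ComputablePred fun a => p a ∨ q a := by
  obtain ⟨b, hb, rfl⟩ := ComputablePred.computable_iff.1 hp
  obtain ⟨c, hc, rfl⟩ := ComputablePred.computable_iff.1 hq
  exact computablePred_of_bool (Primrec.or.to_comp.comp hb hc) fun _ => by simp

theorem _root_.ComputablePred.imp (hp : ComputablePred p) (hq : ComputablePred q) :
    ComputablePred fun a => p a → q a :=
  (hp.not.or hq).of_eq fun _ => imp_iff_not_or.symm

theorem _root_.ComputablePred.iff (hp : ComputablePred p) (hq : ComputablePred q) :
    ComputablePred fun a => p a ↔ q a :=
  ((hp.imp hq).and (hq.imp hp)).of_eq fun _ => iff_def.symm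

theorem _root_.ComputablePred.eq {f g : α → β} (hf : Computable f) (hg : Computable g) :
    ComputablePred fun a => f a = g a :=
  (PrimrecRel.comp (Primrec.eq (α := β)) Primrec.fst Primrec.snd).computablePred.comp
    (f := fun a => (f a, g a)) (hf.pair hg)

theorem _root_.ComputablePred.ball {f : α → List β} {r : α × β → Prop} (hf : Computable f)
    (hr : ComputablePred r) : ComputablePred fun a => ∀ b ∈ f a, r (a, b) := by
  obtain ⟨c, hc, rfl⟩ := ComputablePred.computable_iff.1 hr
  refine computablePred_of_bool (computable_foldr (h := fun a p => c (a, p.1) && p.2) hf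
    (Computable.const true) (Primrec.and.to_comp.comp
      (hc.comp (Computable.fst.pair (Computable.fst.comp .snd))) (Computable.snd.comp .snd)))
    fun a => ?_
  induction f a with
  | nil => simp
  | cons b l ih => simp [ih]

theorem _root_.ComputablePred.bex {f : α → List β} {r : α × β → Prop} (hf : Computable f)
    (hr : ComputablePred r) : ComputablePred fun a => ∃ b ∈ f a, r (a, b) :=
  (ComputablePred.ball hf hr.not).not.of_eq fun a => by push Not; rfl

theorem _root_.ComputablePred.mem {f : α → β} {g : α → List β} (hf : Computable f)
    (hg : Computable g) : ComputablePred fun a => f a ∈ g a :=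
  (ComputablePred.bex (r := fun x => f x.1 = x.2) hg
    (ComputablePred.eq (hf.comp .fst) .snd)).of_eq fun a => by simp

theorem computable_ite [DecidablePred p] {f g : α → σ} (hp : ComputablePred p)
    (hf : Computable f) (hg : Computable g) : Computable fun a => if p a then f a else g a := by
  obtain ⟨b, hb, rfl⟩ := ComputablePred.computable_iff.1 hp
  exact (Computable.cond hb hf hg).of_eq fun a => by cases h : b a <;> simp [h]

theorem computable_filter {f : α → List β} {r : α × β → Prop} (hf : Computable f)
    (hr : ComputablePred r) [∀ a, DecidablePred fun b => r (a, b)] :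
    Computable fun a => (f a).filter fun b => r (a, b) := by
  classical
  refine (computable_filterMap (g := fun a b => if r (a, b) then some b else none) hf ?_).of_eq
    fun a => ?_
  · exact computable_ite (p := r) hr (Computable.option_some.comp .snd) (Computable.const _)
  · induction f a with
    | nil => rfl
    | cons b l ih =>
      rw [List.filterMap_cons, List.filter_cons]
      by_cases h : r (a, b) <;> simp [h, ih]

theorem computable_dedup [DecidableEq β] {f : α → List β} (hf : Computable f) :
    Computable fun a => (f a).dedup := by
  refine (computable_foldr (h := fun _ p => if p.1 ∈ p.2 then p.2 else p.1 :: p.2) hf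
    (Computable.const []) ?_).of_eq fun a => ?_
  · exact computable_ite (p := fun x : α × (β × List β) => x.2.1 ∈ x.2.2)
      (ComputablePred.mem (Computable.fst.comp .snd) (Computable.snd.comp .snd))
      (Computable.snd.comp .snd)
      (Computable.list_cons.comp (Computable.fst.comp .snd) (Computable.snd.comp .snd))
  · induction f a with
    | nil => rfl
    | cons b l ih =>
      rw [List.foldr_cons, ih]
      by_cases h : b ∈ l
      · simp [h]
      · simp [h]

end ComputablePredicates

/-! ### Semidecidable predicates -/

section Semidecidable

variable {α β σ : Type} [Primcodable α] [Primcodable β] [Primcodable σ] {p q : α → Prop}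

/-- A predicate is semidecidable if it is the projection of a decidable one. -/
def Semidecidable (p : α → Prop) : Prop :=
  ∃ r : α × ℕ → Prop, ComputablePred r ∧ ∀ a, p a ↔ ∃ n, r (a, n)

theorem _root_.ComputablePred.semidecidable (hp : ComputablePred p) : Semidecidable p :=
  ⟨fun x => p x.1, hp.comp .fst, fun _ => by simp⟩

theorem Semidecidable.of_eq (hp : Semidecidable p) (h : ∀ a, p a ↔ q a) : Semidecidable q :=
  (funext fun a => propext (h a) : p = q) ▸ hp

theorem Semidecidable.comp {r : β → Prop} (hr : Semidecidable r) {f : α → β}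
    (hf : Computable f) : Semidecidable fun a => r (f a) := by
  obtain ⟨s, hs, h⟩ := hr
  exact ⟨fun x => s (f x.1, x.2), hs.comp ((hf.comp .fst).pair .snd), fun a => h (f a)⟩

theorem Semidecidable.or (hp : Semidecidable p) (hq : Semidecidable q) :
    Semidecidable fun a => p a ∨ q a := by
  obtain ⟨r, hr, hpr⟩ := hp
  obtain ⟨s, hs, hqs⟩ := hq
  exact ⟨fun x => r x ∨ s x, hr.or hs, fun a => by simp only [hpr, hqs, exists_or]⟩

theorem Semidecidable.and (hp : Semidecidable p) (hq : Semidecidable q) :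
    Semidecidable fun a => p a ∧ q a := by
  obtain ⟨r, hr, hpr⟩ := hp
  obtain ⟨s, hs, hqs⟩ := hq
  refine ⟨fun x => r (x.1, x.2.unpair.1) ∧ s (x.1, x.2.unpair.2), ?_, fun a => ?_⟩
  · exact (hr.comp (Computable.fst.pair (Computable.fst.comp (Computable.unpair.comp .snd)))).and
      (hs.comp (Computable.fst.pair (Computable.snd.comp (Computable.unpair.comp .snd))))
  · simp only [hpr, hqs]
    constructor
    · rintro ⟨⟨m, hm⟩, n, hn⟩; exact ⟨Nat.pair m n, by simpa using ⟨hm, hn⟩⟩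
    · rintro ⟨n, h₁, h₂⟩; exact ⟨⟨_, h₁⟩, _, h₂⟩

theorem _root_.ComputablePred.bex_option {f : α → Option β} {r : α × β → Prop} (hf : Computable f)
    (hr : ComputablePred r) : ComputablePred fun a => ∃ b, f a = some b ∧ r (a, b) :=
  (ComputablePred.bex (f := fun a => (f a).toList) (Primrec.optionToList.to_comp.comp hf)
    hr).of_eq fun a => by simp

/-- The object and the witness for it are coded together by one natural number. -/
theorem Semidecidable.exists {r : α × β → Prop} (hr : Semidecidable r) :
    Semidecidable fun a => ∃ b, r (a, b) := by
  obtain ⟨s, hs, h⟩ := hr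
  refine ⟨fun x => ∃ y : β × ℕ, Encodable.decode x.2 = some y ∧ s ((x.1, y.1), y.2), ?_,
    fun a => ?_⟩
  · refine ComputablePred.bex_option (f := fun x : α × ℕ => Encodable.decode x.2)
      (r := fun x : (α × ℕ) × (β × ℕ) => s ((x.1.1, x.2.1), x.2.2)) ?_ ?_
    · exact Computable.decode.comp .snd
    · exact hs.comp (((Computable.fst.comp .fst).pair (Computable.fst.comp .snd)).pair
        (Computable.snd.comp .snd))
  · constructor
    · rintro ⟨b, hb⟩
      obtain ⟨n, hn⟩ := (h _).1 hb
      exact ⟨Encodable.encode (b, n), (b, n), Encodable.encodek _, hn⟩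
    · rintro ⟨_, y, -, hy⟩
      exact ⟨y.1, (h _).2 ⟨_, hy⟩⟩

/-- A semidecidable relation that is total can be uniformized by a computable function. -/
theorem Semidecidable.exists_computable {r : α × β → Prop} (hr : Semidecidable r)
    (ht : ∀ a, ∃ b, r (a, b)) : ∃ F : α → β, Computable F ∧ ∀ a, r (a, F a) := by
  classical
  obtain ⟨s, hs, h⟩ := hr
  -- The number `m` codes a candidate value together with a witness; the search over `m` stops at
  -- the first pair that passes the decidable test.
  let f : α → ℕ → Option β := fun a m => (Encodable.decode (α := β × ℕ) m).bind fun y =>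
    if s ((a, y.1), y.2) then some y.1 else none
  have hf : Computable₂ f := by
    refine Computable.option_bind (f := fun x : α × ℕ => Encodable.decode (α := β × ℕ) x.2)
      (g := fun x y => if s ((x.1, y.1), y.2) then some y.1 else none) ?_ ?_
    · exact Computable.decode.comp .snd
    · refine computable_ite (p := fun z : (α × ℕ) × (β × ℕ) => s ((z.1.1, z.2.1), z.2.2)) ?_ ?_ ?_
      · exact hs.comp (((Computable.fst.comp .fst).pair (Computable.fst.comp .snd)).pair
          (Computable.snd.comp .snd))
      · exact Computable.option_some.comp (Computable.fst.comp .snd)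
      · exact Computable.const _
  have hmem : ∀ a m b, b ∈ f a m → r (a, b) := by
    intro a m b hb
    simp only [f, Option.mem_def, Option.bind_eq_some_iff] at hb
    obtain ⟨y, -, hy⟩ := hb
    split_ifs at hy with hsy
    obtain rfl := Option.some.inj hy
    exact (h _).2 ⟨_, hsy⟩
  have hdom : ∀ a, (Nat.rfindOpt (f a)).Dom := by
    intro a
    obtain ⟨b, hb⟩ := ht a
    obtain ⟨n, hn⟩ := (h _).1 hb
    exact Nat.rfindOpt_dom.2 ⟨Encodable.encode (b, n), b, by simp [f, hn]⟩
  refine ⟨fun a => (Nat.rfindOpt (f a)).get (hdom a),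
    (Partrec.rfindOpt hf).of_eq_tot fun a => Part.get_mem _, fun a => ?_⟩
  obtain ⟨m, hm⟩ := Nat.rfindOpt_spec (Part.get_mem (hdom a))
  exact hmem a m _ hm

/-- The predicate generated inductively by the rules `J`, where `J (a, l)` means that `a` can be
derived from the members of `l`. -/
inductive Derivable (J : α × List α → Prop) : α → Prop
  | intro (a : α) (l : List α) : (∀ b ∈ l, Derivable J b) → J (a, l) → Derivable J a

/-- The list, read from its end, is a derivation; every member comes with its premises and with a
witness. -/
def IsDerivation {α : Type} (r : (α × List α) × ℕ → Prop) : List ((α × List α) × ℕ) → Prop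
  | [] => True
  | x :: s => (r x ∧ ∀ b ∈ x.1.2, b ∈ s.map fun y => y.1.1) ∧ IsDerivation r s

theorem IsDerivation.append {α : Type} {r : (α × List α) × ℕ → Prop} {s t : List ((α × List α) × ℕ)}
    (hs : IsDerivation r s) (ht : IsDerivation r t) : IsDerivation r (s ++ t) := by
  induction s with
  | nil => exact ht
  | cons x s ih =>
    refine ⟨⟨hs.1.1, fun b hb => ?_⟩, ih hs.2⟩
    exact List.map_append ▸ List.mem_append_left _ (hs.1.2 b hb)

theorem computable_conclusions :
    Computable fun s : List ((α × List α) × ℕ) => s.map fun y => y.1.1 :=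
  computable_map (f := id) (g := fun (_ : List ((α × List α) × ℕ)) (y : (α × List α) × ℕ) => y.1.1)
    Computable.id (Computable.fst.comp (Computable.fst.comp Computable.snd))

theorem computablePred_isDerivation {r : (α × List α) × ℕ → Prop} (hr : ComputablePred r) :
    ComputablePred (IsDerivation r) := by
  classical
  have hmem : ComputablePred fun w : (((α × List α) × ℕ) × List ((α × List α) × ℕ)) × α =>
      w.2 ∈ w.1.2.map fun y => y.1.1 :=
    ComputablePred.mem (f := fun w : (((α × List α) × ℕ) × List ((α × List α) × ℕ)) × α => w.2)
      Computable.snd (computable_conclusions.comp (Computable.snd.comp Computable.fst))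
  have hprem : Computable fun z : ((α × List α) × ℕ) × List ((α × List α) × ℕ) => z.1.1.2 :=
    Computable.snd.comp (Computable.fst.comp Computable.fst)
  have hall : ComputablePred fun z : ((α × List α) × ℕ) × List ((α × List α) × ℕ) =>
      r z.1 ∧ ∀ b ∈ z.1.1.2, b ∈ z.2.map fun y => y.1.1 :=
    (hr.comp Computable.fst).and (ComputablePred.ball hprem hmem)
  obtain ⟨c, hc, hce⟩ := ComputablePred.computable_iff.1 hall
  refine computablePred_of_bool (computable_list_rec
    (h := fun (_ : List ((α × List α) × ℕ)) z => c (z.1, z.2.1) && z.2.2) Computable.id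
    (Computable.const true) (Primrec.and.to_comp.comp
      (hc.comp ((Computable.fst.comp .snd).pair ((Computable.fst.comp .snd).comp .snd)))
      ((Computable.snd.comp .snd).comp .snd))) fun l => ?_
  simp only [id]
  induction l with
  | nil => simp [IsDerivation]
  | cons x s ih =>
    simp only [IsDerivation, Bool.and_eq_true, ih]
    exact and_congr_left' (iff_of_eq (congrFun hce (x, s)))

/-- A derivation tree is flattened into a finite list in which the premises of each entry occur
further on. Whether a list is such a derivation is decidable, because every entry carries a witness
for its inference. -/
theorem Semidecidable.derivable {J : α × List α → Prop} (hJ : Semidecidable J) :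
    Semidecidable (Derivable J) := by
  obtain ⟨r, hr, h⟩ := hJ
  have key : ∀ a, Derivable J a ↔ ∃ s, IsDerivation r s ∧ a ∈ s.map fun y => y.1.1 := by
    intro a
    constructor
    · intro ha
      induction ha with
      | intro a l _ hJ ih =>
        obtain ⟨n, hn⟩ := (h _).1 hJ
        have : ∃ s, IsDerivation r s ∧ ∀ b ∈ l, b ∈ s.map fun y => y.1.1 := by
          clear hJ hn
          induction l with
          | nil => exact ⟨[], trivial, by simp⟩
          | cons b l ihl =>
            obtain ⟨s, hs, hsl⟩ := ihl (fun b hb => ‹∀ b ∈ _, Derivable J b› b (by simp [hb]))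
              (fun b hb => ih b (by simp [hb]))
            obtain ⟨t, ht, htb⟩ := ih b (by simp)
            -- Derivations of the single premises are simply concatenated: an entry refers only to
            -- later entries, so a derivation stays one when another is appended.
            refine ⟨t ++ s, ht.append hs, fun c hc => ?_⟩
            rw [List.map_append]
            rcases List.mem_cons.1 hc with rfl | hc
            · exact List.mem_append_left _ htb
            · exact List.mem_append_right _ (hsl c hc)
        obtain ⟨s, hs, hl⟩ := this
        exact ⟨((a, l), n) :: s, ⟨⟨hn, hl⟩, hs⟩, by simp⟩
    · rintro ⟨s, hs, ha⟩
      induction s generalizing a with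
      | nil => simp at ha
      | cons x s ih =>
        rcases List.mem_cons.1 ha with rfl | ha
        · exact Derivable.intro _ x.1.2 (fun b hb => ih b hs.2 (hs.1.2 b hb))
            ((h _).2 ⟨x.2, hs.1.1⟩)
        · exact ih a hs.2 ha
  refine (Semidecidable.exists (r := fun z : α × List ((α × List α) × ℕ) =>
    IsDerivation r z.2 ∧ z.1 ∈ z.2.map fun y => y.1.1) ?_).of_eq fun a => (key a).symm
  exact (((computablePred_isDerivation hr).comp .snd).and (ComputablePred.mem .fst
    (computable_conclusions.comp .snd))).semidecidable

end Semidecidable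

end CombInterp

namespace CombInterp

open FirstOrder.Language (Term)

/-! ### Types coded by natural numbers -/

section OfCode

variable {α β : Type} (c : α → ℕ) (hc : Function.Injective c) [Infinite α]

open Classical in
/-- The position of a code among all codes. -/
noncomputable def codeIndex (n : ℕ) : ℕ := Nat.count (· ∈ Set.range c) n

omit [Infinite α] in
theorem codeIndex_eq [DecidablePred (· ∈ Set.range c)] :
    codeIndex c = Nat.count (· ∈ Set.range c) := by
  funext n
  unfold codeIndex
  congr

include hc in
-- The index counts the smaller codes. As there are infinitely many codes, every natural number is
-- an index, so the type is put in bijection with the natural numbers even if not every number is a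
-- code.
theorem codeIndex_bijective : Function.Bijective fun a => codeIndex c (c a) := by
  classical
  rw [codeIndex_eq]
  constructor
  · intro a b h
    exact hc (Nat.count_injective ⟨a, rfl⟩ ⟨b, rfl⟩ h)
  · intro n
    have hinf : {x | x ∈ Set.range c}.Infinite := Set.infinite_range_of_injective hc
    obtain ⟨a, ha⟩ := Nat.nth_mem_of_infinite hinf n
    refine ⟨a, ?_⟩
    show Nat.count _ (c a) = n
    rw [ha]
    exact Nat.count_nth_of_infinite hinf n

/-- The bijection with the natural numbers that enumerates a type in the order of the codes. -/
noncomputable def codeEquiv : α ≃ ℕ := Equiv.ofBijective _ (codeIndex_bijective c hc)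

theorem codeEquiv_apply (a : α) : codeEquiv c hc a = codeIndex c (c a) := rfl

/-- The computability structure on a type with an injective coding by natural numbers. -/
@[reducible] noncomputable def primcodableOfCode : Primcodable α :=
  Primcodable.ofEquiv ℕ (codeEquiv c hc)

/-- The element with a given code. -/
noncomputable def ofCode (n : ℕ) : α := (codeEquiv c hc).symm (codeIndex c n)

theorem ofCode_code (a : α) : ofCode c hc (c a) = a := by
  rw [ofCode, Equiv.symm_apply_eq, codeEquiv_apply]

theorem computable_count {p : ℕ → Prop} [DecidablePred p] (hp : ComputablePred p) :
    Computable (Nat.count p) := by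
  refine (Computable.nat_rec (f := fun n : ℕ => n) (g := fun _ => 0)
    (h := fun _ x => if p x.1 then x.2 + 1 else x.2) Computable.id (Computable.const 0) ?_).of_eq
    fun n => ?_
  · exact computable_ite (p := fun z : ℕ × (ℕ × ℕ) => p z.2.1)
      (hp.comp (Computable.fst.comp .snd)) (Computable.succ.comp (Computable.snd.comp .snd))
      (Computable.snd.comp .snd)
  · induction n with
    | zero => simp
    | succ n ih => simp only [Nat.count_succ, ih]; split_ifs <;> rfl

variable {c} (hr : ComputablePred (· ∈ Set.range c))
include hr

theorem computable_codeIndex : Computable (codeIndex c) := by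
  classical
  rw [codeIndex_eq]
  exact computable_count hr

theorem computable_ofCode : letI := primcodableOfCode c hc; Computable (ofCode c hc) := by
  let _ := primcodableOfCode c hc
  have h : Computable (codeEquiv c hc).symm := (Primrec.of_equiv_symm (α := ℕ)).to_comp
  exact h.comp (computable_codeIndex hr)

/-- The code is recovered from the index by searching for the code that has this index, which uses
that the set of codes is decidable. -/
theorem computable_code : letI := primcodableOfCode c hc; Computable c := by
  classical
  let _ := primcodableOfCode c hc
  have he : Computable (codeEquiv c hc) := (Primrec.of_equiv (α := ℕ)).to_comp
  have hex : ∀ n, ∃ m, m ∈ Set.range c ∧ codeIndex c m = n := fun n =>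
    ⟨c ((codeEquiv c hc).symm n), ⟨_, rfl⟩, by rw [← codeEquiv_apply c hc]; simp⟩
  have hf := Computable.find (P := fun n m => m ∈ Set.range c ∧
    codeIndex c m = n) ((hr.comp .snd).and
      (ComputablePred.eq ((computable_codeIndex hr).comp .snd) .fst)) hex
  refine (hf.comp he).of_eq fun a => ?_
  obtain ⟨⟨b, hb⟩, h⟩ := Nat.find_spec (hex (codeEquiv c hc a))
  rw [← hb, ← codeEquiv_apply c hc] at h
  rw [← hb, (codeEquiv c hc).injective h]

theorem computable_of_code [Primcodable β] {f : β → α} (hf : Computable fun b => c (f b)) :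
    letI := primcodableOfCode c hc; Computable f := by
  let _ := primcodableOfCode c hc
  exact ((computable_ofCode hc hr).comp hf).of_eq fun b => ofCode_code c hc (f b)

end OfCode

/-! ### Course-of-values recursion -/

section CourseOfValues

variable {α σ : Type}

/-- The list of the values below `n` of the function defined by course-of-values recursion. -/
def courseList (G : List σ → σ) : ℕ → List σ
  | 0 => []
  | n + 1 => courseList G n ++ [G (courseList G n)]

theorem length_courseList (G : List σ → σ) (n : ℕ) : (courseList G n).length = n := by
  induction n with
  | zero => rfl
  | succ n ih => simp [courseList, ih]

theorem getElem?_courseList (G : List σ → σ) {m n : ℕ} (h : m < n) :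
    (courseList G n)[m]? = some (G (courseList G m)) := by
  induction n with
  | zero => omega
  | succ n ih =>
    rw [courseList]
    rcases Nat.lt_succ_iff_lt_or_eq.1 h with h | rfl
    · rw [List.getElem?_append_left (by rwa [length_courseList]), ih h]
    · rw [List.getElem?_append_right (by rw [length_courseList]), length_courseList]; simp

variable [Primcodable α] [Primcodable σ]

theorem computable_courseList {G : α → List σ → σ} (hG : Computable₂ G) :
    Computable₂ fun a n => courseList (G a) n := by
  refine (Computable.nat_rec (f := fun x : α × ℕ => x.2) (g := fun _ => ([] : List σ))
    (h := fun x y => y.2 ++ [G x.1 y.2]) .snd (Computable.const _) ?_).of_eq fun x => ?_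
  · exact Computable.list_concat.comp (Computable.snd.comp .snd)
      (hG.comp (Computable.fst.comp .fst) (Computable.snd.comp .snd))
  · induction x.2 with
    | zero => rfl
    | succ n ih => simp only [courseList, ih]

/-- A function of codes whose value is computed from its values at the codes of the immediate
constituents is computable. -/
theorem exists_computable_fold {children : ℕ → List ℕ} (hch : Computable children)
    (hlt : ∀ n, ∀ m ∈ children n, m < n) {H : α → ℕ × List σ → σ} (hH : Computable₂ H) :
    ∃ F : α → ℕ → σ, Computable₂ F ∧ ∀ a n, F a n = H a (n, (children n).map (F a)) := by
  -- `prev` lists the values below `n`, so its length is `n`; the constituents have smaller codes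
  -- and their values are found in it.
  let G : α → List σ → σ := fun a prev =>
    H a (prev.length, (children prev.length).filterMap fun m => prev[m]?)
  have hG : Computable₂ G := by
    have hlen : Computable fun x : α × List σ => x.2.length :=
      Computable.list_length.comp Computable.snd
    refine hH.comp Computable.fst (hlen.pair ?_)
    exact computable_filterMap (g := fun (x : α × List σ) (m : ℕ) => x.2[m]?) (hch.comp hlen)
      (Computable.list_getElem?.comp (Computable.snd.comp .fst) .snd)
  refine ⟨fun a n => G a (courseList (G a) n),
    hG.comp Computable.fst (computable_courseList hG), fun a n => ?_⟩
  have h : (children n).filterMap (fun m => (courseList (G a) n)[m]?) =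
      (children n).map fun m => G a (courseList (G a) m) := by
    rw [← List.filterMap_eq_map']
    exact List.filterMap_congr fun m hm => getElem?_courseList _ (hlt n m hm)
  rw [← h]
  simp only [G, length_courseList]

end CourseOfValues

/-- Positivity is needed, since `Nat.pair 0 0 = 0`. The constructors with constituents of their own
kind carry the positive tags `1` and `3`, so the codes of these constituents are strictly smaller.
-/
theorem right_lt_pair {a : ℕ} (h : 0 < a) (b : ℕ) : b < Nat.pair a b := by
  unfold Nat.pair
  split_ifs <;> nlinarith

theorem lt_encode_of_mem {l : List ℕ} {x : ℕ} (h : x ∈ l) : x < Encodable.encode l := by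
  induction l with
  | nil => simp at h
  | cons y l ih =>
    rw [Encodable.encode_list_cons]
    rcases List.mem_cons.1 h with rfl | h
    · exact Nat.lt_succ_of_le (Nat.left_le_pair _ _)
    · exact (ih h).trans_le (Nat.le_succ_of_le (Nat.right_le_pair _ _))

end CombInterp

namespace CombInterp

open FirstOrder.Language (Term)

/-! ### Terms and formulae as data types -/

section FormulaCodes

variable {L : FirstOrder.Language.{0, 0}}

theorem termCode_injective [Encodable (Σ n, L.Functions n)] :
    Function.Injective (termCode : L.Term ℕ → ℕ) := by
  intro t
  induction t with
  | var c =>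
    intro u h
    cases u with
    | var d => rw [(Nat.pair_eq_pair.1 h).2]
    | func f us => cases (Nat.pair_eq_pair.1 h).1
  | func f ts ih =>
    intro u h
    cases u with
    | var d => cases (Nat.pair_eq_pair.1 h).1
    | func f' us =>
      obtain ⟨h₁, h₂⟩ := Nat.pair_eq_pair.1 (Nat.pair_eq_pair.1 h).2
      cases Encodable.encode_injective h₁
      congr 1
      funext j
      exact ih j (congrFun (List.ofFn_injective (Encodable.encode_injective h₂)) j)

theorem QF.code_injective [Encodable (Σ n, L.Functions n)] [Encodable (Σ n, L.Relations n)] :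
    Function.Injective (QF.code : QF L → ℕ) := by
  intro φ
  induction φ with
  | falsum =>
    intro ψ h
    cases ψ with
    | falsum => rfl
    | _ => cases (Nat.pair_eq_pair.1 h).1
  | equal t u =>
    intro ψ h
    cases ψ with
    | equal t' u' =>
      obtain ⟨h₁, h₂⟩ := Nat.pair_eq_pair.1 (Nat.pair_eq_pair.1 h).2
      rw [termCode_injective h₁, termCode_injective h₂]
    | _ => cases (Nat.pair_eq_pair.1 h).1
  | rel R ts =>
    intro ψ h
    cases ψ with
    | rel R' us =>
      obtain ⟨h₁, h₂⟩ := Nat.pair_eq_pair.1 (Nat.pair_eq_pair.1 h).2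
      cases Encodable.encode_injective h₁
      congr 1
      funext j
      exact termCode_injective
        (congrFun (List.ofFn_injective (Encodable.encode_injective h₂)) j)
    | _ => cases (Nat.pair_eq_pair.1 h).1
  | imp φ₁ φ₂ ih₁ ih₂ =>
    intro ψ h
    cases ψ with
    | imp ψ₁ ψ₂ =>
      obtain ⟨h₁, h₂⟩ := Nat.pair_eq_pair.1 (Nat.pair_eq_pair.1 h).2
      rw [ih₁ h₁, ih₂ h₂]
    | _ => cases (Nat.pair_eq_pair.1 h).1

instance : Infinite (L.Term ℕ) := Infinite.of_injective Term.var fun _ _ => Term.var.inj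

instance : Infinite (QF L) :=
  Infinite.of_injective (fun c => QF.equal (Term.var c) (Term.var c)) fun _ _ h =>
    Term.var.inj (QF.equal.inj h).1

variable [Primcodable (Σ n, L.Functions n)] [Primcodable (Σ n, L.Relations n)]

/-- The structure is defined through the order of the codes and needs no effectiveness of the
arities; that hypothesis enters only when elements are computed from their Gödel numbers or
conversely. -/
noncomputable instance : Primcodable (L.Term ℕ) := primcodableOfCode termCode termCode_injective

noncomputable instance : Primcodable (QF L) := primcodableOfCode QF.code QF.code_injective

/-- The codes of the immediate subterms. -/
def termChildren (n : ℕ) : List ℕ :=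
  if n.unpair.1 = 1 then Denumerable.ofNat (List ℕ) n.unpair.2.unpair.2 else []

theorem computable_unpair_fst : Computable fun n : ℕ => n.unpair.1 :=
  Computable.fst.comp Computable.unpair

theorem computable_unpair_snd : Computable fun n : ℕ => n.unpair.2 :=
  Computable.snd.comp Computable.unpair

theorem computable_ofNat_list : Computable (Denumerable.ofNat (List ℕ)) :=
  Computable.ofNat _

theorem computable_termChildren : Computable termChildren :=
  computable_ite (ComputablePred.eq computable_unpair_fst (Computable.const 1))
    (computable_ofNat_list.comp (computable_unpair_snd.comp computable_unpair_snd))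
    (Computable.const _)

theorem lt_of_mem_termChildren {n m : ℕ} (h : m ∈ termChildren n) : m < n := by
  unfold termChildren at h
  split_ifs at h with h₁
  · have h₂ := lt_encode_of_mem h
    rw [Denumerable.encode_ofNat] at h₂
    have h₃ := right_lt_pair (a := n.unpair.1) (by omega) n.unpair.2
    rw [Nat.pair_unpair] at h₃
    exact (h₂.trans_le (Nat.unpair_right_le _)).trans h₃
  · simp at h

theorem termChildren_func {n : ℕ} (f : L.Functions n) (ts : Fin n → L.Term ℕ) :
    termChildren (termCode (Term.func f ts)) = List.ofFn fun i => termCode (ts i) := by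
  simp [termChildren, termCode]

theorem termChildren_var (c : ℕ) : termChildren (termCode (Term.var c : L.Term ℕ)) = [] := by
  simp [termChildren, termCode]

theorem exists_ofFn_eq_of_forall_mem_range {α : Type} {c : α → ℕ} {l : List ℕ} {n : ℕ}
    (hl : l.length = n) (h : ∀ m ∈ l, m ∈ Set.range c) :
    ∃ ts : Fin n → α, (List.ofFn fun i => c (ts i)) = l := by
  subst hl
  choose ts hts using fun i : Fin l.length => h (l.get i) (List.get_mem l i)
  exact ⟨ts, by simp only [hts]; exact List.ofFn_get l⟩

/-- Validity of the outermost symbol of the code of a term. -/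
def IsTermHead (L : FirstOrder.Language.{0, 0}) [Primcodable (Σ n, L.Functions n)] (n k : ℕ) :
    Prop :=
  n.unpair.1 = 0 ∨ n.unpair.1 = 1 ∧ ∃ f : Σ n, L.Functions n,
    Encodable.decode n.unpair.2.unpair.1 = some f ∧
      Encodable.encode f = n.unpair.2.unpair.1 ∧ k = f.1

/-- Local validity of every node suffices, which gives a decision by recursion on codes. A number
may decode to a symbol without being its code, hence the test that encoding the symbol gives the
number back. -/
theorem mem_range_termCode {n : ℕ} : n ∈ Set.range (termCode : L.Term ℕ → ℕ) ↔
    IsTermHead L n (termChildren n).length ∧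
      ∀ m ∈ termChildren n, m ∈ Set.range (termCode : L.Term ℕ → ℕ) := by
  constructor
  · rintro ⟨t, rfl⟩
    cases t with
    | var c =>
      rw [termChildren_var]
      exact ⟨Or.inl (by simp [termCode]), by simp⟩
    | func f ts =>
      rw [termChildren_func]
      refine ⟨Or.inr ⟨by simp [termCode], ⟨_, f⟩, by simp [termCode], by simp [termCode],
        by simp⟩, ?_⟩
      simp
  · rintro ⟨h | ⟨h, f, -, hf, hk⟩, hch⟩
    · exact ⟨.var n.unpair.2, by rw [termCode, ← h, Nat.pair_unpair]⟩
    · obtain ⟨ts, hts⟩ := exists_ofFn_eq_of_forall_mem_range hk hch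
      refine ⟨.func f.2 ts, ?_⟩
      rw [termCode, hts, termChildren, if_pos h, Denumerable.encode_ofNat, Sigma.eta, hf,
        Nat.pair_unpair, ← h, Nat.pair_unpair]

/-- A set of codes determined by recursion on the constituents is decidable. -/
theorem computablePred_of_children {children : ℕ → List ℕ} (hch : Computable children)
    (hlt : ∀ n, ∀ m ∈ children n, m < n) {head : ℕ → Prop} (hh : ComputablePred head)
    {p : ℕ → Prop} (hp : ∀ n, p n ↔ head n ∧ ∀ m ∈ children n, p m) : ComputablePred p := by
  obtain ⟨h, hhc, rfl⟩ := ComputablePred.computable_iff.1 hh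
  have hall : Computable fun l : List Bool => l.foldr (fun b s => b && s) true :=
    computable_foldr (h := fun (_ : List Bool) (x : Bool × Bool) => x.1 && x.2) Computable.id
      (Computable.const true)
      (Primrec.and.to_comp.comp (Computable.fst.comp .snd) (Computable.snd.comp .snd))
  have hH : Computable₂ fun (_ : Unit) (x : ℕ × List Bool) =>
      h x.1 && x.2.foldr (fun b s => b && s) true :=
    Primrec.and.to_comp.comp (hhc.comp (Computable.fst.comp .snd))
      (hall.comp (Computable.snd.comp .snd))
  obtain ⟨F, hF, hFeq⟩ := exists_computable_fold hch hlt hH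
  refine computablePred_of_bool (hF.comp (Computable.const ()) Computable.id) fun n => ?_
  induction n using Nat.strong_induction_on with
  | _ n ih =>
    have aux : ∀ l : List ℕ, (∀ m ∈ l, p m ↔ F () m = true) →
        ((∀ m ∈ l, p m) ↔ (l.map (F ())).foldr (fun b s => b && s) true = true) := by
      intro l
      induction l with
      | nil => simp
      | cons m l ihl =>
        intro hl
        rw [List.forall_mem_cons] at hl ⊢
        simp [hl.1, ihl hl.2]
    rw [hp, hFeq, Bool.and_eq_true, aux _ fun m hm => ih m (hlt n m hm)]
    exact Iff.rfl

variable (hL : EffectiveArities L)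
include hL

theorem computablePred_isTermHead : ComputablePred fun x : ℕ × ℕ => IsTermHead L x.1 x.2 := by
  have htag : Computable fun x : ℕ × ℕ => x.1.unpair.1 := computable_unpair_fst.comp .fst
  have hsym : Computable fun x : ℕ × ℕ => x.1.unpair.2.unpair.1 :=
    computable_unpair_fst.comp (computable_unpair_snd.comp .fst)
  refine (ComputablePred.eq htag (Computable.const 0)).or
    ((ComputablePred.eq htag (Computable.const 1)).and
      (ComputablePred.bex_option (r := fun y : (ℕ × ℕ) × (Σ n, L.Functions n) =>
        Encodable.encode y.2 = y.1.1.unpair.2.unpair.1 ∧ y.1.2 = y.2.1)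
        (Computable.decode.comp hsym) ?_))
  exact (ComputablePred.eq (Computable.encode.comp .snd) (hsym.comp .fst)).and
    (ComputablePred.eq (Computable.snd.comp .fst) (hL.1.comp .snd))

theorem computablePred_range_termCode :
    ComputablePred (· ∈ Set.range (termCode : L.Term ℕ → ℕ)) :=
  computablePred_of_children computable_termChildren (fun _ _ => lt_of_mem_termChildren)
    ((computablePred_isTermHead hL).comp
      (Computable.id.pair (Computable.list_length.comp computable_termChildren)))
    fun _ => mem_range_termCode

theorem computable_termCode : Computable (termCode : L.Term ℕ → ℕ) :=
  computable_code termCode_injective (computablePred_range_termCode hL)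

theorem computable_of_termCode {α : Type} [Primcodable α] {f : α → L.Term ℕ}
    (hf : Computable fun a => termCode (f a)) : Computable f :=
  computable_of_code termCode_injective (computablePred_range_termCode hL) hf

omit hL in
/-- The codes of the immediate subformulae. -/
def formulaChildren (n : ℕ) : List ℕ :=
  if n.unpair.1 = 3 then [n.unpair.2.unpair.1, n.unpair.2.unpair.2] else []

omit hL in
theorem computable_formulaChildren : Computable formulaChildren :=
  computable_ite (ComputablePred.eq computable_unpair_fst (Computable.const 3))
    (Computable.list_cons.comp (computable_unpair_fst.comp computable_unpair_snd)
      (Computable.list_cons.comp (computable_unpair_snd.comp computable_unpair_snd)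
        (Computable.const _)))
    (Computable.const _)

omit hL in
theorem lt_of_mem_formulaChildren {n m : ℕ} (h : m ∈ formulaChildren n) : m < n := by
  unfold formulaChildren at h
  split_ifs at h with h₁
  · have h₃ := right_lt_pair (a := n.unpair.1) (by omega) n.unpair.2
    rw [Nat.pair_unpair] at h₃
    have h₄ := Nat.unpair_left_le n.unpair.2
    have h₅ := Nat.unpair_right_le n.unpair.2
    simp only [List.mem_cons, List.not_mem_nil, or_false] at h
    omega
  · simp at h

omit hL in
/-- Validity of the outermost symbol of the code of a formula. -/
def IsFormulaHead (L : FirstOrder.Language.{0, 0}) [Primcodable (Σ n, L.Functions n)]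
    [Primcodable (Σ n, L.Relations n)] (n : ℕ) : Prop :=
  n = Nat.pair 0 0 ∨
  (n.unpair.1 = 1 ∧ n.unpair.2.unpair.1 ∈ Set.range (termCode : L.Term ℕ → ℕ) ∧
    n.unpair.2.unpair.2 ∈ Set.range (termCode : L.Term ℕ → ℕ)) ∨
  (n.unpair.1 = 2 ∧ (∃ R : Σ n, L.Relations n,
    Encodable.decode n.unpair.2.unpair.1 = some R ∧ Encodable.encode R = n.unpair.2.unpair.1 ∧
      (Denumerable.ofNat (List ℕ) n.unpair.2.unpair.2).length = R.1) ∧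
    ∀ m ∈ Denumerable.ofNat (List ℕ) n.unpair.2.unpair.2,
      m ∈ Set.range (termCode : L.Term ℕ → ℕ)) ∨
  n.unpair.1 = 3

omit hL in
theorem mem_range_code {n : ℕ} : n ∈ Set.range (QF.code : QF L → ℕ) ↔
    IsFormulaHead L n ∧ ∀ m ∈ formulaChildren n, m ∈ Set.range (QF.code : QF L → ℕ) := by
  constructor
  · rintro ⟨φ, rfl⟩
    cases φ with
    | falsum => exact ⟨Or.inl rfl, by simp [formulaChildren, QF.code]⟩
    | equal t u =>
      exact ⟨Or.inr (Or.inl (by simp [QF.code])), by simp [formulaChildren, QF.code]⟩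
    | rel R ts =>
      refine ⟨Or.inr (Or.inr (Or.inl ⟨by simp [QF.code], ⟨⟨_, R⟩, ?_⟩, ?_⟩)),
        by simp [formulaChildren, QF.code]⟩ <;> simp [QF.code]
    | imp φ ψ =>
      exact ⟨Or.inr (Or.inr (Or.inr (by simp [QF.code]))), by simp [formulaChildren, QF.code]⟩
  · rintro ⟨rfl | ⟨h, ⟨t, ht⟩, u, hu⟩ | ⟨h, ⟨R, -, hR, hk⟩, hts⟩ | h, hch⟩
    · exact ⟨.falsum, rfl⟩
    · exact ⟨.equal t u, by rw [QF.code, ht, hu, Nat.pair_unpair, ← h, Nat.pair_unpair]⟩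
    · obtain ⟨ts, hts⟩ := exists_ofFn_eq_of_forall_mem_range hk hts
      refine ⟨.rel R.2 ts, ?_⟩
      rw [QF.code, hts, Denumerable.encode_ofNat, Sigma.eta, hR, Nat.pair_unpair, ← h,
        Nat.pair_unpair]
    · rw [formulaChildren, if_pos h] at hch
      obtain ⟨φ, hφ⟩ := hch n.unpair.2.unpair.1 (by simp)
      obtain ⟨ψ, hψ⟩ := hch n.unpair.2.unpair.2 (by simp)
      exact ⟨.imp φ ψ, by rw [QF.code, hφ, hψ, Nat.pair_unpair, ← h, Nat.pair_unpair]⟩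

theorem computablePred_isFormulaHead : ComputablePred (IsFormulaHead L) := by
  have htag (k : ℕ) : ComputablePred fun n : ℕ => n.unpair.1 = k :=
    ComputablePred.eq computable_unpair_fst (Computable.const k)
  have h₁ : Computable fun n : ℕ => n.unpair.2.unpair.1 :=
    computable_unpair_fst.comp computable_unpair_snd
  have h₂ : Computable fun n : ℕ => n.unpair.2.unpair.2 :=
    computable_unpair_snd.comp computable_unpair_snd
  have hl : Computable fun n : ℕ => Denumerable.ofNat (List ℕ) n.unpair.2.unpair.2 :=
    computable_ofNat_list.comp h₂
  have ht := computablePred_range_termCode hL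
  have hR : ComputablePred fun n : ℕ => ∃ R : Σ n, L.Relations n,
      Encodable.decode n.unpair.2.unpair.1 = some R ∧
        Encodable.encode R = n.unpair.2.unpair.1 ∧
        (Denumerable.ofNat (List ℕ) n.unpair.2.unpair.2).length = R.1 := by
    refine ComputablePred.bex_option (r := fun y : ℕ × (Σ n, L.Relations n) =>
      Encodable.encode y.2 = y.1.unpair.2.unpair.1 ∧
        (Denumerable.ofNat (List ℕ) y.1.unpair.2.unpair.2).length = y.2.1)
      (Computable.decode.comp h₁) ?_
    exact (ComputablePred.eq (Computable.encode.comp .snd) (h₁.comp .fst)).and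
      (ComputablePred.eq (Computable.list_length.comp (hl.comp .fst)) (hL.2.comp .snd))
  have hall : ComputablePred fun n : ℕ => ∀ m ∈ Denumerable.ofNat (List ℕ) n.unpair.2.unpair.2,
      m ∈ Set.range (termCode : L.Term ℕ → ℕ) :=
    ComputablePred.ball (r := fun x : ℕ × ℕ => x.2 ∈ Set.range (termCode : L.Term ℕ → ℕ)) hl
      (ht.comp .snd)
  exact (ComputablePred.eq Computable.id (Computable.const (Nat.pair 0 0))).or
    (((htag 1).and ((ht.comp h₁).and (ht.comp h₂))).or
      (((htag 2).and (hR.and hall)).or (htag 3)))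

theorem computablePred_range_code : ComputablePred (· ∈ Set.range (QF.code : QF L → ℕ)) :=
  computablePred_of_children computable_formulaChildren (fun _ _ => lt_of_mem_formulaChildren)
    (computablePred_isFormulaHead hL) fun _ => mem_range_code

theorem computable_qfCode : Computable (QF.code : QF L → ℕ) :=
  computable_code QF.code_injective (computablePred_range_code hL)

theorem computable_of_qfCode {α : Type} [Primcodable α] {f : α → QF L}
    (hf : Computable fun a => (f a).code) : Computable f :=
  computable_of_code QF.code_injective (computablePred_range_code hL) hf

/-! ### Constructors -/

theorem computable_var {α : Type} [Primcodable α] {f : α → ℕ} (hf : Computable f) :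
    Computable fun a => (Term.var (f a) : L.Term ℕ) :=
  computable_of_termCode hL (Primrec₂.natPair.to_comp.comp (Computable.const 0) hf)

omit hL in
/-- The application of a function symbol to a list of terms (a variable if the length of the list
is not the arity of the symbol). -/
def mkFunc (f : Σ n, L.Functions n) (ts : List (L.Term ℕ)) : L.Term ℕ :=
  if h : f.1 = ts.length then .func f.2 fun i => ts.get (i.cast h) else .var 0

omit hL in
/-- The application of a relation symbol to a list of terms (falsum if the length of the list
is not the arity of the symbol). -/
def mkRel (R : Σ n, L.Relations n) (ts : List (L.Term ℕ)) : QF L :=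
  if h : R.1 = ts.length then .rel R.2 fun i => ts.get (i.cast h) else .falsum

omit [Primcodable (Σ n, L.Functions n)] [Primcodable (Σ n, L.Relations n)] hL in
-- Building terms from a symbol and a list avoids the dependence of the argument tuple on the arity,
-- so that computable functions can produce them; on tuples of the right length nothing is lost.
theorem mkFunc_ofFn {n : ℕ} (f : L.Functions n) (ts : Fin n → L.Term ℕ) :
    mkFunc ⟨n, f⟩ (List.ofFn ts) = .func f ts := by
  simp [mkFunc]

omit [Primcodable (Σ n, L.Functions n)] [Primcodable (Σ n, L.Relations n)] hL in
theorem mkRel_ofFn {n : ℕ} (R : L.Relations n) (ts : Fin n → L.Term ℕ) :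
    mkRel ⟨n, R⟩ (List.ofFn ts) = .rel R ts := by
  simp [mkRel]

omit [Primcodable (Σ n, L.Functions n)] [Primcodable (Σ n, L.Relations n)] hL in
theorem ofFn_get_cast {α β : Type} (c : α → β) (l : List α) {n : ℕ} (h : n = l.length) :
    (List.ofFn fun i : Fin n => c (l.get (i.cast h))) = l.map c := by
  subst h
  simp

theorem computable_mkFunc {α : Type} [Primcodable α] {f : α → Σ n, L.Functions n}
    {ts : α → List (L.Term ℕ)} (hf : Computable f) (hts : Computable ts) :
    Computable fun a => mkFunc (f a) (ts a) := by
  classical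
  have hcodes : Computable fun a => (ts a).map termCode :=
    computable_map (g := fun (_ : α) (t : L.Term ℕ) => termCode t) hts
      ((computable_termCode hL).comp .snd)
  refine computable_of_termCode hL ((computable_ite
    (ComputablePred.eq (hL.1.comp hf) (Computable.list_length.comp hts))
    (Primrec₂.natPair.to_comp.comp (Computable.const 1)
      (Primrec₂.natPair.to_comp.comp (Computable.encode.comp hf)
        (Computable.encode.comp hcodes)))
    (Primrec₂.natPair.to_comp.comp (Computable.const 0) (Computable.const 0))).of_eq fun a => ?_)
  unfold mkFunc
  split_ifs with h
  · rw [termCode, ofFn_get_cast]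
  · rfl

theorem computable_mkRel {α : Type} [Primcodable α] {f : α → Σ n, L.Relations n}
    {ts : α → List (L.Term ℕ)} (hf : Computable f) (hts : Computable ts) :
    Computable fun a => mkRel (f a) (ts a) := by
  classical
  have hcodes : Computable fun a => (ts a).map termCode :=
    computable_map (g := fun (_ : α) (t : L.Term ℕ) => termCode t) hts
      ((computable_termCode hL).comp .snd)
  refine computable_of_qfCode hL ((computable_ite
    (ComputablePred.eq (hL.2.comp hf) (Computable.list_length.comp hts))
    (Primrec₂.natPair.to_comp.comp (Computable.const 2)
      (Primrec₂.natPair.to_comp.comp (Computable.encode.comp hf)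
        (Computable.encode.comp hcodes)))
    (Primrec₂.natPair.to_comp.comp (Computable.const 0) (Computable.const 0))).of_eq fun a => ?_)
  unfold mkRel
  split_ifs with h
  · rw [QF.code, ofFn_get_cast]
  · rfl

theorem computable_equal {α : Type} [Primcodable α] {t u : α → L.Term ℕ} (ht : Computable t)
    (hu : Computable u) : Computable fun a => QF.equal (t a) (u a) :=
  computable_of_qfCode hL (Primrec₂.natPair.to_comp.comp (Computable.const 1)
    (Primrec₂.natPair.to_comp.comp ((computable_termCode hL).comp ht)
      ((computable_termCode hL).comp hu)))

theorem computable_imp {α : Type} [Primcodable α] {φ ψ : α → QF L} (hφ : Computable φ)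
    (hψ : Computable ψ) : Computable fun a => (φ a).imp (ψ a) :=
  computable_of_qfCode hL (Primrec₂.natPair.to_comp.comp (Computable.const 3)
    (Primrec₂.natPair.to_comp.comp ((computable_qfCode hL).comp hφ)
      ((computable_qfCode hL).comp hψ)))

/-! ### Recursion -/

/-- The recursion equations of `F` become a course-of-values recursion on term codes, which is
computable; induction on the term shows that it computes `F`. -/
theorem computable_termRec {α σ : Type} [Primcodable α] [Primcodable σ] {F : α → L.Term ℕ → σ}
    {h₀ : α → ℕ → σ} {h₁ : α → (Σ n, L.Functions n) × List σ → σ} (hh₀ : Computable₂ h₀)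
    (hh₁ : Computable₂ h₁) (hv : ∀ a c, F a (.var c) = h₀ a c)
    (hf : ∀ a n (f : L.Functions n) ts,
      F a (.func f ts) = h₁ a (⟨n, f⟩, List.ofFn fun i => F a (ts i))) : Computable₂ F := by
  -- The value `h₀ a 0` stands for a symbol that cannot be decoded; it is not used at codes of
  -- terms.
  let H : α → ℕ × List σ → σ := fun a x =>
    if x.1.unpair.1 = 1 then
      Option.casesOn (Encodable.decode (α := Σ n, L.Functions n) x.1.unpair.2.unpair.1)
        (h₀ a 0) fun f => h₁ a (f, x.2)
    else h₀ a x.1.unpair.2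
  have hH : Computable₂ H := by
    have hn : Computable fun y : α × (ℕ × List σ) => y.2.1 := Computable.fst.comp .snd
    refine computable_ite (p := fun y : α × (ℕ × List σ) => y.2.1.unpair.1 = 1)
      (ComputablePred.eq (computable_unpair_fst.comp hn) (Computable.const 1)) ?_
      (hh₀.comp .fst (computable_unpair_snd.comp hn))
    refine Computable.option_casesOn (o := fun y : α × (ℕ × List σ) =>
      Encodable.decode (α := Σ n, L.Functions n) y.2.1.unpair.2.unpair.1)
      (f := fun y => h₀ y.1 0) (g := fun y f => h₁ y.1 (f, y.2.2)) ?_ ?_ ?_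
    · exact Computable.decode.comp
        (computable_unpair_fst.comp (computable_unpair_snd.comp hn))
    · exact hh₀.comp .fst (Computable.const 0)
    · exact hh₁.comp (Computable.fst.comp .fst)
        (Computable.snd.pair (Computable.snd.comp (Computable.snd.comp .fst)))
  obtain ⟨G, hG, hGeq⟩ := exists_computable_fold computable_termChildren
    (fun _ _ => lt_of_mem_termChildren) hH
  refine (hG.comp Computable.fst ((computable_termCode hL).comp .snd)).of_eq fun y => ?_
  obtain ⟨a, t⟩ := y
  show G a (termCode t) = F a t
  induction t with
  | var c => rw [hGeq, hv]; simp [H, termCode]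
  | func f ts ih =>
    rw [hGeq, hf, termChildren_func, List.map_ofFn]
    simp only [H, termCode, Nat.unpair_pair, if_pos, Encodable.encodek]
    congr 3
    funext i
    exact ih i

theorem computable_formulaRec {α σ : Type} [Primcodable α] [Primcodable σ]
    {F : α → QF L → σ} {h₀ : α → σ} {h₁ : α → L.Term ℕ × L.Term ℕ → σ}
    {h₂ : α → (Σ n, L.Relations n) × List (L.Term ℕ) → σ} {h₃ : α → σ × σ → σ}
    (hh₀ : Computable h₀) (hh₁ : Computable₂ h₁) (hh₂ : Computable₂ h₂) (hh₃ : Computable₂ h₃)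
    (hfalsum : ∀ a, F a .falsum = h₀ a) (hequal : ∀ a t u, F a (.equal t u) = h₁ a (t, u))
    (hrel : ∀ a n (R : L.Relations n) ts, F a (.rel R ts) = h₂ a (⟨n, R⟩, List.ofFn ts))
    (himp : ∀ a φ ψ, F a (.imp φ ψ) = h₃ a (F a φ, F a ψ)) : Computable₂ F := by
  -- The recursion stops at atoms; the terms in them are not traversed but recovered as elements of
  -- the type from their codes.
  let T : ℕ → L.Term ℕ := ofCode termCode termCode_injective
  have hT : Computable T := computable_ofCode termCode_injective (computablePred_range_termCode hL)
  have hTc : ∀ t : L.Term ℕ, T (termCode t) = t := ofCode_code termCode termCode_injective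
  -- Away from codes of formulae the values are irrelevant, and `h₀ a` fills every gap; the code of
  -- an implication has exactly the two constituents that are looked up.
  let H : α → ℕ × List σ → σ := fun a x =>
    if x.1.unpair.1 = 1 then h₁ a (T x.1.unpair.2.unpair.1, T x.1.unpair.2.unpair.2)
    else if x.1.unpair.1 = 2 then
      Option.casesOn (Encodable.decode (α := Σ n, L.Relations n) x.1.unpair.2.unpair.1)
        (h₀ a) fun R => h₂ a (R, (Denumerable.ofNat (List ℕ) x.1.unpair.2.unpair.2).map T)
    else if x.1.unpair.1 = 3 then h₃ a ((x.2[0]?).getD (h₀ a), (x.2[1]?).getD (h₀ a))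
    else h₀ a
  have hH : Computable₂ H := by
    have hn : Computable fun y : α × (ℕ × List σ) => y.2.1 := Computable.fst.comp .snd
    have hr₁ : Computable fun y : α × (ℕ × List σ) => y.2.1.unpair.2.unpair.1 :=
      computable_unpair_fst.comp (computable_unpair_snd.comp hn)
    have hr₂ : Computable fun y : α × (ℕ × List σ) => y.2.1.unpair.2.unpair.2 :=
      computable_unpair_snd.comp (computable_unpair_snd.comp hn)
    have htag (k : ℕ) : ComputablePred fun y : α × (ℕ × List σ) => y.2.1.unpair.1 = k :=
      ComputablePred.eq (computable_unpair_fst.comp hn) (Computable.const k)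
    have hl : Computable fun y : α × (ℕ × List σ) =>
        (Denumerable.ofNat (List ℕ) y.2.1.unpair.2.unpair.2).map T :=
      computable_map (g := fun (_ : α × (ℕ × List σ)) (m : ℕ) => T m)
        (computable_ofNat_list.comp hr₂) (hT.comp .snd)
    have hget (k : ℕ) : Computable fun y : α × (ℕ × List σ) => (y.2.2[k]?).getD (h₀ y.1) :=
      Computable.option_getD
        (Computable.list_getElem?.comp (Computable.snd.comp .snd) (Computable.const k))
        (hh₀.comp .fst)
    have e₁ : Computable fun y : α × (ℕ × List σ) =>
        h₁ y.1 (T y.2.1.unpair.2.unpair.1, T y.2.1.unpair.2.unpair.2) :=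
      hh₁.comp .fst ((hT.comp hr₁).pair (hT.comp hr₂))
    have e₂ : Computable fun y : α × (ℕ × List σ) => (Option.casesOn
        (Encodable.decode (α := Σ n, L.Relations n) y.2.1.unpair.2.unpair.1)
        (h₀ y.1) fun R => h₂ y.1 (R,
          (Denumerable.ofNat (List ℕ) y.2.1.unpair.2.unpair.2).map T) : σ) := by
      refine Computable.option_casesOn (o := fun y : α × (ℕ × List σ) =>
        Encodable.decode (α := Σ n, L.Relations n) y.2.1.unpair.2.unpair.1)
        (f := fun y => h₀ y.1) (g := fun y R => h₂ y.1 (R,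
          (Denumerable.ofNat (List ℕ) y.2.1.unpair.2.unpair.2).map T))
        (Computable.decode.comp hr₁) (hh₀.comp .fst) ?_
      exact hh₂.comp (Computable.fst.comp .fst) (Computable.snd.pair (hl.comp .fst))
    have e₃ : Computable fun y : α × (ℕ × List σ) =>
        h₃ y.1 ((y.2.2[0]?).getD (h₀ y.1), (y.2.2[1]?).getD (h₀ y.1)) :=
      hh₃.comp .fst ((hget 0).pair (hget 1))
    exact computable_ite (htag 1) e₁ (computable_ite (htag 2) e₂
      (computable_ite (htag 3) e₃ (hh₀.comp .fst)))
  obtain ⟨G, hG, hGeq⟩ := exists_computable_fold computable_formulaChildren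
    (fun _ _ => lt_of_mem_formulaChildren) hH
  refine (hG.comp Computable.fst ((computable_qfCode hL).comp .snd)).of_eq fun y => ?_
  obtain ⟨a, φ⟩ := y
  show G a φ.code = F a φ
  induction φ with
  | falsum => rw [hGeq, hfalsum]; simp [H, QF.code]
  | equal t u => rw [hGeq, hequal]; simp [H, QF.code, hTc]
  | rel R ts =>
    rw [hGeq, hrel]
    simp [H, QF.code, hTc, List.map_ofFn, Function.comp_def]
  | imp φ ψ ih₁ ih₂ =>
    rw [hGeq, himp, ← ih₁, ← ih₂]; simp [H, QF.code, formulaChildren]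

end FormulaCodes

end CombInterp

namespace CombInterp

open FirstOrder.Language (Term)

/-! ### Computability of the syntactic operations -/

section SyntaxComputability

variable {L : FirstOrder.Language.{0, 0}} [Primcodable (Σ n, L.Functions n)]
  [Primcodable (Σ n, L.Relations n)] (hL : EffectiveArities L) {α : Type} [Primcodable α]
include hL

theorem computable_neg {φ : α → QF L} (hφ : Computable φ) : Computable fun a => (φ a).neg :=
  computable_imp hL hφ (Computable.const _)

theorem computable_and {φ ψ : α → QF L} (hφ : Computable φ) (hψ : Computable ψ) :
    Computable fun a => (φ a).and (ψ a) :=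
  computable_neg hL (computable_imp hL hφ (computable_neg hL hψ))

theorem computable_or {φ ψ : α → QF L} (hφ : Computable φ) (hψ : Computable ψ) :
    Computable fun a => (φ a).or (ψ a) :=
  computable_imp hL (computable_neg hL hφ) hψ

theorem computable_bigAnd {l : α → List (QF L)} (hl : Computable l) :
    Computable fun a => QF.bigAnd (l a) :=
  computable_foldr (h := fun (_ : α) (x : QF L × QF L) => x.1.and x.2) hl (Computable.const _)
    (computable_and hL (Computable.fst.comp .snd) (Computable.snd.comp .snd))

theorem computable_bigOr {l : α → List (QF L)} (hl : Computable l) :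
    Computable fun a => QF.bigOr (l a) :=
  computable_foldr (h := fun (_ : α) (x : QF L × QF L) => x.1.or x.2) hl (Computable.const _)
    (computable_or hL (Computable.fst.comp .snd) (Computable.snd.comp .snd))

theorem computable_meet {ts us : α → List (L.Term ℕ)} (hts : Computable ts)
    (hus : Computable us) : Computable fun a => meet (ts a) (us a) :=
  computable_bigOr hL (computable_map
    (g := fun (_ : α) (p : L.Term ℕ × L.Term ℕ) => QF.equal p.1 p.2) (computable_product hts hus)
    (computable_equal hL (Computable.fst.comp .snd) (Computable.snd.comp .snd)))

theorem computable_vars {xs : α → List ℕ} (hxs : Computable xs) :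
    Computable fun a => (vars (xs a) : List (L.Term ℕ)) :=
  computable_map (g := fun (_ : α) (x : ℕ) => (Term.var x : L.Term ℕ)) hxs
    (computable_var hL .snd)

theorem computable_termSubst {c : α → ℕ} {t u : α → L.Term ℕ} (hc : Computable c)
    (ht : Computable t) (hu : Computable u) :
    Computable fun a => (u a).subst fun x => if x = c a then t a else Term.var x := by
  have h₀ : Computable₂ fun (a : ℕ × L.Term ℕ) (x : ℕ) => if x = a.1 then a.2 else Term.var x :=
    computable_ite (p := fun y : (ℕ × L.Term ℕ) × ℕ => y.2 = y.1.1)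
      (ComputablePred.eq .snd (Computable.fst.comp .fst)) (Computable.snd.comp .fst)
      (computable_var hL .snd)
  have h₁ : Computable₂ fun (_ : ℕ × L.Term ℕ) (y : (Σ n, L.Functions n) × List (L.Term ℕ)) =>
      mkFunc y.1 y.2 :=
    computable_mkFunc hL (Computable.fst.comp .snd) (Computable.snd.comp .snd)
  exact (computable_termRec hL (F := fun (a : ℕ × L.Term ℕ) (u : L.Term ℕ) =>
    u.subst fun x => if x = a.1 then a.2 else Term.var x) h₀ h₁ (fun _ _ => rfl)
    fun a n f ts => by rw [mkFunc_ofFn]; rfl).comp (hc.pair ht) hu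

theorem computable_subst {c : α → ℕ} {t : α → L.Term ℕ} {φ : α → QF L} (hc : Computable c)
    (ht : Computable t) (hφ : Computable φ) : Computable fun a => (φ a).subst (c a) (t a) := by
  have h₁ : Computable₂ fun (a : ℕ × L.Term ℕ) (y : L.Term ℕ × L.Term ℕ) =>
      QF.equal (y.1.subst fun x => if x = a.1 then a.2 else Term.var x)
        (y.2.subst fun x => if x = a.1 then a.2 else Term.var x) :=
    computable_equal hL
      (computable_termSubst hL (Computable.fst.comp .fst) (Computable.snd.comp .fst)
        (Computable.fst.comp .snd))
      (computable_termSubst hL (Computable.fst.comp .fst) (Computable.snd.comp .fst)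
        (Computable.snd.comp .snd))
  have h₂ : Computable₂ fun (a : ℕ × L.Term ℕ) (y : (Σ n, L.Relations n) × List (L.Term ℕ)) =>
      mkRel y.1 (y.2.map fun u => u.subst fun x => if x = a.1 then a.2 else Term.var x) := by
    refine computable_mkRel hL (Computable.fst.comp .snd) (computable_map
      (g := fun (a : (ℕ × L.Term ℕ) × ((Σ n, L.Relations n) × List (L.Term ℕ))) (u : L.Term ℕ) =>
        u.subst fun x => if x = a.1.1 then a.1.2 else Term.var x) (Computable.snd.comp .snd) ?_)
    exact computable_termSubst hL (Computable.fst.comp (Computable.fst.comp .fst))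
      (Computable.snd.comp (Computable.fst.comp .fst)) .snd
  have h₃ : Computable₂ fun (_ : ℕ × L.Term ℕ) (y : QF L × QF L) => y.1.imp y.2 :=
    computable_imp hL (Computable.fst.comp .snd) (Computable.snd.comp .snd)
  exact (computable_formulaRec hL (F := fun (a : ℕ × L.Term ℕ) (φ : QF L) => φ.subst a.1 a.2)
    (Computable.const .falsum) h₁ h₂ h₃ (fun _ => rfl) (fun _ _ _ => rfl)
    (fun a n R ts => by rw [List.map_ofFn, mkRel_ofFn]; rfl) fun _ _ _ => rfl).comp
    (hc.pair ht) hφ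

theorem computable_termConsts {t : α → L.Term ℕ} (ht : Computable t) :
    Computable fun a => termConsts (t a) :=
  (computable_termRec hL (F := fun (_ : Unit) (t : L.Term ℕ) => termConsts t)
    (h₀ := fun _ c => [c]) (h₁ := fun _ y => y.2.flatten)
    (Computable.list_cons.comp .snd (Computable.const []))
    (computable_flatten (Computable.snd.comp .snd)) (fun _ _ => rfl) fun _ _ _ _ => rfl).comp
    (Computable.const ()) ht

theorem computable_constList {φ : α → QF L} (hφ : Computable φ) :
    Computable fun a => (φ a).constList := by
  have h₁ : Computable₂ fun (_ : Unit) (y : L.Term ℕ × L.Term ℕ) =>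
      termConsts y.1 ++ termConsts y.2 :=
    Computable.list_append.comp (computable_termConsts hL (Computable.fst.comp .snd))
      (computable_termConsts hL (Computable.snd.comp .snd))
  have h₂ : Computable₂ fun (_ : Unit) (y : (Σ n, L.Relations n) × List (L.Term ℕ)) =>
      (y.2.map termConsts).flatten :=
    computable_flatten (computable_map
      (g := fun (_ : Unit × ((Σ n, L.Relations n) × List (L.Term ℕ))) (t : L.Term ℕ) =>
        termConsts t) (Computable.snd.comp .snd) (computable_termConsts hL .snd))
  have h₃ : Computable₂ fun (_ : Unit) (y : List ℕ × List ℕ) => y.1 ++ y.2 :=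
    Computable.list_append.comp (Computable.fst.comp .snd) (Computable.snd.comp .snd)
  exact (computable_formulaRec hL (F := fun (_ : Unit) (φ : QF L) => φ.constList)
    (Computable.const []) h₁ h₂ h₃ (fun _ => rfl) (fun _ _ _ => rfl)
    (fun a n R ts => by rw [List.map_ofFn]; rfl) fun _ _ _ => rfl).comp (Computable.const ()) hφ

theorem computable_constListOf {A : α → List (QF L)} (hA : Computable A) :
    Computable fun a => constListOf (A a) :=
  computable_flatMap (g := fun (_ : α) (φ : QF L) => φ.constList) hA
    (computable_constList hL .snd)

theorem computable_atomList {φ : α → QF L} (hφ : Computable φ) :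
    Computable fun a => (φ a).atomList := by
  have h₁ : Computable₂ fun (_ : Unit) (y : L.Term ℕ × L.Term ℕ) => [QF.equal y.1 y.2] :=
    Computable.list_cons.comp
      (computable_equal hL (Computable.fst.comp .snd) (Computable.snd.comp .snd))
      (Computable.const [])
  have h₂ : Computable₂ fun (_ : Unit) (y : (Σ n, L.Relations n) × List (L.Term ℕ)) =>
      [mkRel y.1 y.2] :=
    Computable.list_cons.comp
      (computable_mkRel hL (Computable.fst.comp .snd) (Computable.snd.comp .snd))
      (Computable.const [])
  have h₃ : Computable₂ fun (_ : Unit) (y : List (QF L) × List (QF L)) => y.1 ++ y.2 :=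
    Computable.list_append.comp (Computable.fst.comp .snd) (Computable.snd.comp .snd)
  exact (computable_formulaRec hL (F := fun (_ : Unit) (φ : QF L) => φ.atomList)
    (Computable.const []) h₁ h₂ h₃ (fun _ => rfl) (fun _ _ _ => rfl)
    (fun a n R ts => by rw [mkRel_ofFn]; rfl) fun _ _ _ => rfl).comp (Computable.const ()) hφ

theorem computable_relevantList {A : α → List (QF L)} (hA : Computable A) :
    Computable fun a => relevantList (A a) := by
  have hc : Computable fun a => constListOf (A a) := computable_constListOf hL hA
  have h₁ : Computable fun a => (A a).flatMap QF.atomList :=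
    computable_flatMap (g := fun (_ : α) (φ : QF L) => φ.atomList) hA (computable_atomList hL .snd)
  have h₂ : Computable₂ fun (a : α) (c : ℕ) =>
      (constListOf (A a)).map fun d => (QF.equal (Term.var c) (Term.var d) : QF L) :=
    computable_map (g := fun (x : α × ℕ) (d : ℕ) =>
      (QF.equal (Term.var x.2) (Term.var d) : QF L)) (hc.comp .fst)
      (computable_equal hL (computable_var hL (Computable.snd.comp .fst)) (computable_var hL .snd))
  exact Computable.list_append.comp h₁ (computable_flatMap (g := fun (a : α) (c : ℕ) =>
    (constListOf (A a)).map fun d => (QF.equal (Term.var c) (Term.var d) : QF L)) hc h₂)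

theorem computablePred_propTrue {A : α → List (QF L)} {φ : α → QF L} (hA : Computable A)
    (hφ : Computable φ) : ComputablePred fun a => (φ a).PropTrue (· ∈ A a) := by
  classical
  have hmem {β : Type} [Primcodable β] {f : List (QF L) × β → QF L} (hf : Computable f) :
      Computable fun x => decide (f x ∈ x.1) :=
    (computable_ite (ComputablePred.mem hf .fst) (Computable.const true)
      (Computable.const false)).of_eq fun x => by by_cases h : f x ∈ x.1 <;> simp [h]
  have h₁ : Computable₂ fun (A : List (QF L)) (y : L.Term ℕ × L.Term ℕ) =>
      decide (QF.equal y.1 y.2 ∈ A) :=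
    hmem (computable_equal hL (Computable.fst.comp .snd) (Computable.snd.comp .snd))
  have h₂ : Computable₂ fun (A : List (QF L)) (y : (Σ n, L.Relations n) × List (L.Term ℕ)) =>
      decide (mkRel y.1 y.2 ∈ A) :=
    hmem (computable_mkRel hL (Computable.fst.comp .snd) (Computable.snd.comp .snd))
  have h₃ : Computable₂ fun (_ : List (QF L)) (y : Bool × Bool) => !y.1 || y.2 :=
    Primrec.or.to_comp.comp (Primrec.not.to_comp.comp (Computable.fst.comp .snd))
      (Computable.snd.comp .snd)
  refine computablePred_of_bool ((computable_formulaRec hL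
    (F := fun (A : List (QF L)) (φ : QF L) => decide (φ.PropTrue (· ∈ A)))
    (Computable.const false) h₁ h₂ h₃ (fun _ => ?_) (fun _ _ _ => ?_)
    (fun a n R ts => ?_) fun _ φ ψ => ?_).comp hA hφ) fun a => ?_
  · exact decide_eq_false fun h => h
  · exact decide_eq_decide.2 Iff.rfl
  · rw [mkRel_ofFn]; exact decide_eq_decide.2 Iff.rfl
  · by_cases h : φ.PropTrue (· ∈ ‹List (QF L)›) <;> simp [QF.PropTrue, h]
  · simp

theorem computable_literalChoices {l : α → List (QF L)} (hl : Computable l) :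
    Computable fun a => literalChoices (l a) := by
  have hstep : Computable₂ fun (x : α × (QF L × List (List (QF L)))) (c : List (QF L)) =>
      [x.2.1 :: c, x.2.1.neg :: c] := by
    have hp : Computable fun y : (α × (QF L × List (List (QF L)))) × List (QF L) => y.1.2.1 :=
      Computable.fst.comp (Computable.snd.comp .fst)
    exact Computable.list_cons.comp (Computable.list_cons.comp hp .snd)
      (Computable.list_cons.comp (Computable.list_cons.comp (computable_neg hL hp) .snd)
        (Computable.const []))
  refine (computable_foldr (h := fun (_ : α) (x : QF L × List (List (QF L))) =>
    x.2.flatMap fun c => [x.1 :: c, x.1.neg :: c]) hl (Computable.const [ [] ]) ?_).of_eq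
    fun a => ?_
  · exact computable_flatMap (g := fun (x : α × (QF L × List (List (QF L)))) (c : List (QF L)) =>
      [x.2.1 :: c, x.2.1.neg :: c]) (Computable.snd.comp .snd) hstep
  · induction l a with
    | nil => rfl
    | cons p l ih => rw [List.foldr_cons, ih]; rfl

theorem computablePred_consistent {A B : α → List (QF L)} (hA : Computable A)
    (hB : Computable B) : ComputablePred fun a => Consistent (A a) (B a) :=
  (ComputablePred.ball (r := fun x : α × QF L => x.2.neg ∈ B x.1 ↔ x.2 ∉ B x.1)
    (computable_relevantList hL hA)
    ((ComputablePred.mem (computable_neg hL .snd) (hB.comp .fst)).iff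
      (ComputablePred.mem .snd (hB.comp .fst)).not)).and
  (ComputablePred.ball (r := fun x : α × QF L => x.2.PropTrue (· ∈ B x.1)) hA
    (computablePred_propTrue hL (hB.comp .fst) .snd))

theorem computablePred_containsAssignment {A : α → List (QF L)} (hA : Computable A) :
    ComputablePred fun a => ContainsAssignment (A a) :=
  (computablePred_consistent hL hA hA).of_eq fun _ => containsAssignment_iff.symm

theorem computable_assignments {A : α → List (QF L)} (hA : Computable A) :
    Computable fun a => assignments (A a) := by
  classical
  refine (computable_filter (r := fun x : α × List (QF L) => Consistent (A x.1) x.2)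
    (computable_literalChoices hL (computable_relevantList hL hA))
    (computablePred_consistent hL (hA.comp .fst) .snd)).of_eq fun a => ?_
  unfold assignments
  -- The two filters differ only in the decidability instance of the predicate.
  congr

omit hL [Primcodable (Σ n, L.Functions n)] [Primcodable (Σ n, L.Relations n)] in
-- The atom of a literal is among the finitely many atoms of the formula, so the existential
-- quantifier becomes a bounded search.
theorem isLiteral_iff {φ : QF L} :
    φ.IsLiteral ↔ ∃ p ∈ φ.atomList, φ = p ∨ φ = p.neg := by
  simp only [QF.mem_atomList]
  constructor
  · rintro (h | ⟨p, hp, rfl⟩)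
    · exact ⟨φ, by rw [h.atoms_eq]; rfl, Or.inl rfl⟩
    · refine ⟨p, Or.inl ?_, Or.inr rfl⟩
      rw [hp.atoms_eq]; rfl
  · rintro ⟨p, hp, h⟩
    have hpa := QF.isAtom_of_mem_atoms hp
    rcases h with rfl | h
    · exact Or.inl hpa
    · exact Or.inr ⟨p, hpa, h⟩

theorem computablePred_isLiteral {φ : α → QF L} (hφ : Computable φ) :
    ComputablePred fun a => (φ a).IsLiteral :=
  (ComputablePred.bex (r := fun x : α × QF L => φ x.1 = x.2 ∨ φ x.1 = x.2.neg)
    (computable_atomList hL hφ) ((ComputablePred.eq (hφ.comp .fst) .snd).or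
      (ComputablePred.eq (hφ.comp .fst) (computable_neg hL .snd)))).of_eq
    fun _ => isLiteral_iff.symm

end SyntaxComputability

end CombInterp

namespace CombInterp

open FirstOrder.Language (Term)

/-! ### Computability of maps of signatures -/

section MapComputability

variable {L L' : FirstOrder.Language.{0, 0}} [Primcodable (Σ n, L.Functions n)]
  [Primcodable (Σ n, L.Relations n)] [Primcodable (Σ n, L'.Functions n)]
  [Primcodable (Σ n, L'.Relations n)] {α : Type} [Primcodable α]

/-- The images of the symbols are computable. -/
def ComputableLHom (g : L →ᴸ L') : Prop :=
  (Computable fun f : Σ n, L.Functions n => (⟨f.1, g.onFunction f.2⟩ : Σ n, L'.Functions n)) ∧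
    Computable fun R : Σ n, L.Relations n => (⟨R.1, g.onRelation R.2⟩ : Σ n, L'.Relations n)

/-- The partial inverse is computable on symbols. -/
def LHomInverse.IsComputable {g : L →ᴸ L'} (i : LHomInverse g) : Prop :=
  (Computable fun F : Σ n, L'.Functions n =>
    ((i.func F.2).map (Sigma.mk F.1) : Option (Σ n, L.Functions n))) ∧
  Computable fun R : Σ n, L'.Relations n =>
    ((i.rel R.2).map (Sigma.mk R.1) : Option (Σ n, L.Relations n))

/-- The list of the values of a list of options, if all of them are defined. -/
def sequenceList {σ : Type} (l : List (Option σ)) : Option (List σ) :=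
  l.foldr (fun o s => o.bind fun b => s.map (b :: ·)) (some [])

theorem sequenceList_eq_some {σ : Type} {l : List (Option σ)} {m : List σ} :
    sequenceList l = some m ↔ l = m.map some := by
  induction l generalizing m with
  | nil => cases m <;> simp [sequenceList]
  | cons o l ih =>
    have h : sequenceList (o :: l) = o.bind fun b => (sequenceList l).map (b :: ·) := rfl
    rw [h]
    simp only [Option.bind_eq_some_iff, Option.map_eq_some_iff, ih]
    cases m with
    | nil => simp
    | cons b m => simp

/-- Inverting a signature map on the arguments of a symbol involves a tuple of options of dependent
length; on lists the same operation is a computable fold. -/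
theorem sequenceList_ofFn {σ : Type} {n : ℕ} (f : Fin n → Option σ) :
    sequenceList (List.ofFn f) = (sequenceFin f).map List.ofFn := by
  ext m
  simp only [Option.map_eq_some_iff, sequenceFin_eq_some, sequenceList_eq_some]
  constructor
  · intro h
    have hlen : m.length = n := by simpa using (congrArg List.length h).symm
    subst hlen
    refine ⟨m.get, fun j => ?_, List.ofFn_get m⟩
    have hj : (List.ofFn f)[(j : ℕ)]? = (m.map some)[(j : ℕ)]? := by rw [h]
    simpa using hj
  · rintro ⟨a, ha, rfl⟩
    rw [List.map_ofFn]
    exact congrArg _ (funext ha)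

theorem computable_sequenceList {σ : Type} [Primcodable σ] {l : α → List (Option σ)}
    (hl : Computable l) : Computable fun a => sequenceList (l a) := by
  refine computable_foldr (h := fun (_ : α) (x : Option σ × Option (List σ)) =>
    x.1.bind fun b => x.2.map (b :: ·)) hl (Computable.const _) ?_
  refine Computable.option_bind (f := fun y : α × (Option σ × Option (List σ)) => y.2.1)
    (g := fun y b => y.2.2.map (b :: ·)) (Computable.fst.comp .snd) ?_
  exact Computable.option_map (f := fun y : (α × (Option σ × Option (List σ))) × σ => y.1.2.2)
    (g := fun y l => y.2 :: l) (Computable.snd.comp (Computable.snd.comp .fst))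
    (Computable.list_cons.comp (Computable.snd.comp .fst) .snd)

variable (hL : EffectiveArities L) (hL' : EffectiveArities L') {g : L →ᴸ L'}

section Lift

variable (hg : ComputableLHom g)
include hL hL' hg

theorem computable_onTerm {t : α → L.Term ℕ} (ht : Computable t) :
    Computable fun a => g.onTerm (t a) := by
  have h₁ : Computable₂ fun (_ : Unit) (y : (Σ n, L.Functions n) × List (L'.Term ℕ)) =>
      mkFunc ⟨y.1.1, g.onFunction y.1.2⟩ y.2 :=
    computable_mkFunc hL' (hg.1.comp (Computable.fst.comp .snd)) (Computable.snd.comp .snd)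
  exact (computable_termRec hL (F := fun (_ : Unit) (t : L.Term ℕ) => g.onTerm t)
    (h₀ := fun _ c => Term.var c) (computable_var hL' .snd) h₁ (fun _ _ => rfl)
    fun _ _ _ _ => by rw [mkFunc_ofFn]; rfl).comp (Computable.const ()) ht

theorem computable_lift {φ : α → QF L} (hφ : Computable φ) :
    Computable fun a => (φ a).lift g := by
  have h₁ : Computable₂ fun (_ : Unit) (y : L.Term ℕ × L.Term ℕ) =>
      QF.equal (g.onTerm y.1) (g.onTerm y.2) :=
    computable_equal hL' (computable_onTerm hL hL' hg (Computable.fst.comp .snd))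
      (computable_onTerm hL hL' hg (Computable.snd.comp .snd))
  have h₂ : Computable₂ fun (_ : Unit) (y : (Σ n, L.Relations n) × List (L.Term ℕ)) =>
      mkRel ⟨y.1.1, g.onRelation y.1.2⟩ (y.2.map g.onTerm) :=
    computable_mkRel hL' (hg.2.comp (Computable.fst.comp .snd)) (computable_map
      (g := fun (_ : Unit × ((Σ n, L.Relations n) × List (L.Term ℕ))) (t : L.Term ℕ) =>
        g.onTerm t) (Computable.snd.comp .snd) (computable_onTerm hL hL' hg .snd))
  have h₃ : Computable₂ fun (_ : Unit) (y : QF L' × QF L') => y.1.imp y.2 :=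
    computable_imp hL' (Computable.fst.comp .snd) (Computable.snd.comp .snd)
  exact (computable_formulaRec hL (F := fun (_ : Unit) (φ : QF L) => φ.lift g)
    (Computable.const .falsum) h₁ h₂ h₃ (fun _ => rfl) (fun _ _ _ => rfl)
    (fun a n R ts => by rw [List.map_ofFn, mkRel_ofFn]; rfl) fun _ _ _ => rfl).comp
    (Computable.const ()) hφ

end Lift

section Unlift

variable {i : LHomInverse g} (hi : i.IsComputable)
include hL hL' hi

theorem computable_unliftTerm {t : α → L'.Term ℕ} (ht : Computable t) :
    Computable fun a => unliftTerm i (t a) := by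
  have h₁ : Computable₂ fun (_ : Unit) (y : (Σ n, L'.Functions n) × List (Option (L.Term ℕ))) =>
      ((i.func y.1.2).map (Sigma.mk y.1.1) : Option (Σ n, L.Functions n)).bind fun f =>
        (sequenceList y.2).map (mkFunc f) := by
    refine Computable.option_bind
      (f := fun y : Unit × ((Σ n, L'.Functions n) × List (Option (L.Term ℕ))) =>
        ((i.func y.2.1.2).map (Sigma.mk y.2.1.1) : Option (Σ n, L.Functions n)))
      (g := fun y f => (sequenceList y.2.2).map (mkFunc f))
      (hi.1.comp (Computable.fst.comp .snd)) ?_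
    exact Computable.option_map (f := fun y : (Unit × ((Σ n, L'.Functions n) ×
        List (Option (L.Term ℕ)))) × (Σ n, L.Functions n) => sequenceList y.1.2.2)
      (g := fun y ts => mkFunc y.2 ts)
      (computable_sequenceList (Computable.snd.comp (Computable.snd.comp .fst)))
      (computable_mkFunc hL (Computable.snd.comp .fst) .snd)
  exact (computable_termRec hL' (F := fun (_ : Unit) (t : L'.Term ℕ) => unliftTerm i t)
    (h₀ := fun _ c => some (Term.var c)) (Computable.option_some.comp (computable_var hL .snd)) h₁
    (fun _ _ => rfl) fun _ n F ts => by
      rw [sequenceList_ofFn]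
      simp only [unliftTerm, Option.bind_map, Option.map_map, Function.comp_def, mkFunc_ofFn]).comp
    (Computable.const ()) ht

theorem computable_unlift {φ : α → QF L'} (hφ : Computable φ) :
    Computable fun a => (φ a).unlift i := by
  have h₁ : Computable₂ fun (_ : Unit) (y : L'.Term ℕ × L'.Term ℕ) =>
      (unliftTerm i y.1).bind fun t => (unliftTerm i y.2).map (QF.equal t) := by
    refine Computable.option_bind (f := fun y : Unit × (L'.Term ℕ × L'.Term ℕ) =>
      unliftTerm i y.2.1) (g := fun y t => (unliftTerm i y.2.2).map (QF.equal t))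
      (computable_unliftTerm hL hL' hi (Computable.fst.comp .snd)) ?_
    exact Computable.option_map (f := fun y : (Unit × (L'.Term ℕ × L'.Term ℕ)) × L.Term ℕ =>
      unliftTerm i y.1.2.2) (g := fun y u => QF.equal y.2 u)
      (computable_unliftTerm hL hL' hi (Computable.snd.comp (Computable.snd.comp .fst)))
      (computable_equal hL (Computable.snd.comp .fst) .snd)
  have h₂ : Computable₂ fun (_ : Unit) (y : (Σ n, L'.Relations n) × List (L'.Term ℕ)) =>
      ((i.rel y.1.2).map (Sigma.mk y.1.1) : Option (Σ n, L.Relations n)).bind fun R =>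
        (sequenceList (y.2.map (unliftTerm i))).map (mkRel R) := by
    have hs : Computable fun y : Unit × ((Σ n, L'.Relations n) × List (L'.Term ℕ)) =>
        sequenceList (y.2.2.map (unliftTerm i)) :=
      computable_sequenceList (computable_map
        (g := fun (_ : Unit × ((Σ n, L'.Relations n) × List (L'.Term ℕ))) (t : L'.Term ℕ) =>
          unliftTerm i t) (Computable.snd.comp .snd) (computable_unliftTerm hL hL' hi .snd))
    refine Computable.option_bind
      (f := fun y : Unit × ((Σ n, L'.Relations n) × List (L'.Term ℕ)) =>
        ((i.rel y.2.1.2).map (Sigma.mk y.2.1.1) : Option (Σ n, L.Relations n)))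
      (g := fun y R => (sequenceList (y.2.2.map (unliftTerm i))).map (mkRel R))
      (hi.2.comp (Computable.fst.comp .snd)) ?_
    exact Computable.option_map (f := fun y : (Unit × ((Σ n, L'.Relations n) ×
        List (L'.Term ℕ))) × (Σ n, L.Relations n) => sequenceList (y.1.2.2.map (unliftTerm i)))
      (g := fun y ts => mkRel y.2 ts) (hs.comp .fst)
      (computable_mkRel hL (Computable.snd.comp .fst) .snd)
  have h₃ : Computable₂ fun (_ : Unit) (y : Option (QF L) × Option (QF L)) =>
      y.1.bind fun φ => y.2.map (QF.imp φ) := by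
    refine Computable.option_bind (f := fun y : Unit × (Option (QF L) × Option (QF L)) => y.2.1)
      (g := fun y φ => y.2.2.map (QF.imp φ)) (Computable.fst.comp .snd) ?_
    exact Computable.option_map
      (f := fun y : (Unit × (Option (QF L) × Option (QF L))) × QF L => y.1.2.2)
      (g := fun y ψ => QF.imp y.2 ψ) (Computable.snd.comp (Computable.snd.comp .fst))
      (computable_imp hL (Computable.snd.comp .fst) .snd)
  exact (computable_formulaRec hL' (F := fun (_ : Unit) (φ : QF L') => φ.unlift i)
    (Computable.const (some .falsum)) h₁ h₂ h₃ (fun _ => rfl) (fun _ _ _ => rfl)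
    (fun a n R ts => by
      rw [List.map_ofFn, sequenceList_ofFn]
      simp only [QF.unlift, Option.bind_map, Option.map_map, Function.comp_def, mkRel_ofFn])
    fun _ _ _ => rfl).comp (Computable.const ()) hφ

theorem computable_partList {A : α → List (QF L')} (hA : Computable A) :
    Computable fun a => partList i (A a) := by
  classical
  refine (computable_filter (r := fun x : α × QF L => x.2.IsLiteral)
    (computable_filterMap (g := fun (_ : α) (φ : QF L') => φ.unlift i) hA
      (computable_unlift hL hL' hi .snd)) (computablePred_isLiteral hL .snd)).of_eq fun a => ?_
  unfold partList
  congr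

end Unlift

end MapComputability

/-! ### Computability of the rules -/

section PairComputability

variable {L : FirstOrder.Language.{0, 0}} [Primcodable (Σ n, L.Functions n)]
  [Primcodable (Σ n, L.Relations n)] {α : Type} [Primcodable α]

/-- Pairs of finite sets of formulae as elements of a product. -/
def pairEquiv (L : FirstOrder.Language.{0, 0}) : Pair L ≃ List (QF L) × List (QF L) where
  toFun P := (P.A, P.B)
  invFun p := ⟨p.1, p.2⟩

noncomputable instance : Primcodable (Pair L) := Primcodable.ofEquiv _ (pairEquiv L)

theorem computable_pairA {P : α → Pair L} (hP : Computable P) : Computable fun a => (P a).A :=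
  (Computable.fst.comp (Primrec.of_equiv (e := pairEquiv L)).to_comp).comp hP

theorem computable_pairB {P : α → Pair L} (hP : Computable P) : Computable fun a => (P a).B :=
  (Computable.snd.comp (Primrec.of_equiv (e := pairEquiv L)).to_comp).comp hP

theorem computable_pairMk {A B : α → List (QF L)} (hA : Computable A) (hB : Computable B) :
    Computable fun a => (⟨A a, B a⟩ : Pair L) :=
  (Primrec.of_equiv_symm (e := pairEquiv L)).to_comp.comp (hA.pair hB)

theorem computable_swap {P : α → Pair L} (hP : Computable P) : Computable fun a => (P a).swap :=
  computable_pairMk (computable_pairB hP) (computable_pairA hP)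

theorem computablePred_isOpen {P : α → Pair L} (hP : Computable P) :
    ComputablePred fun a => (P a).IsOpen :=
  (ComputablePred.mem (Computable.const _) (computable_pairA hP)).not.and
    (ComputablePred.mem (Computable.const _) (computable_pairB hP)).not

variable (hL : EffectiveArities L)
include hL

theorem computable_strictList {P : α → Pair L} (hP : Computable P) :
    Computable fun a => (P a).strictList := by
  refine computable_dedup ?_
  exact computable_filter (r := fun x : α × ℕ => x.2 ∉ constListOf (P x.1).B)
    (computable_constListOf hL (computable_pairA hP))
    (ComputablePred.mem .snd ((computable_constListOf hL (computable_pairB hP)).comp .fst)).not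

theorem computable_shareTerm {P : α → Pair L} {x c : α → ℕ} {t : α → L.Term ℕ}
    (hP : Computable P) (hx : Computable x) (ht : Computable t) (hc : Computable c) :
    Computable fun a => (P a).shareTerm (x a) (t a) (c a) := by
  have he : Computable fun a => (QF.equal (Term.var (c a)) (t a) : QF L) :=
    computable_equal hL (computable_var hL hc) ht
  refine computable_pairMk (Computable.list_cons.comp he (computable_map
    (g := fun (a : α) (φ : QF L) => φ.subst (x a) (Term.var (c a))) (computable_pairA hP) ?_))
    (Computable.list_cons.comp he (computable_pairB hP))
  exact computable_subst hL (hx.comp .fst) (computable_var hL (hc.comp .fst)) .snd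

theorem computablePred_common {P : α → Pair L} {l : α → List ℕ} (hP : Computable P)
    (hl : Computable l) : ComputablePred fun a => (l a).toFinset ⊆ (P a).common := by
  refine (ComputablePred.ball (r := fun x : α × ℕ =>
    x.2 ∈ constListOf (P x.1).A ∧ x.2 ∈ constListOf (P x.1).B) hl
    ((ComputablePred.mem .snd ((computable_constListOf hL (computable_pairA hP)).comp .fst)).and
    (ComputablePred.mem .snd
      ((computable_constListOf hL (computable_pairB hP)).comp .fst)))).of_eq fun a => ?_
  simp [Finset.subset_iff, Pair.common, mem_constListOf]

theorem computablePred_fresh {P : α → Pair L} {c : α → ℕ} (hP : Computable P)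
    (hc : Computable c) : ComputablePred fun a => (P a).Fresh (c a) :=
  ((ComputablePred.mem hc (computable_constListOf hL (computable_pairA hP))).or
    (ComputablePred.mem hc (computable_constListOf hL (computable_pairB hP)))).not.of_eq fun a => by
      simp [Pair.Fresh, mem_constListOf]

omit [Primcodable (Σ n, L.Functions n)] [Primcodable (Σ n, L.Relations n)] hL in
-- Decidability of the SMT problem concerns single formulae; finite sets are reduced to their
-- conjunctions.
theorem sat_bigAnd {T : L.Theory} {A : List (QF L)} :
    Sat T {QF.bigAnd A} ↔ Sat T {φ | φ ∈ A} := by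
  simp [Sat]

omit [Primcodable (Σ n, L.Functions n)] [Primcodable (Σ n, L.Relations n)] hL in
theorem entails_iff {T : L.Theory} {S : Set (QF L)} {φ : QF L} :
    Entails T S φ ↔ ¬ Sat T (S ∪ {φ.neg}) := by
  constructor
  · rintro h ⟨M, _, hne, hM, v, hv⟩
    exact hv _ (Or.inr rfl) (h M _ hne hM v fun ψ hψ => hv ψ (Or.inl hψ))
  · intro h M _ hne hM v hv
    by_contra hφ
    refine h ⟨M, _, hne, hM, v, ?_⟩
    rintro ψ (hψ | hψ)
    · exact hv ψ hψ
    · rw [Set.mem_singleton_iff.1 hψ]; exact hφ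

theorem computablePred_sat {T : L.Theory} (hT : DecidableSMT T) {A : α → List (QF L)}
    (hA : Computable A) : ComputablePred fun a => Sat T {φ | φ ∈ A a} := by
  obtain ⟨d, hd, h⟩ := hT
  exact computablePred_of_bool
    (hd.comp ((computable_qfCode hL).comp (computable_bigAnd hL hA))) fun a => by
      rw [h, sat_bigAnd]

end PairComputability

section RuleComputability

variable {L L' : FirstOrder.Language.{0, 0}} [Primcodable (Σ n, L.Functions n)]
  [Primcodable (Σ n, L.Relations n)] [Primcodable (Σ n, L'.Functions n)]
  [Primcodable (Σ n, L'.Relations n)] {α : Type} [Primcodable α]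
  (hL : EffectiveArities L) (hL' : EffectiveArities L') {g : L →ᴸ L'} {T : L.Theory}
  {i : LHomInverse g} (hi : i.IsComputable) (hg : ComputableLHom g) (hT : DecidableSMT T)
include hL hL'

section
include hi hT

/-- The component literals form a computable list, so these sets are finite and computable from `a`.
The semantic side conditions of Share and Terminate reduce to queries of this kind. -/
theorem computablePred_sat_parts {A B : α → List (QF L')} {C : α → List (QF L)}
    (hA : Computable A) (hB : Computable B) (hC : Computable C) :
    ComputablePred fun a => Sat T (part g (A a) ∪ part g (B a) ∪ {φ | φ ∈ C a}) := by
  refine (computablePred_sat hL hT (A := fun a => partList i (A a) ++ partList i (B a) ++ C a)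
    (Computable.list_append.comp (Computable.list_append.comp
      (computable_partList hL hL' hi hA) (computable_partList hL hL' hi hB)) hC)).of_eq fun a => ?_
  have h : {φ | φ ∈ partList i (A a) ++ partList i (B a) ++ C a} =
      part g (A a) ∪ part g (B a) ∪ {φ | φ ∈ C a} := by
    ext φ; simp [mem_partList, or_assoc]
  rw [h]

theorem computablePred_sat_part {A : α → List (QF L')} {C : α → List (QF L)}
    (hA : Computable A) (hC : Computable C) :
    ComputablePred fun a => Sat T (part g (A a) ∪ {φ | φ ∈ C a}) :=
  (computablePred_sat_parts hL hL' hi hT hA hA hC).of_eq fun a => by rw [Set.union_self]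

theorem computablePred_separated {P : α → Pair L'} (hP : Computable P) :
    ComputablePred fun a => Separated g T (P a) := by
  refine (computablePred_sat_parts hL hL' hi hT
    (C := fun a => [(meet (vars (P a).strictList) (vars (P a).swap.strictList)).neg])
    (computable_pairA hP) (computable_pairB hP)
    (Computable.list_cons.comp (computable_neg hL (computable_meet hL
      (computable_vars hL (computable_strictList hL' hP))
      (computable_vars hL (computable_strictList hL' (computable_swap hP)))))
      (Computable.const []))).of_eq fun a => ?_
  simp only [List.mem_singleton, Separated]
  rfl

theorem computablePred_terminateData {P : α → Pair L'} {θ : α → QF L} (hP : Computable P)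
    (hθ : Computable θ) : ComputablePred fun a => TerminateData g T (P a) (θ a) := by
  have hA := computable_pairA hP
  have hB := computable_pairB hP
  have h₁ := computablePred_sat_parts hL hL' hi hT hA hB (Computable.const [])
  have h₂ := computablePred_common hL' hP (computable_constList hL hθ)
  have h₃ := computablePred_sat_part hL hL' hi hT hA
    (Computable.list_cons.comp (computable_neg hL hθ) (Computable.const []))
  have h₄ := computablePred_sat_part hL hL' hi hT hB
    (Computable.list_cons.comp hθ (Computable.const []))
  refine ((computablePred_isOpen hP).and (h₁.not.and (h₂.and (h₃.not.and h₄.not)))).of_eq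
    fun a => ?_
  have hc : (θ a).constList.toFinset = (θ a).consts := by ext x; simp [QF.mem_constList]
  simp only [TerminateData, entails_iff, hc, List.mem_singleton, List.not_mem_nil,
    Set.ofPred_false, Set.union_empty]
  rfl

/-- For given `vs`, `θ` and `c` every condition is a membership test or a satisfiability query,
entailment being unsatisfiability with the negated conclusion. Only finding these data requires a
search. -/
theorem computablePred_shareData {P : α → Pair L'} {vs : α → List (L.Term ℕ)} {θ : α → QF L}
    {c : α → ℕ} (hP : Computable P) (hvs : Computable vs) (hθ : Computable θ) (hc : Computable c) :
    ComputablePred fun a =>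
      ShareData g T (P a) (P a).strictList (P a).swap.strictList (vs a) (θ a) (c a) := by
  have hA := computable_pairA hP
  have hB := computable_pairB hP
  have has := computable_strictList hL' hP
  have hbs := computable_strictList hL' (computable_swap hP)
  have single {φ : α → QF L} (hφ : Computable φ) : Computable fun a => [φ a] :=
    Computable.list_cons.comp hφ (Computable.const [])
  have ma := computable_neg hL (computable_meet hL (computable_vars hL has) hvs)
  have mb := computable_neg hL (computable_meet hL (computable_vars hL hbs) hvs)
  have mab := computable_neg hL (computable_meet hL
    (computable_vars hL (Computable.list_append.comp has hbs)) hvs)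
  have h₁ := computablePred_sat_parts hL hL' hi hT hA hB (Computable.const [])
  have h₂ := computablePred_separated hL hL' hi hT hP
  have h₃ : ComputablePred fun a => ∀ t ∈ vs a, (termConsts t).toFinset ⊆ (P a).common :=
    ComputablePred.ball (r := fun x : α × L.Term ℕ =>
      (termConsts x.2).toFinset ⊆ (P x.1).common) hvs
      (computablePred_common hL' (hP.comp .fst) (computable_termConsts hL .snd))
  have h₄ := computablePred_sat_parts hL hL' hi hT hA hB (single mab)
  have h₅ := computablePred_common hL' hP (computable_constList hL hθ)
  have h₆ := computablePred_sat_part hL hL' hi hT hA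
    (Computable.list_append.comp (single ma) (single (computable_neg hL hθ)))
  have h₇ := computablePred_sat_part hL hL' hi hT hB
    (Computable.list_append.comp (single mb) (single hθ))
  have h₈ := computablePred_fresh hL' hP hc
  refine ((computablePred_isOpen hP).and (h₁.and (h₂.not.and (h₃.and (h₄.not.and (h₅.and
    (h₆.not.and (h₇.not.and h₈)))))))).of_eq fun a => ?_
  have e₁ : (θ a).constList.toFinset = (θ a).consts := by ext x; simp [QF.mem_constList]
  have e₂ (t : L.Term ℕ) : (termConsts t).toFinset = t.varFinset := by ext x; simp [mem_termConsts]
  have e₃ (S : Set (QF L)) (φ ψ : QF L) :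
      S ∪ {χ | χ ∈ [φ] ++ [ψ]} = S ∪ {φ} ∪ {ψ} := by
    ext χ
    simp only [List.mem_append, List.mem_singleton, Set.mem_union, Set.mem_ofPred_eq,
      Set.mem_singleton_iff, or_assoc]
  have e₄ (S : Set (QF L)) (φ : QF L) : S ∪ {χ | χ ∈ [φ]} = S ∪ {φ} := by ext χ; simp
  have e₅ (S : Set (QF L)) : S ∪ {χ : QF L | χ ∈ ([] : List (QF L))} = S := by ext χ; simp
  simp only [e₁, e₂, e₃, e₄, e₅, Separated]
  constructor
  · rintro ⟨k₁, k₂, k₃, k₄, k₅, k₆, k₇, k₈, k₉⟩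
    exact ⟨k₁, Pair.nodup_strictList _, fun _ => Pair.mem_strictList, Pair.nodup_strictList _,
      fun _ => Pair.mem_strictList, k₂, k₃, k₄, k₅, k₆, entails_iff.2 k₇, k₈, k₉⟩
  · intro h
    exact ⟨h.isOpen, h.sat, h.unsat, h.vs_common, h.vs_unsat, h.θ_common, entails_iff.1 h.entails,
      h.refutes, h.fresh⟩

end

section
include hg

theorem computable_shareOutcomes {P : α → Pair L'} {as bs : α → List ℕ}
    {vs : α → List (L.Term ℕ)} {θ : α → QF L} {c : α → ℕ} (hP : Computable P)
    (has : Computable as) (hbs : Computable bs) (hvs : Computable vs) (hθ : Computable θ)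
    (hc : Computable c) :
    Computable fun a => shareOutcomes g (P a) (as a) (bs a) (vs a) (θ a) (c a) := by
  have hx : Computable fun y : α × (ℕ × L.Term ℕ) => y.2.1 := Computable.fst.comp .snd
  have ht : Computable fun y : α × (ℕ × L.Term ℕ) => g.onTerm y.2.2 :=
    computable_onTerm hL hL' hg (Computable.snd.comp .snd)
  have hl := computable_lift hL hL' hg hθ
  have hQ : Computable fun a => (⟨(θ a).lift g :: (P a).B, (θ a).lift g :: (P a).A⟩ : Pair L') :=
    computable_pairMk (Computable.list_cons.comp hl (computable_pairB hP))
      (Computable.list_cons.comp hl (computable_pairA hP))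
  have h₁ : Computable₂ fun (a : α) (p : ℕ × L.Term ℕ) =>
      (P a).shareTerm p.1 (g.onTerm p.2) (c a) :=
    computable_shareTerm hL' (hP.comp .fst) hx ht (hc.comp .fst)
  have h₂ : Computable₂ fun (a : α) (p : ℕ × L.Term ℕ) =>
      (Pair.shareTerm ⟨(θ a).lift g :: (P a).B, (θ a).lift g :: (P a).A⟩ p.1
        (g.onTerm p.2) (c a)).swap :=
    computable_swap (computable_shareTerm hL' (hQ.comp .fst) hx ht (hc.comp .fst))
  exact Computable.list_append.comp
    (computable_map (g := fun (a : α) (p : ℕ × L.Term ℕ) =>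
      (P a).shareTerm p.1 (g.onTerm p.2) (c a)) (computable_product has hvs) h₁)
    (computable_map (g := fun (a : α) (p : ℕ × L.Term ℕ) =>
      (Pair.shareTerm ⟨(θ a).lift g :: (P a).B, (θ a).lift g :: (P a).A⟩ p.1
        (g.onTerm p.2) (c a)).swap) (computable_product hbs hvs) h₂)

theorem computable_shareInterpolant {as bs : α → List ℕ}
    {vs : α → List (L.Term ℕ)} {θ : α → QF L} {c : α → ℕ} {ιs : α → List (QF L')}
    (has : Computable as) (hbs : Computable bs) (hvs : Computable vs) (hθ : Computable θ)
    (hc : Computable c) (hιs : Computable ιs) :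
    Computable fun a => shareInterpolant g (as a) (bs a) (vs a) (θ a) (c a) (ιs a) := by
  have hz : Computable₂ fun (a : α) (x : (ℕ × L.Term ℕ) × QF L') =>
      QF.subst (c a) (g.onTerm x.1.2) x.2 :=
    computable_subst hL' (hc.comp .fst) (computable_onTerm hL hL' hg
      (Computable.snd.comp (Computable.fst.comp .snd))) (Computable.snd.comp .snd)
  have hd : Computable fun a => (ιs a).drop ((as a).product (vs a)).length :=
    computable_drop hιs (Computable.list_length.comp (computable_product has hvs))
  exact computable_or hL' (computable_bigOr hL' (computable_zipWith
      (h := fun (a : α) (x : (ℕ × L.Term ℕ) × QF L') => QF.subst (c a) (g.onTerm x.1.2) x.2)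
      (computable_product has hvs) hιs hz))
    (computable_and hL' (computable_lift hL hL' hg hθ) (computable_bigAnd hL' (computable_zipWith
      (h := fun (a : α) (x : (ℕ × L.Term ℕ) × QF L') => QF.subst (c a) (g.onTerm x.1.2) x.2)
      (computable_product hbs hvs) hd hz)))

end

include hi hg hT

/-- The data of the rule are searched for and then checked. The instruction, a function on lists of
formulae, has no code, which is why only its value `ι` at `ιs` appears in the relation. -/
theorem semidecidable_theoryStep {P : α → Pair L'} {outcomes : α → List (Pair L')}
    {ιs : α → List (QF L')} {ι : α → QF L'} (hP : Computable P) (ho : Computable outcomes)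
    (hιs : Computable ιs) (hι : Computable ι) :
    Semidecidable fun a => TheoryStep g T (P a) (outcomes a) (ιs a) (ι a) := by
  refine Semidecidable.or ?_ ?_
  · refine Semidecidable.exists (r := fun x : α × QF L => TerminateData g T (P x.1) x.2 ∧
      outcomes x.1 = [⟨x.2.lift g :: (P x.1).A, QF.falsum :: x.2.lift g :: (P x.1).B⟩] ∧
      ι x.1 = QF.and (x.2.lift g) (QF.bigAnd (ιs x.1))) (ComputablePred.semidecidable ?_)
    have hl : Computable fun x : α × QF L => x.2.lift g := computable_lift hL hL' hg .snd
    have hA : Computable fun x : α × QF L => (P x.1).A := computable_pairA (hP.comp .fst)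
    have hB : Computable fun x : α × QF L => (P x.1).B := computable_pairB (hP.comp .fst)
    have hQ : Computable fun x : α × QF L =>
        (⟨x.2.lift g :: (P x.1).A, QF.falsum :: x.2.lift g :: (P x.1).B⟩ : Pair L') :=
      computable_pairMk (Computable.list_cons.comp hl hA)
        (Computable.list_cons.comp (Computable.const _) (Computable.list_cons.comp hl hB))
    exact (computablePred_terminateData hL hL' hi hT (hP.comp .fst) .snd).and
      ((ComputablePred.eq (ho.comp .fst) (Computable.list_cons.comp hQ (Computable.const []))).and
        (ComputablePred.eq (hι.comp .fst) (computable_and hL' hl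
          (computable_bigAnd hL' (hιs.comp .fst)))))
  · refine (Semidecidable.exists (r := fun x : α × (List (L.Term ℕ) × QF L × ℕ) =>
      ShareData g T (P x.1) (P x.1).strictList (P x.1).swap.strictList x.2.1 x.2.2.1 x.2.2.2 ∧
      outcomes x.1 = shareOutcomes g (P x.1) (P x.1).strictList (P x.1).swap.strictList
        x.2.1 x.2.2.1 x.2.2.2 ∧
      ι x.1 = shareInterpolant g (P x.1).strictList (P x.1).swap.strictList
        x.2.1 x.2.2.1 x.2.2.2 (ιs x.1)) (ComputablePred.semidecidable ?_)).of_eq fun a => ?_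
    · have hP' : Computable fun x : α × (List (L.Term ℕ) × QF L × ℕ) => P x.1 := hP.comp .fst
      have hvs : Computable fun x : α × (List (L.Term ℕ) × QF L × ℕ) => x.2.1 :=
        Computable.fst.comp .snd
      have hθ : Computable fun x : α × (List (L.Term ℕ) × QF L × ℕ) => x.2.2.1 :=
        Computable.fst.comp (Computable.snd.comp .snd)
      have hc : Computable fun x : α × (List (L.Term ℕ) × QF L × ℕ) => x.2.2.2 :=
        Computable.snd.comp (Computable.snd.comp .snd)
      have has := computable_strictList hL' hP'
      have hbs := computable_strictList hL' (computable_swap hP')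
      exact (computablePred_shareData hL hL' hi hT hP' hvs hθ hc).and
        ((ComputablePred.eq (ho.comp .fst)
          (computable_shareOutcomes hL hL' hg hP' has hbs hvs hθ hc)).and
        (ComputablePred.eq (hι.comp .fst)
          (computable_shareInterpolant hL hL' hg has hbs hvs hθ hc (hιs.comp .fst))))
    · simp only [Prod.exists]

end RuleComputability

end CombInterp

namespace CombInterp

open FirstOrder.Language (Term)

/-! ### The union of two effective signatures -/

section SumSignature

variable (L₁ L₂ : FirstOrder.Language.{0, 0})
  [Primcodable (Σ n, L₁.Functions n)] [Primcodable (Σ n, L₁.Relations n)]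
  [Primcodable (Σ n, L₂.Functions n)] [Primcodable (Σ n, L₂.Relations n)]

/-- The function symbols of the union of two signatures. -/
def sumFunctionsEquiv :
    (Σ n, (L₁.sum L₂).Functions n) ≃ (Σ n, L₁.Functions n) ⊕ (Σ n, L₂.Functions n) :=
  Equiv.sigmaSumDistrib L₁.Functions L₂.Functions

/-- The relation symbols of the union of two signatures. -/
def sumRelationsEquiv :
    (Σ n, (L₁.sum L₂).Relations n) ≃ (Σ n, L₁.Relations n) ⊕ (Σ n, L₂.Relations n) :=
  Equiv.sigmaSumDistrib L₁.Relations L₂.Relations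

-- The equivalence is the one behind `sumFunctionsEncodable`, so that the symbols of the union have
-- the same codes here as in the Gödel numbers of the theorem.
@[reducible] def sumFunctionsPrimcodable : Primcodable (Σ n, (L₁.sum L₂).Functions n) :=
  Primcodable.ofEquiv ((Σ n, L₁.Functions n) ⊕ (Σ n, L₂.Functions n)) (sumFunctionsEquiv L₁ L₂)

@[reducible] def sumRelationsPrimcodable : Primcodable (Σ n, (L₁.sum L₂).Relations n) :=
  Primcodable.ofEquiv ((Σ n, L₁.Relations n) ⊕ (Σ n, L₂.Relations n)) (sumRelationsEquiv L₁ L₂)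

variable {L₁ L₂}

theorem effectiveArities_sum (hL₁ : EffectiveArities L₁) (hL₂ : EffectiveArities L₂) :
    @EffectiveArities (L₁.sum L₂) (sumFunctionsPrimcodable L₁ L₂)
      (sumRelationsPrimcodable L₁ L₂) := by
  let _ := sumFunctionsPrimcodable L₁ L₂
  let _ := sumRelationsPrimcodable L₁ L₂
  constructor
  · have he : Computable (sumFunctionsEquiv L₁ L₂) :=
      (Primrec.of_equiv (e := sumFunctionsEquiv L₁ L₂)).to_comp
    refine (Computable.sumCasesOn (g := fun _ (f : Σ n, L₁.Functions n) => f.1)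
      (h := fun _ (f : Σ n, L₂.Functions n) => f.1) he (hL₁.1.comp .snd)
      (hL₂.1.comp .snd)).of_eq fun f => ?_
    obtain ⟨n, f | f⟩ := f <;> rfl
  · have he : Computable (sumRelationsEquiv L₁ L₂) :=
      (Primrec.of_equiv (e := sumRelationsEquiv L₁ L₂)).to_comp
    refine (Computable.sumCasesOn (g := fun _ (f : Σ n, L₁.Relations n) => f.1)
      (h := fun _ (f : Σ n, L₂.Relations n) => f.1) he (hL₁.2.comp .snd)
      (hL₂.2.comp .snd)).of_eq fun f => ?_
    obtain ⟨n, f | f⟩ := f <;> rfl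

theorem computableLHom_sumInl :
    letI := sumFunctionsPrimcodable L₁ L₂
    letI := sumRelationsPrimcodable L₁ L₂
    ComputableLHom (FirstOrder.Language.LHom.sumInl : L₁ →ᴸ L₁.sum L₂) := by
  let _ := sumFunctionsPrimcodable L₁ L₂
  let _ := sumRelationsPrimcodable L₁ L₂
  exact ⟨(Primrec.of_equiv_symm
      (e := sumFunctionsEquiv L₁ L₂)).to_comp.comp Primrec.sumInl.to_comp,
    (Primrec.of_equiv_symm
      (e := sumRelationsEquiv L₁ L₂)).to_comp.comp Primrec.sumInl.to_comp⟩

theorem computableLHom_sumInr :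
    letI := sumFunctionsPrimcodable L₁ L₂
    letI := sumRelationsPrimcodable L₁ L₂
    ComputableLHom (FirstOrder.Language.LHom.sumInr : L₂ →ᴸ L₁.sum L₂) := by
  let _ := sumFunctionsPrimcodable L₁ L₂
  let _ := sumRelationsPrimcodable L₁ L₂
  exact ⟨(Primrec.of_equiv_symm
      (e := sumFunctionsEquiv L₁ L₂)).to_comp.comp Primrec.sumInr.to_comp,
    (Primrec.of_equiv_symm
      (e := sumRelationsEquiv L₁ L₂)).to_comp.comp Primrec.sumInr.to_comp⟩

theorem computable_getLeft? {α β : Type} [Primcodable α] [Primcodable β] :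
    Computable (Sum.getLeft? : α ⊕ β → Option α) :=
  (Computable.sumCasesOn (g := fun _ a => some a) (h := fun _ _ => none) Computable.id
    (Computable.option_some.comp .snd) (Computable.const none)).of_eq fun x => by cases x <;> rfl

theorem computable_getRight? {α β : Type} [Primcodable α] [Primcodable β] :
    Computable (Sum.getRight? : α ⊕ β → Option β) :=
  (Computable.sumCasesOn (g := fun _ _ => none) (h := fun _ b => some b) Computable.id
    (Computable.const none) (Computable.option_some.comp .snd)).of_eq fun x => by cases x <;> rfl

theorem isComputable_inverseInl :
    letI := sumFunctionsPrimcodable L₁ L₂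
    letI := sumRelationsPrimcodable L₁ L₂
    (inverseInl : LHomInverse (FirstOrder.Language.LHom.sumInl : L₁ →ᴸ L₁.sum L₂)).IsComputable := by
  let _ := sumFunctionsPrimcodable L₁ L₂
  let _ := sumRelationsPrimcodable L₁ L₂
  constructor
  · refine (computable_getLeft?.comp (Primrec.of_equiv
      (e := sumFunctionsEquiv L₁ L₂)).to_comp).of_eq fun f => ?_
    obtain ⟨n, f | f⟩ := f <;> rfl
  · refine (computable_getLeft?.comp (Primrec.of_equiv
      (e := sumRelationsEquiv L₁ L₂)).to_comp).of_eq fun f => ?_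
    obtain ⟨n, f | f⟩ := f <;> rfl

theorem isComputable_inverseInr :
    letI := sumFunctionsPrimcodable L₁ L₂
    letI := sumRelationsPrimcodable L₁ L₂
    (inverseInr : LHomInverse (FirstOrder.Language.LHom.sumInr : L₂ →ᴸ L₁.sum L₂)).IsComputable := by
  let _ := sumFunctionsPrimcodable L₁ L₂
  let _ := sumRelationsPrimcodable L₁ L₂
  constructor
  · refine (computable_getRight?.comp (Primrec.of_equiv
      (e := sumFunctionsEquiv L₁ L₂)).to_comp).of_eq fun f => ?_
    obtain ⟨n, f | f⟩ := f <;> rfl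
  · refine (computable_getRight?.comp (Primrec.of_equiv
      (e := sumRelationsEquiv L₁ L₂)).to_comp).of_eq fun f => ?_
    obtain ⟨n, f | f⟩ := f <;> rfl

end SumSignature

/-! ### Runs of the procedure as derivations -/

section Search

variable {L₁ L₂ : FirstOrder.Language.{0, 0}} (T₁ : L₁.Theory) (T₂ : L₂.Theory)

/-- A judgment about a run of the procedure: `((true, P), r)` says that the rules lead from `P` to
the result `r`, and `((false, P), r)` that they do so from a purification of `P`. -/
abbrev Judgment (L₁ L₂ : FirstOrder.Language.{0, 0}) : Type :=
  (Bool × Pair (L₁.sum L₂)) × Option (QF (L₁.sum L₂))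

/-- The inference rules for the judgments that precede the application of the rules. -/
def PurifyInference (x : Judgment L₁ L₂ × List (Judgment L₁ L₂)) : Prop :=
  (∃ Q, PurifyStep x.1.1.2 Q ∧ x.2 = [((false, Q), x.1.2)]) ∨
  (((∀ φ ∈ x.1.1.2.A, IsPure φ) ∧ ∀ φ ∈ x.1.1.2.B, IsPure φ) ∧
    x.2 = [((true, x.1.1.2), x.1.2)])

/-- The inference rules for the judgments about the application of the rules. -/
def RunInference (x : Judgment L₁ L₂ × List (Judgment L₁ L₂)) : Prop :=
  (QF.falsum ∈ x.1.1.2.A ∧ x.1.2 = some QF.falsum ∧ x.2 = []) ∨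
  (QF.falsum ∈ x.1.1.2.B ∧ x.1.2 = some QF.top ∧ x.2 = []) ∨
  (Saturated T₁ T₂ x.1.1.2 ∧ x.1.2 = none ∧ x.2 = []) ∨
  (∃ y : List (Pair (L₁.sum L₂)) × List (QF (L₁.sum L₂)) × QF (L₁.sum L₂),
    Step T₁ T₂ x.1.1.2 y.1 y.2.1 y.2.2 ∧ y.2.1.length = y.1.length ∧ x.1.2 = some y.2.2 ∧
      x.2 = (y.1.zip y.2.1).map fun q => ((true, q.1), some q.2)) ∨
  (∃ y : (List (Pair (L₁.sum L₂)) × List (QF (L₁.sum L₂)) × QF (L₁.sum L₂)) × Pair (L₁.sum L₂),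
    Step T₁ T₂ x.1.1.2 y.1.1 y.1.2.1 y.1.2.2 ∧ y.2 ∈ y.1.1 ∧ x.1.2 = none ∧
      x.2 = [((true, y.2), none)])

/-- The inference rules for all the judgments. -/
def Inference (x : Judgment L₁ L₂ × List (Judgment L₁ L₂)) : Prop :=
  (x.1.1.1 = false ∧ PurifyInference x) ∨ (x.1.1.1 = true ∧ RunInference T₁ T₂ x)

variable {T₁ T₂}

/-- Every inference mirrors a purification step, a rule or a leaf of a run. Only this direction is
needed: the inferences use selected rule instances, and that some result is derivable is shown
directly. -/
theorem Derivable.sound {x : Judgment L₁ L₂} (h : Derivable (Inference T₁ T₂) x) :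
    (x.1.1 = true → Run T₁ T₂ x.1.2 x.2) ∧
      (x.1.1 = false → ∃ Q, Purifies x.1.2 Q ∧ Run T₁ T₂ Q x.2) := by
  induction h with
  | intro x l hl hJ ih =>
    obtain ⟨⟨b, P⟩, r⟩ := x
    rcases hJ with ⟨rfl : b = false, hJ⟩ | ⟨rfl : b = true, hJ⟩
    · refine ⟨nofun, fun _ => ?_⟩
      rcases hJ with ⟨Q, hPQ, rfl : l = [((false, Q), r)]⟩ | ⟨hp, rfl : l = [((true, P), r)]⟩
      · obtain ⟨R, hR, hr⟩ := (ih _ (List.mem_singleton.2 rfl)).2 rfl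
        exact ⟨R, ⟨hR.1.head hPQ, hR.2⟩, hr⟩
      · exact ⟨P, ⟨.refl, hp⟩, (ih _ (List.mem_singleton.2 rfl)).1 rfl⟩
    · refine ⟨fun _ => ?_, nofun⟩
      rcases hJ with ⟨h, rfl : r = _, -⟩ | ⟨h, rfl : r = _, -⟩ | ⟨h, rfl : r = _, -⟩ |
        ⟨⟨o, ιs, ι⟩, h, hlen, rfl : r = _, rfl : l = _⟩ | ⟨⟨⟨o, ιs, ι⟩, Q⟩, h, hQ, rfl : r = _,
          rfl : l = _⟩
      · exact .closeA P h
      · exact .closeB P h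
      · exact .saturated P h.isOpen fun _ _ => h.not_rule
      · obtain ⟨instr, hR, rfl : instr ιs = ι⟩ := h.rule
        exact .node P o instr ιs hR hlen fun q hq =>
          (ih ((true, q.1), some q.2) (List.mem_map.2 ⟨q, hq, rfl⟩)).1 rfl
      · obtain ⟨instr, hR, -⟩ := h.rule
        exact .fail P Q ⟨o, instr, hR, hQ⟩ ((ih _ (List.mem_singleton.2 rfl)).1 rfl)

theorem mem_zip_map {α β : Type} {l : List α} {f : α → β} {q : α × β} (h : q ∈ l.zip (l.map f)) :
    q.1 ∈ l ∧ q.2 = f q.1 := by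
  induction l with
  | nil => simp at h
  | cons a l ih =>
    rw [List.map_cons, List.zip_cons_cons, List.mem_cons] at h
    rcases h with rfl | h
    · exact ⟨List.mem_cons_self, rfl⟩
    · exact ⟨List.mem_cons_of_mem _ (ih h).1, (ih h).2⟩

/-- Induction along the terminating relation, without assuming unsatisfiability: either the pair is
a leaf, or some outcome has a derivable failure, which is passed on, or all outcomes have formulae,
to which the instruction is applied. -/
theorem exists_derivable_run (hei₁ : EqualityInterpolating T₁) (hei₂ : EqualityInterpolating T₂)
    (P : Pair (L₁.sum L₂)) : ∃ r, Derivable (Inference T₁ T₂) ((true, P), r) := by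
  induction P using (next_wellFounded (T₁ := T₁) (T₂ := T₂)).induction with
  | _ P ih =>
    by_cases hA : QF.falsum ∈ P.A
    · exact ⟨_, .intro _ [] (by simp) (Or.inr ⟨rfl, Or.inl ⟨hA, rfl, rfl⟩⟩)⟩
    by_cases hB : QF.falsum ∈ P.B
    · exact ⟨_, .intro _ [] (by simp) (Or.inr ⟨rfl, Or.inr (Or.inl ⟨hB, rfl, rfl⟩)⟩)⟩
    rcases saturated_or_exists_step hei₁ hei₂ (P := P) ⟨hA, hB⟩ with h | ⟨o, h⟩
    · exact ⟨_, .intro _ [] (by simp) (Or.inr ⟨rfl, Or.inr (Or.inr (Or.inl ⟨h, rfl, rfl⟩))⟩)⟩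
    have hnext : ∀ Q ∈ o, ∃ r, Derivable (Inference T₁ T₂) ((true, Q), r) := fun Q hQ => by
      obtain ⟨ι, hι⟩ := h []
      obtain ⟨instr, hR, -⟩ := hι.rule
      exact ih Q ⟨o, instr, hR, hQ⟩
    by_cases hf : ∃ Q ∈ o, Derivable (Inference T₁ T₂) ((true, Q), none)
    · obtain ⟨Q, hQ, hd⟩ := hf
      obtain ⟨ι, hι⟩ := h []
      exact ⟨none, .intro _ [((true, Q), none)] (by simpa using hd) (Or.inr ⟨rfl,
        Or.inr (Or.inr (Or.inr (Or.inr ⟨⟨⟨o, [], ι⟩, Q⟩, hι, hQ, rfl, rfl⟩)))⟩)⟩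
    -- If no outcome has a derivable failure, the result provided by induction for each outcome is a
    -- formula; pairs outside `o` receive a dummy value.
    · have hs : ∀ Q : Pair (L₁.sum L₂), ∃ θ : QF (L₁.sum L₂), Q ∈ o →
          Derivable (Inference T₁ T₂) ((true, Q), some θ) := fun Q => by
        by_cases hQ : Q ∈ o
        · obtain ⟨_ | θ, hd⟩ := hnext Q hQ
          · exact absurd ⟨Q, hQ, hd⟩ hf
          · exact ⟨θ, fun _ => hd⟩
        · exact ⟨.falsum, fun h => absurd h hQ⟩
      choose f hf using hs
      obtain ⟨ι, hι⟩ := h (o.map f)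
      refine ⟨some ι, .intro _ _ ?_ (Or.inr ⟨rfl, Or.inr (Or.inr (Or.inr (Or.inl
        ⟨⟨o, o.map f, ι⟩, hι, List.length_map _, rfl, rfl⟩)))⟩)⟩
      intro x hx
      obtain ⟨q, hq, rfl⟩ := List.mem_map.1 hx
      obtain ⟨h₁, h₂⟩ := mem_zip_map hq
      rw [h₂]
      exact hf _ h₁

theorem exists_derivable (hei₁ : EqualityInterpolating T₁) (hei₂ : EqualityInterpolating T₂)
    (P : Pair (L₁.sum L₂)) : ∃ r, Derivable (Inference T₁ T₂) ((false, P), r) := by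
  obtain ⟨Q, hPQ, hp⟩ := exists_purification P
  induction hPQ using Relation.ReflTransGen.head_induction_on with
  | refl =>
    obtain ⟨r, hr⟩ := exists_derivable_run hei₁ hei₂ Q
    exact ⟨r, .intro _ [((true, Q), r)] (by simpa using hr)
      (Or.inl ⟨rfl, Or.inr ⟨hp, rfl⟩⟩)⟩
  | head h _ ih =>
    obtain ⟨r, hr⟩ := ih
    exact ⟨r, .intro _ [((false, _), r)] (by simpa using hr) (Or.inl ⟨rfl, Or.inl ⟨_, h, rfl⟩⟩)⟩

variable [Primcodable (Σ n, L₁.Functions n)] [Primcodable (Σ n, L₁.Relations n)]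
  [Primcodable (Σ n, L₂.Functions n)] [Primcodable (Σ n, L₂.Relations n)]
  [Primcodable (Σ n, (L₁.sum L₂).Functions n)] [Primcodable (Σ n, (L₁.sum L₂).Relations n)]
  (hL₁ : EffectiveArities L₁) (hL₂ : EffectiveArities L₂) (hL : EffectiveArities (L₁.sum L₂))
  {α : Type} [Primcodable α]
include hL

theorem computable_alternatives {A : α → List (QF (L₁.sum L₂))} (hA : Computable A) :
    Computable fun a => alternatives (A a) := by
  classical
  refine (computable_ite (ComputablePred.eq (computable_assignments hL hA) (Computable.const []))
    (Computable.const [ [QF.falsum] ]) (computable_assignments hL hA)).of_eq fun a => ?_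
  unfold alternatives
  congr

theorem semidecidable_purifyStep_left {P Q : α → Pair (L₁.sum L₂)} (hP : Computable P)
    (hQ : Computable Q) : Semidecidable fun a =>
      ∃ x : ℕ × (L₁.sum L₂).Term ℕ × List (QF (L₁.sum L₂)), (P a).Fresh x.1 ∧
        (termConsts x.2.1 ⊆ constListOf (P a).A ∧ (x.2.2.map (QF.subst x.1 x.2.1) = (P a).A ∧
          Q a = ⟨QF.equal (Term.var x.1) x.2.1 :: x.2.2, (P a).B⟩)) := by
  have hP' : Computable fun y : α × (ℕ × (L₁.sum L₂).Term ℕ × List (QF (L₁.sum L₂))) => P y.1 :=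
    hP.comp .fst
  have hd : Computable fun y : α × (ℕ × (L₁.sum L₂).Term ℕ × List (QF (L₁.sum L₂))) => y.2.1 :=
    Computable.fst.comp .snd
  have ht : Computable fun y : α × (ℕ × (L₁.sum L₂).Term ℕ × List (QF (L₁.sum L₂))) => y.2.2.1 :=
    Computable.fst.comp (Computable.snd.comp .snd)
  have hA : Computable fun y : α × (ℕ × (L₁.sum L₂).Term ℕ × List (QF (L₁.sum L₂))) => y.2.2.2 :=
    Computable.snd.comp (Computable.snd.comp .snd)
  refine Semidecidable.exists (r := fun y : α × (ℕ × (L₁.sum L₂).Term ℕ × List (QF (L₁.sum L₂))) =>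
    (P y.1).Fresh y.2.1 ∧ (termConsts y.2.2.1 ⊆ constListOf (P y.1).A ∧
      (y.2.2.2.map (QF.subst y.2.1 y.2.2.1) = (P y.1).A ∧
        Q y.1 = ⟨QF.equal (Term.var y.2.1) y.2.2.1 :: y.2.2.2, (P y.1).B⟩)))
    (ComputablePred.semidecidable ?_)
  refine (computablePred_fresh hL hP' hd).and (ComputablePred.and ?_ (ComputablePred.and ?_ ?_))
  · exact ComputablePred.ball (r := fun z : (α × (ℕ × (L₁.sum L₂).Term ℕ ×
      List (QF (L₁.sum L₂)))) × ℕ => z.2 ∈ constListOf (P z.1.1).A) (computable_termConsts hL ht)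
      (ComputablePred.mem .snd ((computable_constListOf hL (computable_pairA hP')).comp .fst))
  · exact ComputablePred.eq (computable_map (g := fun (y : α × (ℕ × (L₁.sum L₂).Term ℕ ×
      List (QF (L₁.sum L₂)))) (φ : QF (L₁.sum L₂)) => φ.subst y.2.1 y.2.2.1) hA
      (computable_subst hL (hd.comp .fst) (ht.comp .fst) .snd)) (computable_pairA hP')
  · exact ComputablePred.eq (hQ.comp .fst) (computable_pairMk (Computable.list_cons.comp
      (computable_equal hL (computable_var hL hd) ht) hA) (computable_pairB hP'))

theorem semidecidable_purifyStep {P Q : α → Pair (L₁.sum L₂)} (hP : Computable P)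
    (hQ : Computable Q) : Semidecidable fun a => PurifyStep (P a) (Q a) := by
  -- A purification step in the second component is one in the first component of the swapped pairs.
  refine ((semidecidable_purifyStep_left hL hP hQ).or (semidecidable_purifyStep_left hL
    (computable_swap hP) (computable_swap hQ))).of_eq fun a => ?_
  have hsub {t : (L₁.sum L₂).Term ℕ} {A : List (QF (L₁.sum L₂))} :
      termConsts t ⊆ constListOf A ↔ t.varFinset ⊆ constsOf A := by
    simp only [List.subset_def, Finset.subset_iff, mem_termConsts, mem_constListOf]
  simp only [hsub, Prod.exists]
  constructor
  · rintro (⟨d, t, A', h₁, h₂, h₃, h₄⟩ | ⟨d, t, B', h₁, h₂, h₃, h₄⟩)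
    · rw [h₄]; exact .left _ d t A' h₁ h₂ h₃
    · have h₅ : Q a = ⟨(P a).A, QF.equal (Term.var d) t :: B'⟩ := congrArg Pair.swap h₄
      rw [h₅]
      exact .right _ d t B' (by simpa [Pair.Fresh, Pair.swap, and_comm] using h₁) h₂ h₃
  · generalize P a = P, Q a = Q
    rintro (⟨d, t, A', h₁, h₂, h₃⟩ | ⟨d, t, B', h₁, h₂, h₃⟩)
    · exact Or.inl ⟨d, t, A', h₁, h₂, h₃, rfl⟩
    · exact Or.inr ⟨d, t, B', by simpa [Pair.Fresh, Pair.swap, and_comm] using h₁, h₂, h₃, rfl⟩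

section

variable (hi₁ : (inverseInl : LHomInverse
    (FirstOrder.Language.LHom.sumInl : L₁ →ᴸ L₁.sum L₂)).IsComputable)
  (hi₂ : (inverseInr : LHomInverse
    (FirstOrder.Language.LHom.sumInr : L₂ →ᴸ L₁.sum L₂)).IsComputable)
include hL₁ hL₂ hi₁ hi₂

/-- An atom is over a component signature exactly when the partial inverse of the inclusion is
defined at it, and this inverse is computable. -/
theorem computablePred_isPure {A : α → List (QF (L₁.sum L₂))} (hA : Computable A) :
    ComputablePred fun a => ∀ φ ∈ A a, IsPure φ := by
  have hatom : ComputablePred fun p : QF (L₁.sum L₂) =>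
      (∃ q : QF L₁, q.lift FirstOrder.Language.LHom.sumInl = p) ∨
        ∃ q : QF L₂, q.lift FirstOrder.Language.LHom.sumInr = p := by
    have htrue {β : Type} [Primcodable β] : ComputablePred fun _ : β => True :=
      computablePred_of_bool (Computable.const true) fun _ => by simp
    refine ((ComputablePred.bex_option (r := fun _ => True)
      (computable_unlift hL₁ hL hi₁ Computable.id) htrue).or
      (ComputablePred.bex_option (r := fun _ => True)
      (computable_unlift hL₂ hL hi₂ Computable.id) htrue)).of_eq fun p => ?_
    simp only [QF.unlift_eq_some, and_true, id]
  refine (ComputablePred.ball (r := fun x : α × QF (L₁.sum L₂) => ∀ p ∈ x.2.atomList,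
    (∃ q : QF L₁, q.lift FirstOrder.Language.LHom.sumInl = p) ∨
      ∃ q : QF L₂, q.lift FirstOrder.Language.LHom.sumInr = p) hA ?_).of_eq fun a => ?_
  · exact ComputablePred.ball (r := fun x : (α × QF (L₁.sum L₂)) × QF (L₁.sum L₂) =>
      (∃ q : QF L₁, q.lift FirstOrder.Language.LHom.sumInl = x.2) ∨
        ∃ q : QF L₂, q.lift FirstOrder.Language.LHom.sumInr = x.2)
      (computable_atomList hL .snd) (hatom.comp .snd)
  · simp only [QF.mem_atomList, IsPure]

theorem semidecidable_purifyInference :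
    Semidecidable (PurifyInference (L₁ := L₁) (L₂ := L₂)) := by
  have hP : Computable fun x : Judgment L₁ L₂ × List (Judgment L₁ L₂) => x.1.1.2 :=
    Computable.snd.comp (Computable.fst.comp .fst)
  have hr : Computable fun x : Judgment L₁ L₂ × List (Judgment L₁ L₂) => x.1.2 :=
    Computable.snd.comp .fst
  refine Semidecidable.or ?_ (ComputablePred.semidecidable ?_)
  · refine Semidecidable.exists (r := fun y : (Judgment L₁ L₂ × List (Judgment L₁ L₂)) ×
      Pair (L₁.sum L₂) => PurifyStep y.1.1.1.2 y.2 ∧ y.1.2 = [((false, y.2), y.1.1.2)]) ?_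
    exact (semidecidable_purifyStep hL (hP.comp .fst) .snd).and
      (ComputablePred.semidecidable (ComputablePred.eq (Computable.snd.comp .fst)
        (Computable.list_cons.comp (((Computable.const false).pair .snd).pair (hr.comp .fst))
          (Computable.const []))))
  · exact ((computablePred_isPure hL₁ hL₂ hL hi₁ hi₂ (computable_pairA hP)).and
      (computablePred_isPure hL₁ hL₂ hL hi₁ hi₂ (computable_pairB hP))).and
      (ComputablePred.eq .snd (Computable.list_cons.comp
        (((Computable.const true).pair hP).pair hr) (Computable.const [])))

variable (hg₁ : ComputableLHom (FirstOrder.Language.LHom.sumInl : L₁ →ᴸ L₁.sum L₂))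
  (hg₂ : ComputableLHom (FirstOrder.Language.LHom.sumInr : L₂ →ᴸ L₁.sum L₂))
  (hT₁ : DecidableSMT T₁) (hT₂ : DecidableSMT T₂)
include hT₁ hT₂

/-- That no rule applies is a statement about all rule instances; expressed as saturation it
consists of decidable conditions, so reporting a stuck pair is effective as well. -/
theorem computablePred_saturated {P : α → Pair (L₁.sum L₂)} (hP : Computable P) :
    ComputablePred fun a => Saturated T₁ T₂ (P a) :=
  ((computablePred_isOpen hP).and
    ((computablePred_containsAssignment hL (computable_pairA hP)).and
    ((computablePred_containsAssignment hL (computable_pairB hP)).and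
    ((computablePred_separated hL₁ hL hi₁ hT₁ hP).and
      (computablePred_separated hL₂ hL hi₂ hT₂ hP))))).of_eq fun _ =>
    ⟨fun ⟨h₁, h₂, h₃, h₄, h₅⟩ => ⟨h₁, h₂, h₃, h₄, h₅⟩,
      fun h => ⟨h.isOpen, h.containsA, h.containsB, h.separated₁, h.separated₂⟩⟩

include hg₁ hg₂

theorem semidecidable_step {P : α → Pair (L₁.sum L₂)} {o : α → List (Pair (L₁.sum L₂))}
    {ιs : α → List (QF (L₁.sum L₂))} {ι : α → QF (L₁.sum L₂)} (hP : Computable P)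
    (ho : Computable o) (hιs : Computable ιs) (hι : Computable ι) :
    Semidecidable fun a => Step T₁ T₂ (P a) (o a) (ιs a) (ι a) := by
  have hA := computable_pairA hP
  have hB := computable_pairB hP
  have hop := computablePred_isOpen hP
  have mA : Computable fun a => (alternatives (P a).A).map fun β =>
      (⟨β ++ (P a).A, (P a).B⟩ : Pair (L₁.sum L₂)) :=
    computable_map (g := fun (a : α) (β : List (QF (L₁.sum L₂))) =>
      (⟨β ++ (P a).A, (P a).B⟩ : Pair (L₁.sum L₂))) (computable_alternatives hL hA)
      (computable_pairMk (Computable.list_append.comp .snd (hA.comp .fst)) (hB.comp .fst))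
  have mB : Computable fun a => (alternatives (P a).B).map fun β =>
      (⟨(P a).A, β ++ (P a).B⟩ : Pair (L₁.sum L₂)) :=
    computable_map (g := fun (a : α) (β : List (QF (L₁.sum L₂))) =>
      (⟨(P a).A, β ++ (P a).B⟩ : Pair (L₁.sum L₂))) (computable_alternatives hL hB)
      (computable_pairMk (hA.comp .fst) (Computable.list_append.comp .snd (hB.comp .fst)))
  exact (ComputablePred.semidecidable ((hop.and
      (computablePred_containsAssignment hL hA).not).and ((ComputablePred.eq ho mA).and
      (ComputablePred.eq hι (computable_bigOr hL hιs))))).or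
    ((ComputablePred.semidecidable ((hop.and
      (computablePred_containsAssignment hL hB).not).and ((ComputablePred.eq ho mB).and
      (ComputablePred.eq hι (computable_bigAnd hL hιs))))).or
    ((semidecidable_theoryStep hL₁ hL hi₁ hg₁ hT₁ hP ho hιs hι).or
      (semidecidable_theoryStep hL₂ hL hi₂ hg₂ hT₂ hP ho hιs hι)))

theorem semidecidable_runInference : Semidecidable (RunInference T₁ T₂) := by
  have hP : Computable fun x : Judgment L₁ L₂ × List (Judgment L₁ L₂) => x.1.1.2 :=
    Computable.snd.comp (Computable.fst.comp .fst)
  have hr : Computable fun x : Judgment L₁ L₂ × List (Judgment L₁ L₂) => x.1.2 :=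
    Computable.snd.comp .fst
  have hr_eq (r : Option (QF (L₁.sum L₂))) : ComputablePred fun x : Judgment L₁ L₂ ×
      List (Judgment L₁ L₂) => x.1.2 = r := ComputablePred.eq hr (Computable.const r)
  have hnil : ComputablePred fun x : Judgment L₁ L₂ × List (Judgment L₁ L₂) => x.2 = [] :=
    ComputablePred.eq .snd (Computable.const [])
  have h₁ := ((ComputablePred.mem (Computable.const QF.falsum) (computable_pairA hP)).and
    ((hr_eq (some QF.falsum)).and hnil)).semidecidable
  have h₂ := ((ComputablePred.mem (Computable.const QF.falsum) (computable_pairB hP)).and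
    ((hr_eq (some QF.top)).and hnil)).semidecidable
  have h₃ := ((computablePred_saturated hL₁ hL₂ hL hi₁ hi₂ hT₁ hT₂ hP).and
    ((hr_eq none).and hnil)).semidecidable
  refine h₁.or (h₂.or (h₃.or (Semidecidable.or ?_ ?_)))
  · let β := (Judgment L₁ L₂ × List (Judgment L₁ L₂)) ×
      (List (Pair (L₁.sum L₂)) × List (QF (L₁.sum L₂)) × QF (L₁.sum L₂))
    have ho : Computable fun y : β => y.2.1 := Computable.fst.comp .snd
    have hιs : Computable fun y : β => y.2.2.1 := Computable.fst.comp (Computable.snd.comp .snd)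
    have hι : Computable fun y : β => y.2.2.2 := Computable.snd.comp (Computable.snd.comp .snd)
    have hz : Computable fun y : β => (y.2.1.zip y.2.2.1).map fun q =>
        (((true, q.1), some q.2) : Judgment L₁ L₂) :=
      computable_map (g := fun (_ : β) (q : Pair (L₁.sum L₂) × QF (L₁.sum L₂)) =>
        (((true, q.1), some q.2) : Judgment L₁ L₂)) (computable_zip ho hιs)
        (((Computable.const true).pair (Computable.fst.comp .snd)).pair
          (Computable.option_some.comp (Computable.snd.comp .snd)))
    refine Semidecidable.exists (r := fun y : β => Step T₁ T₂ y.1.1.1.2 y.2.1 y.2.2.1 y.2.2.2 ∧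
      y.2.2.1.length = y.2.1.length ∧ y.1.1.2 = some y.2.2.2 ∧
        y.1.2 = (y.2.1.zip y.2.2.1).map fun q => ((true, q.1), some q.2)) ?_
    exact (semidecidable_step hL₁ hL₂ hL hi₁ hi₂ hg₁ hg₂ hT₁ hT₂ (hP.comp .fst) ho hιs hι).and
      (((ComputablePred.eq (Computable.list_length.comp hιs)
        (Computable.list_length.comp ho)).and ((ComputablePred.eq (hr.comp .fst)
          (Computable.option_some.comp hι)).and
        (ComputablePred.eq (Computable.snd.comp .fst) hz))).semidecidable)
  · let β := (Judgment L₁ L₂ × List (Judgment L₁ L₂)) ×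
      ((List (Pair (L₁.sum L₂)) × List (QF (L₁.sum L₂)) × QF (L₁.sum L₂)) × Pair (L₁.sum L₂))
    have hy : Computable fun y : β => y.2.1 := Computable.fst.comp .snd
    have hQ : Computable fun y : β => y.2.2 := Computable.snd.comp .snd
    refine Semidecidable.exists (r := fun y : β =>
      Step T₁ T₂ y.1.1.1.2 y.2.1.1 y.2.1.2.1 y.2.1.2.2 ∧ y.2.2 ∈ y.2.1.1 ∧ y.1.1.2 = none ∧
        y.1.2 = [((true, y.2.2), none)]) ?_
    exact (semidecidable_step hL₁ hL₂ hL hi₁ hi₂ hg₁ hg₂ hT₁ hT₂ (hP.comp .fst)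
      (Computable.fst.comp hy) (Computable.fst.comp (Computable.snd.comp hy))
      (Computable.snd.comp (Computable.snd.comp hy))).and
      (((ComputablePred.mem hQ (Computable.fst.comp hy)).and (((hr_eq none).comp .fst).and
        (ComputablePred.eq (Computable.snd.comp .fst) (Computable.list_cons.comp
          (((Computable.const true).pair hQ).pair (Computable.const none))
          (Computable.const []))))).semidecidable)

theorem semidecidable_inference : Semidecidable (Inference T₁ T₂) := by
  have hb : Computable fun x : Judgment L₁ L₂ × List (Judgment L₁ L₂) => x.1.1.1 :=
    Computable.fst.comp (Computable.fst.comp .fst)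
  exact ((ComputablePred.eq hb (Computable.const false)).semidecidable.and
    (semidecidable_purifyInference hL₁ hL₂ hL hi₁ hi₂)).or
    ((ComputablePred.eq hb (Computable.const true)).semidecidable.and
      (semidecidable_runInference hL₁ hL₂ hL hi₁ hi₂ hg₁ hg₂ hT₁ hT₂))

/-- The relation between inputs and derivable results is semidecidable and total, so it is
uniformized by an unbounded search. -/
theorem exists_computable_procedure (hei₁ : EqualityInterpolating T₁)
    (hei₂ : EqualityInterpolating T₂) : ∃ F : Pair (L₁.sum L₂) → Option (QF (L₁.sum L₂)),
      Computable F ∧ ∀ P, CI T₁ T₂ P.A P.B (F P) := by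
  have hd := Semidecidable.derivable
    (semidecidable_inference hL₁ hL₂ hL hi₁ hi₂ hg₁ hg₂ hT₁ hT₂)
  obtain ⟨F, hF, h⟩ := Semidecidable.exists_computable (r := fun x : Pair (L₁.sum L₂) ×
    Option (QF (L₁.sum L₂)) => Derivable (Inference T₁ T₂) ((false, x.1), x.2))
    (hd.comp (((Computable.const false).pair .fst).pair .snd)) (exists_derivable hei₁ hei₂)
  exact ⟨F, hF, fun P => (h P).sound.2 rfl⟩

end

end Search

/-- A computable function on pairs of finite sets of formulae, as a function of Gödel numbers. -/
theorem exists_computable_on_codes {L : FirstOrder.Language.{0, 0}}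
    [Primcodable (Σ n, L.Functions n)] [Primcodable (Σ n, L.Relations n)]
    (hL : EffectiveArities L) {F : Pair L → Option (QF L)} (hF : Computable F) :
    ∃ f : ℕ → ℕ, Computable f ∧ ∀ A B : List (QF L),
      f (Nat.pair (listCode A) (listCode B)) = Encodable.encode ((F ⟨A, B⟩).map QF.code) := by
  let D : ℕ → List (QF L) := fun n =>
    (Denumerable.ofNat (List ℕ) n).map (ofCode QF.code QF.code_injective)
  have hD : Computable D :=
    computable_map (g := fun (_ : ℕ) (m : ℕ) => ofCode QF.code QF.code_injective m)
      computable_ofNat_list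
      ((computable_ofCode QF.code_injective (computablePred_range_code hL)).comp .snd)
  have hDc (A : List (QF L)) : D (listCode A) = A := by
    simp only [D, listCode, Denumerable.ofNat_encode, List.map_map, Function.comp_def, ofCode_code,
      List.map_id']
  have hP : Computable fun n : ℕ => F ⟨D n.unpair.1, D n.unpair.2⟩ :=
    hF.comp (computable_pairMk (hD.comp computable_unpair_fst) (hD.comp computable_unpair_snd))
  refine ⟨fun n => Encodable.encode ((F ⟨D n.unpair.1, D n.unpair.2⟩).map QF.code), ?_,
    fun A B => by simp only [Nat.unpair_pair, hDc]⟩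
  exact Computable.encode.comp (Computable.option_map (g := fun (_ : ℕ) (φ : QF L) => φ.code) hP
    ((computable_qfCode hL).comp .snd))

end CombInterp

/-! ### The combined interpolation theorem -/

theorem mainTheorem1 (L₁ L₂ : FirstOrder.Language.{0, 0})
    [Primcodable (Σ n, L₁.Functions n)] [Primcodable (Σ n, L₁.Relations n)]
    [Primcodable (Σ n, L₂.Functions n)] [Primcodable (Σ n, L₂.Relations n)]
    (hL₁ : EffectiveArities L₁) (hL₂ : EffectiveArities L₂)
    (T₁ : L₁.Theory) (T₂ : L₂.Theory)
    (hsi₁ : StablyInfinite T₁) (hsi₂ : StablyInfinite T₂)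
    (hei₁ : EqualityInterpolating T₁) (hei₂ : EqualityInterpolating T₂)
    (hsmt₁ : DecidableSMT T₁) (hsmt₂ : DecidableSMT T₂) :
    -- termination: there is no infinite sequence of rule applications
    WellFounded (Next T₁ T₂) ∧
    -- soundness: a formula computed by the procedure is an interpolant
    (∀ (A B : List (QF (L₁.sum L₂))) (θ : QF (L₁.sum L₂)),
      CI T₁ T₂ A B (some θ) → IsInterpolant (unionTheory T₁ T₂) A B θ) ∧
    -- completeness: on an unsatisfiable pair the procedure can always be completed, and it always
    -- computes a formula
    (∀ (A B : List (QF (L₁.sum L₂))) (P : Pair (L₁.sum L₂)),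
      ¬ Sat (unionTheory T₁ T₂) ({φ | φ ∈ A} ∪ {φ | φ ∈ B}) → Purifies ⟨A, B⟩ P →
      (∃ θ, Run T₁ T₂ P (some θ)) ∧ ¬ Run T₁ T₂ P none) ∧
    -- effectiveness: the procedure can be carried out by an algorithm, on every input
    (∃ f : ℕ → ℕ, Computable f ∧ ∀ A B : List (QF (L₁.sum L₂)),
      ∃ r : Option (QF (L₁.sum L₂)),
        f (Nat.pair (listCode A) (listCode B)) = Encodable.encode (r.map QF.code) ∧
        CI T₁ T₂ A B r) := by
  refine ⟨next_wellFounded, fun A B θ h => h.sound, fun A B P hAB hP => ?_, ?_⟩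
  · have h : P.PureUnsat (unionTheory T₁ T₂) := hP.pureUnsat hAB
    exact ⟨h.exists_run hsi₁ hsi₂ hei₁ hei₂, h.not_run_none hsi₁ hsi₂ hei₁ hei₂⟩
  -- These structures induce the coding of the union signature used in the statement, so the
  -- function obtained below works on the same Gödel numbers.
  · let _ := sumFunctionsPrimcodable L₁ L₂
    let _ := sumRelationsPrimcodable L₁ L₂
    have hL := effectiveArities_sum hL₁ hL₂
    obtain ⟨F, hF, h⟩ := exists_computable_procedure hL₁ hL₂ hL isComputable_inverseInl
      isComputable_inverseInr computableLHom_sumInl computableLHom_sumInr hsmt₁ hsmt₂ hei₁ hei₂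
    obtain ⟨f, hf, hfF⟩ := exists_computable_on_codes hL hF
    exact ⟨f, hf, fun A B => ⟨F ⟨A, B⟩, hfF A B, h ⟨A, B⟩⟩⟩
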